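/- All graphs are finite and simple. A graph is $d$-degenerate if its vertices can be linearly ordered so that every vertex has at most $d$ neighbours greater than itself. An edge coloring is acyclic if it is proper (edges sharing an endpoint have distinct colors) and no cycle receives exactly two colors. Let $G$ be a $d$-degenerate graph of maximum degree $\Delta$, and let $q=\lceil(2+\epsilon)\Delta\rceil$ with $\epsilon=4\sqrt{d/\Delta}$ (and $q=0$ if $\Delta=0$). Then $G$ has an acyclic edge coloring with $q$ colors. Moreover, such a coloring can be found in randomized polynomial time by the following recursive walk. For an uncolored edge $e=uv$ in a partial edge coloring of $G$, call a color 4-forbidden if giving it to $e$ would make the coloring improper or create a bichromatic 4-cycle through $e$, and 4-available otherwise. Start by coloring the edges one by one, in a fixed order, each with the first 4-available color in a fixed order of the palette. As long as there are bichromatic cycles, call Address$(C)$ for the first bichromatic cycle $C$ in a fixed order of the cycles of $G$. The procedure Address$(C)$ uncolors all edges of $C$ except two fixed adjacent edges $e_1^C,e_2^C$, then goes around $C$ starting after $e_2^C$ and gives each uncolored edge a color chosen uniformly at random among those 4-available for it at that time; afterwards, as long as there are bichromatic cycles that share an edge with $C$ (including $C$ itself), it calls Address$(C')$ for the first such cycle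 $C'$. There is a polynomial $P$, independent of $G$, $d$, $\Delta$ and $s$, such that for every $d$-degenerate graph $G$ with $n$ vertices and maximum degree $\Delta$ and every integer $s\ge 0$, with probability at least $1-2^{-s}$ the walk with $q$ colors ends after at most $P(n+q+s)$ elementary operations with an acyclic edge coloring of $G$ with $q$ colors. Here the operations needed for finding bichromatic cycles (by following, from every vertex, the edges of each pair of colors) and 4-available colors are counted, and the elementary operations are single table look-ups and updates, comparisons of vertices or colors, and elementary list operations; drawing a uniformly random element of a list of length $m$ is counted as at most $m+2$ operations. -/

import Mathlib

open scoped ENNReal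

noncomputable section

/-! ## Graph-theoretic notions -/

/-- `G` is `d`-degenerate: its vertices can be (linearly) ordered so that every vertex has at most
`d` neighbours greater than itself. -/
def IsDegenerate {V : Type*} (G : SimpleGraph V) (d : ℕ) : Prop :=
  ∃ o : LinearOrder V, ∀ v : V, {w | G.Adj v w ∧ o.lt v w}.encard ≤ d

/-- A proper edge colouring: distinct edges that share an endpoint receive distinct colours. -/
def IsProperEdgeColoring {V K : Type*} (G : SimpleGraph V) (c : G.EdgeLabeling K) : Prop :=
  ∀ e f : G.edgeSet, e ≠ f → (∃ v : V, v ∈ (e : Sym2 V) ∧ v ∈ (f : Sym2 V)) → c e ≠ c f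

/-- The set of colours that occur on the edges of a walk. -/
def colorsOn {V K : Type*} {G : SimpleGraph V} (c : G.EdgeLabeling K) {u v : V}
    (p : G.Walk u v) : Set K :=
  {a | ∃ e : G.edgeSet, (e : Sym2 V) ∈ p.edges ∧ c e = a}

/-- An acyclic edge colouring: it is proper, and no cycle receives exactly two colours. -/
def IsAcyclicEdgeColoring {V K : Type*} (G : SimpleGraph V) (c : G.EdgeLabeling K) : Prop :=
  IsProperEdgeColoring G c ∧
    ∀ (v : V) (p : G.Walk v v), p.IsCycle → (colorsOn c p).ncard ≠ 2

/-- The number of colours `⌈(2 + ε) Δ⌉`, where `ε = 4 √(d / Δ)`. (For `Δ = 0` this is `0`, the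
right number for a graph without edges.) -/
def paletteSize (d Δ : ℕ) : ℕ :=
  ⌈(2 + 4 * Real.sqrt ((d : ℝ) / (Δ : ℝ))) * (Δ : ℝ)⌉₊

end

namespace RecursiveWalk

/-! ## Computations with a step counter

Every elementary operation (looking up or changing one entry of a table, comparing two vertices or
two colours, extending a list by one entry, adopting a list by reference) goes through `op` and
costs one unit; every iteration of a loop costs one further unit. -/

/-- A value together with the number of elementary operations spent on computing it. -/
structure Timed (α : Type) where
  val : α
  time : ℕ

instance : Monad Timed where
  pure a := ⟨a, 0⟩
  bind x f := ⟨(f x.val).val, x.time + (f x.val).time⟩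

/-- One elementary operation, with result `a`. -/
def op {α : Type} (a : α) : Timed α := ⟨a, 1⟩

/-- Search a list for an entry that passes a test. -/
def findT {α : Type} (test : α → Timed Bool) : List α → Timed (Option α)
  | [] => op none
  | x :: l => do
    let _ ← op ()
    let b ← test x
    if b then pure (some x) else findT test l

/-- Does some entry of a list pass a test? -/
def anyT {α : Type} (test : α → Timed Bool) (l : List α) : Timed Bool := do
  let o ← findT test l
  op o.isSome

/-- The sublist of the entries that pass a test. -/
def filterT {α : Type} (test : α → Timed Bool) : List α → Timed (List α)
  | [] => op []
  | x :: l => do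
    let b ← test x
    let r ← filterT test l
    if b then op (x :: r) else op r

/-! ## Partial colourings and 4-available colours

Vertices are the elements of `Fin n`, colours those of `Fin q`. -/

/-- A table that holds the colour of every coloured edge, and `none` in all other places. -/
abbrev Table (n q : ℕ) := Sym2 (Fin n) → Option (Fin q)

/-- Is the colour `a` 4-forbidden for the (uncoloured) edge `uv`? That is: is there an edge of
colour `a` at `u` or at `v`, or a 4-cycle `u x y v` in which `ux` and `yv` have the same colour and
`xy` has colour `a`? -/
def fourForbidden {n q : ℕ} (σ : Table n q) (u v : Fin n) (a : Fin q) : Timed Bool :=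
  anyT (fun x => do
    let ux ← op (σ s(u, x))
    let vx ← op (σ s(v, x))
    let b ← op (decide (ux = some a ∨ vx = some a))
    if b then pure true
    else if ux = none then op false
    else anyT (fun y => do
      let xy ← op (σ s(x, y))
      let yv ← op (σ s(y, v))
      op (decide (xy = some a ∧ yv = ux))) (List.finRange n)) (List.finRange n)

/-- The list of the 4-available colours for the (uncoloured) edge `uv`. -/
def available {n q : ℕ} (σ : Table n q) (u v : Fin n) : Timed (List (Fin q)) :=
  filterT (fun a => do
    let b ← fourForbidden σ u v a
    op (!b)) (List.finRange q)

/-- The initial colouring: go through the pairs of vertices in a fixed order and give every edge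
the first colour (in a fixed order of the palette) that is 4-available for it. -/
def greedy {n q : ℕ} (G : SimpleGraph (Fin n)) [DecidableRel G.Adj] :
    List (Fin n × Fin n) → Table n q → Timed (Table n q)
  | [], σ => op σ
  | (u, v) :: l, σ => do
    let b ← op (decide (u < v ∧ G.Adj u v))
    if b then do
      let A ← available σ u v
      let σ' ← op (Function.update σ s(u, v) A.head?)
      greedy G l σ'
    else greedy G l σ

/-! ## Bichromatic cycles

A cycle is stored as the list of its vertices in cyclic order, starting at its least vertex and
continuing with the smaller one of the two neighbours of that vertex on the cycle. Hence every
cycle of the graph has exactly one representation. -/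

/-- From `cur`, follow edges of colours `a, b, a, b, …` for at most `k` edges, until `v₀` is
reached. If it is reached, return the list of the vertices visited before. -/
def traceT {n q : ℕ} (σ : Table n q) (v₀ : Fin n) :
    (k : ℕ) → (cur : Fin n) → (a b : Fin q) → Timed (Option (List (Fin n)))
  | 0, _, _, _ => op none
  | k + 1, cur, a, b => do
    let o ← findT (fun w => do
      let c ← op (σ s(cur, w))
      op (decide (c = some a))) (List.finRange n)
    match o with
    | none => op none
    | some w => do
      let closed ← op (decide (w = v₀))
      if closed then op (some [cur])
      else do
        let r ← traceT σ v₀ k w b a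
        op (r.map fun l => cur :: l)

/-- Is this the chosen representation of a cycle (of length at least 3)? -/
def canonicalT {n : ℕ} : List (Fin n) → Timed Bool
  | v :: x :: y :: l => do
    let smaller ← anyT (fun w => op (decide (w < v))) (x :: y :: l)
    let z ← (⟨(y :: l).getLast (List.cons_ne_nil y l), l.length + 1⟩ : Timed (Fin n))
    let b ← op (decide (x < z))
    op (!smaller && b)
  | _ => op false

/-- The edges `x₀x₁, x₁x₂, …, xₖ₋₁x₀` of the cycle `x₀, x₁, …, xₖ₋₁`, in this order. -/
def edgesT {n : ℕ} (C : List (Fin n)) : Timed (List (Fin n × Fin n)) :=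
  ⟨C.zip (C.rotate 1), 2 * C.length + 1⟩

/-- Do two cycles have an edge in common? -/
def meetT {n : ℕ} (C C' : List (Fin n)) : Timed Bool := do
  let E ← edgesT C
  let E' ← edgesT C'
  anyT (fun e => anyT (fun e' => op (decide (s(e.1, e.2) = s(e'.1, e'.2)))) E') E

/-- Lexicographic comparison of two cycles. -/
def precedesT {n : ℕ} : List (Fin n) → List (Fin n) → Timed Bool
  | _, [] => op false
  | [], _ :: _ => op true
  | x :: l, y :: l' => do
    let lt ← op (decide (x < y))
    if lt then pure true
    else do
      let gt ← op (decide (y < x))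
      if gt then pure false else precedesT l l'

/-- Is `C` to be preferred to the candidate `best` found so far? It has to be canonical, to share an
edge with the cycle `top` (if there is one), and to come before `best` (if there is one). -/
def betterT {n : ℕ} (top best : Option (List (Fin n))) (C : List (Fin n)) : Timed Bool := do
  let b₁ ← canonicalT C
  let b₂ ← (match top with
    | none => op true
    | some D => meetT D C)
  let b₃ ← (match best with
    | none => op true
    | some D => precedesT C D)
  op (b₁ && b₂ && b₃)

/-- Go through a list of starting vertices and pairs of colours, and keep the best cycle. -/
def selectFrom {n q : ℕ} (σ : Table n q) (top : Option (List (Fin n))) :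
    List (Fin n × Fin q × Fin q) → Option (List (Fin n)) → Timed (Option (List (Fin n)))
  | [], best => op best
  | (v, a, b) :: l, best => do
    let o ← traceT σ v n v a b
    match o with
    | none => do
      let _ ← op ()
      selectFrom σ top l best
    | some C => do
      let better ← betterT top best C
      let best' ← op (if better then some C else best)
      selectFrom σ top l best'

/-- The first one, in a fixed order of the cycles, of all the bichromatic cycles of `σ` that share
an edge with `top` (of all the bichromatic cycles of `σ`, if `top = none`). -/
def select {n q : ℕ} (σ : Table n q) (top : Option (List (Fin n))) :
    Timed (Option (List (Fin n))) :=
  selectFrom σ top (List.finRange n ×ˢ (List.finRange q ×ˢ List.finRange q)) none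

/-! ## Recolouring a cycle -/

/-- Remove the colours of a list of edges. -/
def uncolor {n q : ℕ} : List (Fin n × Fin n) → Table n q → Timed (Table n q)
  | [], σ => op σ
  | e :: l, σ => do
    let σ' ← op (Function.update σ s(e.1, e.2) none)
    uncolor l σ'

/-- A uniformly random entry of a list (`none` if the list is empty). -/
noncomputable def draw {α : Type} : List α → PMF (Option α)
  | [] => PMF.pure none
  | a :: l => (PMF.ofMultiset (↑(a :: l) : Multiset α) (by simp)).map some

/-- Give the edges of a list, one after the other, a uniformly random colour among those that are
4-available at the time when the edge is considered. The second argument and the second component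
of the result are the time before and after. -/
noncomputable def recolor {n q : ℕ} :
    List (Fin n × Fin n) → Timed (Table n q) → PMF (Timed (Table n q))
  | [], σ => PMF.pure σ
  | e :: l, σ =>
    let A := available σ.val e.1 e.2
    (draw A.val).bind fun a =>
      recolor l ⟨Function.update σ.val s(e.1, e.2) a, σ.time + A.time + A.val.length + 2⟩

/-- Address a bichromatic cycle: keep the colours of its first two edges, uncolour all its other
edges, and recolour these at random, going around the cycle. -/
noncomputable def address {n q : ℕ} (C : List (Fin n)) (σ : Table n q) : PMF (Timed (Table n q)) :=
  let U : Timed (Table n q) := do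
    let E ← edgesT C
    uncolor (E.drop 2) σ
  recolor (((edgesT C).val).drop 2) U

/-! ## The recursive walk -/

/-- A state of the computation: the current colouring, the stack of the cycles whose recursive
calls have not returned yet (innermost call first), whether the computation has ended, and the
number of elementary operations so far. -/
structure State (n q : ℕ) where
  coloring : Table n q
  stack : List (List (Fin n))
  done : Bool
  time : ℕ

/-- The initial state: the greedy colouring and no recursive call. -/
def start {n : ℕ} (G : SimpleGraph (Fin n)) [DecidableRel G.Adj] (q : ℕ) : State n q :=
  let σ := greedy (q := q) G (List.finRange n ×ˢ List.finRange n) (fun _ => none)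
  ⟨σ.val, [], false, σ.time⟩

/-- One step of the walk. If the innermost call is the one for the cycle `C`, then the first
bichromatic cycle that shares an edge with `C` is addressed, in a new call; if there is none, the
call for `C` returns. If there is no call left, then the first one of all the bichromatic cycles is
addressed; if there is none, the computation ends. -/
noncomputable def step {n q : ℕ} (S : State n q) : PMF (State n q) :=
  if S.done then PMF.pure S
  else
    let o := select S.coloring S.stack.head?
    match o.val, S.stack with
    | some C, stack =>
      (address C S.coloring).map fun σ =>
        ⟨σ.val, C :: stack, false, S.time + o.time + σ.time + 1⟩
    | none, _ :: stack => PMF.pure ⟨S.coloring, stack, false, S.time + o.time + 1⟩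
    | none, [] => PMF.pure ⟨S.coloring, [], true, S.time + o.time + 1⟩

/-- The random state after a given number of steps. -/
noncomputable def run {n : ℕ} (G : SimpleGraph (Fin n)) [DecidableRel G.Adj] (q : ℕ) :
    ℕ → PMF (State n q)
  | 0 => PMF.pure (start G q)
  | N + 1 => (run G q N).bind step

/-- The table assigns a colour to every edge of `G`, and these colours form an acyclic edge
colouring of `G`. -/
def HoldsAcyclicColoring {n q : ℕ} (G : SimpleGraph (Fin n)) (σ : Table n q) : Prop :=
  ∃ c : G.EdgeLabeling (Fin q), IsAcyclicEdgeColoring G c ∧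
    ∀ e : G.edgeSet, σ (e : Sym2 (Fin n)) = some (c e)

end RecursiveWalk

/-! ## Words of up and down steps -/

/-! Three estimates carry the proof.

(1) In a proper partial colouring without bichromatic 4-cycles, at most 2Δ colours are 4-forbidden
for an edge uv. A colour forbidden by a 4-cycle is determined by a colour that occurs at both u and
v, and those common colours are exactly what the union of the colours at u and at v saves
(`Valid.le_length_available`). So the palette always leaves at least 4√(dΔ) choices, and a given
outcome of addressing a cycle of length 2j+2 has probability at most (16dΔ)^(-j).

(2) For j ≥ 2 an edge uv lies on at most (2/3)(4dΔ)^j cycles of length 2j+2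
(`card_evenCycles_through_le`). The rest of such a cycle is a walk of 2j+1 steps, each up or down in
the degeneracy order. A unique step next to a highest point splits the walk into a climbing and a
sinking part, both of even length. The first part is counted from its start and the second backwards
from its end, so steps with d choices are at least as frequent as steps with Δ choices; the
splitting step is then fixed by its ends. The 4^j splittings give (4dΔ)^j. If Δ > 3d, at least half
of them are unbalanced and gain a factor d/Δ < 1/3, whence the 2/3; if Δ ≤ 3d, the trivial bound is
good enough.

(3) Addressing C loses no information: the two edges that keep their colours show both colours of C,
so C and the new colouring determine the old one (`Bichromatic.eq_of_address`). Hence even the sum,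
over all old colourings, of the probabilities of reaching a fixed new colouring is at most
(16dΔ)^(-j) (`sum_addressProb_le`).

When a call for C returns, no bichromatic cycle meets C. Therefore the cycles called directly by one
call increase in the fixed order, and they can be charged to distinct edges of the calling cycle.
The weight of all such sequences is at most the product, over the edges e of the caller, of 1 plus
the weight of the cycles through e (`one_add_sum_le_prod`). If S bounds each factor, the recursion
closes as soon as 1 + Σ y² r^(|C|-2) S^|C| ≤ S, summed over the cycles C through e, where r =
1/(4√(dΔ)). By (2) this holds for y = 101/100 and S = 6/5 (`one_add_through_le`). The slack y²
supplies one factor y for the call and one for its return, so the probability of surviving N steps,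
summed over all colourings, decays like y^(-N) (`sum_undone_le`). As there are at most 2^(qn²)
tables, a constant multiple of qn² + n² + 1 + s steps suffices, and each step is polynomial. The
existence statement follows because an event of positive probability is nonempty. -/

namespace UpDown

open Finset

/-- All words of length `n` in two letters (`true`: up, `false`: down). -/
def words : ℕ → Finset (List Bool)
  | 0 => {[]}
  | n + 1 => (words n).image (List.cons true) ∪ (words n).image (List.cons false)

theorem mem_words {n : ℕ} {w : List Bool} : w ∈ words n ↔ w.length = n := by
  induction n generalizing w with
  | zero => simp [words]
  | succ n ih =>
    rcases w with _ | ⟨b, w⟩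
    · simp [words]
    · cases b <;> simp [words, ih]

theorem sum_words_succ {M : Type*} [AddCommMonoid M] (n : ℕ) (f : List Bool → M) :
    ∑ w ∈ words (n + 1), f w =
      ∑ w ∈ words n, f (true :: w) + ∑ w ∈ words n, f (false :: w) := by
  rw [words, sum_union, sum_image, sum_image]
  · intro a _ b _ h; exact List.tail_eq_of_cons_eq h
  · intro a _ b _ h; exact List.tail_eq_of_cons_eq h
  · rw [disjoint_left]; intro w h1 h2
    simp only [mem_image] at h1 h2
    obtain ⟨a, _, rfl⟩ := h1
    obtain ⟨b, _, h⟩ := h2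
    simp at h

theorem card_words (n : ℕ) : (words n).card = 2 ^ n := by
  induction n with
  | zero => simp [words]
  | succ n ih =>
    rw [card_eq_sum_ones] at *
    rw [sum_words_succ, ih, pow_succ]; ring

/-- The number of up steps minus the number of down steps. -/
def height (w : List Bool) : ℤ := w.count true - w.count false

@[simp] theorem height_nil : height [] = 0 := by simp [height]
@[simp] theorem height_true (w : List Bool) : height (true :: w) = height w + 1 := by
  simp [height]; ring
@[simp] theorem height_false (w : List Bool) : height (false :: w) = height w - 1 := by
  simp [height]; ring
theorem height_append (w w' : List Bool) : height (w ++ w') = height w + height w' := by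
  simp [height]; ring

theorem height_parity (w : List Bool) : (2 : ℤ) ∣ height w - w.length := by
  induction w with
  | nil => simp
  | cons b w ih => cases b <;> simp <;> omega

/-- No prefix is higher than the whole word. -/
def Climbs (w : List Bool) : Prop := ∀ j, height (w.take j) ≤ height w

/-- No prefix has positive height. -/
def Sinks (w : List Bool) : Prop := ∀ j, height (w.take j) ≤ 0

/-! ### Cutting a word next to its highest point -/

theorem height_take_drop (w : List Bool) (i j : ℕ) :
    height ((w.drop i).take j) = height (w.take (i + j)) - height (w.take i) := by
  rw [List.take_add, height_append]; ring

theorem height_take_succ (w : List Bool) {i : ℕ} (hi : i < w.length) :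
    height (w.take (i + 1)) = height (w.take i) + 1 ∨
      height (w.take (i + 1)) = height (w.take i) - 1 := by
  rw [List.take_succ_eq_append_getElem hi, height_append]
  cases w[i] <;> simp <;> omega

/-- Heights and lengths of prefixes agree mod 2, so the maximum height is attained only at positions
of one parity. If that parity is even, the cut letter is the step leaving the last maximum; if it is
odd, the cut letter is the step reaching the first maximum. In both cases the other side of the
letter lies at most one below the maximum. -/
theorem exists_cut (w : List Bool) (hw : Odd w.length) :
    ∃ w₁ s w₂, w = w₁ ++ s :: w₂ ∧ Even w₁.length ∧ Climbs w₁ ∧ Sinks w₂ := by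
  classical
  set h : ℕ → ℤ := fun i => height (w.take i) with hh
  set S := (range (w.length + 1)).filter (fun i => ∀ j ∈ range (w.length + 1), h j ≤ h i) with hS
  have hSm : ∀ i, i ∈ S ↔ i ∈ range (w.length + 1) ∧ ∀ j ∈ range (w.length + 1), h j ≤ h i :=
    fun i => by simp only [hS, mem_filter]
  have hne : S.Nonempty := by
    obtain ⟨i, hi, hm⟩ := exists_max_image (range (w.length + 1)) h ⟨0, by simp⟩
    exact ⟨i, (hSm i).2 ⟨hi, hm⟩⟩
  have hlen : ∀ j, w.length ≤ j → h j = h w.length := by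
    intro j hj; simp only [hh]; rw [List.take_of_length_le hj, List.take_of_length_le le_rfl]
  have hmax : ∀ i ∈ S, ∀ j, h j ≤ h i := by
    intro i hi j
    have h1 := ((hSm i).1 hi).2
    rcases le_or_gt w.length j with hj | hj
    · rw [hlen j hj]; exact h1 _ (by simp)
    · exact h1 _ (by simp; omega)
  have hmem : ∀ i ∈ S, ∀ j, j ≤ w.length → j ∉ S → h j < h i := by
    intro i hi j hj hjS
    by_contra hc
    apply hjS
    refine (hSm j).2 ⟨mem_range.2 (by omega), fun l _ => ?_⟩
    have := hmax i hi l
    omega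
  have hle : ∀ i ∈ S, i ≤ w.length := fun i hi => by
    have := ((hSm i).1 hi).1; simp at this; omega
  have key : ∀ i, i < w.length → Even i → (∀ j ≤ i, h j ≤ h i) →
      (∀ j, i + 1 ≤ j → h j ≤ h (i + 1)) →
      ∃ w₁ s w₂, w = w₁ ++ s :: w₂ ∧ Even w₁.length ∧ Climbs w₁ ∧ Sinks w₂ := by
    intro i hi he h1 h2
    refine ⟨w.take i, w[i], w.drop (i + 1), ?_, ?_, ?_, ?_⟩
    · rw [List.getElem_cons_drop, List.take_append_drop]
    · rw [List.length_take, min_eq_left hi.le]; exact he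
    · intro j
      rw [List.take_take]
      exact h1 _ (min_le_right _ _)
    · intro j
      rw [height_take_drop]
      have := h2 (i + 1 + j) (by omega)
      simp only [hh] at this
      omega
  have hmin := S.min'_mem hne
  have hmx := S.max'_mem hne
  set a := S.min' hne
  set b := S.max' hne
  rcases Nat.even_or_odd a with ha | ha
  · have hab : h a = h b := le_antisymm (hmax b hmx a) (hmax a hmin b)
    have pa := height_parity (w.take a)
    have pb := height_parity (w.take b)
    rw [List.length_take, min_eq_left (hle _ hmin)] at pa
    rw [List.length_take, min_eq_left (hle _ hmx)] at pb
    simp only [hh] at hab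
    have hb : Even b := by
      rw [Nat.even_iff] at ha ⊢
      omega
    -- An even position is not the end of a word of odd length, so a step leaves the last maximum.
    have hbl : b < w.length := by
      refine lt_of_le_of_ne (hle _ hmx) fun hc => ?_
      rw [hc] at hb
      exact (Nat.not_even_iff_odd.2 hw) hb
    have hout : ∀ j, b < j → j ∉ S := fun j hj hjS => by
      have := S.le_max' j hjS
      omega
    refine key b hbl hb (fun j _ => hmax b hmx j) ?_
    intro j hj
    have h1 := hmem b hmx (b + 1) (by omega) (hout _ (by omega))
    have h2 := height_take_succ w hbl
    rcases le_or_gt j w.length with hj' | hj'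
    · have h3 := hmem b hmx j hj' (hout _ (by omega))
      simp only [hh] at *
      omega
    · rw [hlen j hj'.le]
      have h3 := hmem b hmx w.length le_rfl (hout _ (by omega))
      simp only [hh] at *
      omega
  · obtain ⟨c, hc⟩ : ∃ c, a = c + 1 := ⟨a - 1, by have := ha.pos; omega⟩
    have hout : ∀ j, j < a → j ∉ S := fun j hj hjS => by
      have := S.min'_le j hjS
      omega
    have hal := hle _ hmin
    refine key c (by omega) (by rw [hc] at ha; rw [Nat.odd_iff] at ha; rw [Nat.even_iff]; omega) ?_ ?_
    · intro j hj
      have h1 := hmem a hmin c (by omega) (hout _ (by omega))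
      have h2 := height_take_succ w (i := c) (by omega)
      have h3 := hmem a hmin j (by omega) (hout _ (by omega))
      rw [hc] at h1 h3
      simp only [hh] at *
      omega
    · intro j _
      rw [← hc]
      exact hmax a hmin j

/-- If `w₁` were shorter than `w₁'`, climbing of `w₁'` and sinking of `w₂` would force `w₁ ++ [s]`
and `w₁'` to have the same height, although their lengths have different parities. -/
theorem cut_unique {w₁ w₂ w₁' w₂' : List Bool} {s s' : Bool}
    (h : w₁ ++ s :: w₂ = w₁' ++ s' :: w₂')
    (e : Even w₁.length) (e' : Even w₁'.length) (c : Climbs w₁) (c' : Climbs w₁')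
    (k : Sinks w₂) (k' : Sinks w₂') : w₁ = w₁' ∧ s = s' ∧ w₂ = w₂' := by
  have main : ∀ {w₁ w₂ w₁' w₂' : List Bool} {s s' : Bool}, w₁ ++ s :: w₂ = w₁' ++ s' :: w₂' →
      Even w₁.length → Even w₁'.length → Climbs w₁' → Sinks w₂ →
      ¬ w₁.length < w₁'.length := by
    intro w₁ w₂ w₁' w₂' s s' h e e' c' k hlt
    have t : w₁' = (w₁ ++ [s]) ++ w₂.take (w₁'.length - (w₁.length + 1)) := by
      have := congrArg (List.take w₁'.length) h
      rw [List.take_left] at this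
      refine this.symm.trans ?_
      rw [show w₁ ++ s :: w₂ = (w₁ ++ [s]) ++ w₂ by simp, List.take_append,
        List.take_of_length_le (by simp; omega), List.length_append, List.length_singleton]
    have h1 := c' (w₁.length + 1)
    have h2 : w₁'.take (w₁.length + 1) = w₁ ++ [s] := by
      conv_lhs => rw [t]
      rw [List.take_append_of_le_length (by simp), List.take_of_length_le (by simp)]
    have h3 := congrArg height t
    rw [height_append] at h3
    have h4 := k (w₁'.length - (w₁.length + 1))
    rw [h2] at h1
    have p1 := height_parity (w₁ ++ [s])
    have p2 := height_parity w₁'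
    rw [Nat.even_iff] at e e'
    simp only [List.length_append, List.length_singleton] at p1
    push_cast at p1
    omega
  have hl : w₁.length = w₁'.length :=
    le_antisymm (not_lt.1 (main h.symm e' e c k')) (not_lt.1 (main h e e' c' k))
  have := List.append_inj h hl
  simpa using this

open scoped Classical in
/-- The pairs of a climbing and a sinking word, both of even length, of total length `m`. -/
noncomputable def cuts (m : ℕ) : Finset (List Bool × List Bool) :=
  (((range (m + 1)).biUnion words) ×ˢ ((range (m + 1)).biUnion words)).filter
    (fun p => p.1.length + p.2.length = m ∧ Even p.1.length ∧ Climbs p.1 ∧ Sinks p.2)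

theorem mem_cuts {m : ℕ} {p : List Bool × List Bool} :
    p ∈ cuts m ↔ p.1.length + p.2.length = m ∧ Even p.1.length ∧ Climbs p.1 ∧ Sinks p.2 := by
  classical
  simp only [cuts, mem_filter, mem_product, mem_biUnion, mem_words, mem_range]
  constructor
  · exact fun h => h.2
  · intro h; exact ⟨⟨⟨_, by omega, rfl⟩, ⟨_, by omega, rfl⟩⟩, h⟩

/-- A word of odd length is the same thing as a cut together with a free middle letter. Summing over
that letter later turns the middle step into an arbitrary edge of the graph. -/
theorem sum_words_eq {M : Type*} [AddCommMonoid M] {m : ℕ} (hm : Even m) (f : List Bool → M) :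
    ∑ w ∈ words (m + 1), f w =
      ∑ p ∈ cuts m, (f (p.1 ++ true :: p.2) + f (p.1 ++ false :: p.2)) := by
  classical
  have : words (m + 1) = (cuts m ×ˢ (univ : Finset Bool)).image
      (fun p => p.1.1 ++ p.2 :: p.1.2) := by
    ext w
    simp only [mem_words, mem_image, mem_product, mem_univ, and_true, mem_cuts, Prod.exists]
    constructor
    · intro hw
      obtain ⟨w₁, s, w₂, rfl, h1, h2, h3⟩ := exists_cut w (by rw [hw]; exact hm.add_one)
      refine ⟨w₁, w₂, s, ⟨?_, h1, h2, h3⟩, rfl⟩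
      simp at hw; omega
    · rintro ⟨w₁, w₂, s, ⟨h, -⟩, rfl⟩
      simp; omega
  rw [this, sum_image, sum_product]
  · simp
  · rintro ⟨⟨a, b⟩, s⟩ h ⟨⟨a', b'⟩, s'⟩ h' e
    simp only [mem_coe, mem_product, mem_univ, and_true, mem_cuts] at h h'
    obtain ⟨rfl, rfl, rfl⟩ := cut_unique e h.2.1 h'.2.1 h.2.2.1 h'.2.2.1 h.2.2.2 h'.2.2.2
    rfl

theorem card_cuts {j : ℕ} : (cuts (2 * j)).card = 4 ^ j := by
  have h := sum_words_eq (m := 2 * j) (by simp) (fun _ => 1)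
  rw [← card_eq_sum_ones, card_words] at h
  simp only [sum_const, smul_eq_mul] at h
  have : 2 ^ (2 * j + 1) = 4 ^ j * 2 := by rw [pow_succ, pow_mul]; norm_num
  omega

/-- The cuts in which both words have height `0`. -/
noncomputable def flatCuts (m : ℕ) : Finset (List Bool × List Bool) :=
  (cuts m).filter (fun p => height p.1 = 0 ∧ height p.2 = 0)

/-- Turn the first letter of the first word or else the last letter of the second word. -/
def tilt : List Bool × List Bool → List Bool × List Bool
  | (_ :: t, w) => (true :: t, w)
  | ([], w) => ([], w.dropLast ++ [false])

theorem Climbs.head_eq {b : Bool} {t : List Bool} (h : Climbs (b :: t))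
    (h0 : height (b :: t) = 0) : b = false := by
  have := h 1
  cases b
  · rfl
  · rw [h0] at this; simp at this

theorem Sinks.last_eq {b : Bool} {t : List Bool} (h : Sinks (t ++ [b]))
    (h0 : height (t ++ [b]) = 0) : b = true := by
  have := h t.length
  rw [List.take_left] at this
  rw [height_append] at h0
  cases b
  · simp at h0; omega
  · rfl

/-- A nonempty climbing word of height 0 starts with a down step, and a nonempty sinking word of
height 0 ends with an up step. Turning that letter changes the height to 2 or to −2 and preserves
climbing or sinking. As the old value of the letter is forced, the change can be undone. -/
theorem tilt_mem {m : ℕ} (hm : 0 < m) {p : List Bool × List Bool} (hp : p ∈ flatCuts m) :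
    tilt p ∈ cuts m \ flatCuts m := by
  obtain ⟨w₁, w₂⟩ := p
  simp only [flatCuts, mem_filter, mem_cuts, mem_sdiff, not_and] at hp ⊢
  obtain ⟨⟨hl, he, hc, hs⟩, h1, h2⟩ := hp
  rcases w₁ with _ | ⟨b, t⟩
  · rcases List.eq_nil_or_concat w₂ with rfl | ⟨t, b, rfl⟩
    · simp at hl; omega
    · simp only [List.concat_eq_append] at *
      obtain rfl := hs.last_eq h2
      have h3 : tilt ([], t ++ [true]) = ([], t ++ [false]) := by simp [tilt]
      rw [height_append] at h2
      simp at h2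
      refine ⟨⟨?_, ?_, ?_, ?_⟩, ?_⟩
      · rw [h3]; simpa using hl
      · simp [h3]
      · simpa [h3] using hc
      · rw [h3]
        intro j
        rcases le_or_gt j t.length with hj | hj
        · have := hs j
          rwa [List.take_append_of_le_length hj] at this ⊢
        · rw [List.take_of_length_le (by simp; omega), height_append]; simp; omega
      · intro _ _; rw [h3, height_append]; simp; omega
  · obtain rfl := hc.head_eq h1
    simp at h1
    simp only [tilt]
    refine ⟨⟨by simpa using hl, by simpa using he, ?_, hs⟩, ?_⟩
    · intro j
      rcases j with _ | j
      · simp; omega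
      · have := hc (j + 1)
        simp at this ⊢; omega
    · intro _ h; simp at h; omega

theorem tilt_injOn (m : ℕ) (hm : 0 < m) : Set.InjOn tilt (flatCuts m : Set _) := by
  rintro ⟨w₁, w₂⟩ h ⟨w₁', w₂'⟩ h' e
  simp only [mem_coe, flatCuts, mem_filter, mem_cuts] at h h'
  obtain ⟨⟨hl, he, hc, hs⟩, h1, h2⟩ := h
  obtain ⟨⟨hl', he', hc', hs'⟩, h1', h2'⟩ := h'
  rcases w₁ with _ | ⟨b, t⟩ <;> rcases w₁' with _ | ⟨b', t'⟩
  · rcases List.eq_nil_or_concat w₂ with rfl | ⟨t, b, rfl⟩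
    · simp at hl; omega
    rcases List.eq_nil_or_concat w₂' with rfl | ⟨t', b', rfl⟩
    · simp at hl'; omega
    simp only [List.concat_eq_append] at *
    obtain rfl := hs.last_eq h2
    obtain rfl := hs'.last_eq h2'
    simp [tilt] at e
    simp [e]
  · simp [tilt] at e
  · simp [tilt] at e
  · obtain rfl := hc.head_eq h1
    obtain rfl := hc'.head_eq h1'
    simpa [tilt] using e

theorem two_mul_card_flatCuts {m : ℕ} (hm : 0 < m) :
    2 * (flatCuts m).card ≤ (cuts m).card := by
  have h1 : (flatCuts m).card ≤ (cuts m \ flatCuts m).card :=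
    card_le_card_of_injOn tilt (fun p hp => tilt_mem hm hp) (tilt_injOn m hm)
  have h2 : flatCuts m ⊆ cuts m := filter_subset _ _
  rw [card_sdiff_of_subset h2] at h1
  have := card_le_card h2
  omega

/-- The weight of a cut, when a step of one kind has `d` choices and one of the other kind `Δ`. -/
def weight (d Δ : ℕ) (p : List Bool × List Bool) : ℕ :=
  (d ^ p.1.count true * Δ ^ p.1.count false) * (d ^ p.2.count false * Δ ^ p.2.count true)

theorem length_eq_count (w : List Bool) : w.length = w.count true + w.count false := by
  induction w with
  | nil => simp
  | cons b w ih => cases b <;> simp <;> omega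

/-- The exponent of d minus that of Δ is the height of the first word minus that of the second,
which is nonnegative and even. Unless the cut is flat it is at least 2, so at least one factor Δ is
replaced by d ≤ Δ/3. -/
theorem weight_le {d Δ j : ℕ} (h : 3 * d ≤ Δ) {p : List Bool × List Bool} (hp : p ∈ cuts (2 * j)) :
    3 * weight d Δ p ≤ if p ∈ flatCuts (2 * j) then 3 * (d * Δ) ^ j else (d * Δ) ^ j := by
  have hp' := mem_cuts.1 hp
  have e1 : weight d Δ p = d ^ (p.1.count true + p.2.count false) *
      Δ ^ (p.1.count false + p.2.count true) := by
    rw [weight, pow_add, pow_add]; ring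
  set x := p.1.count true + p.2.count false with hx
  set y := p.1.count false + p.2.count true with hy
  have hxy : x + y = 2 * j := by
    have := hp'.1
    rw [length_eq_count, length_eq_count] at this
    omega
  have h1 : 0 ≤ height p.1 := by simpa using hp'.2.2.1 0
  have h2 : height p.2 ≤ 0 := by simpa using hp'.2.2.2 p.2.length
  have h3 : (x : ℤ) - y = height p.1 - height p.2 := by simp [hx, hy, height]; ring
  rw [e1]
  split_ifs with hf
  · have := (mem_filter.1 hf).2
    have hxj : x = j := by omega
    have hyj : y = j := by omega
    rw [hxj, hyj, mul_pow]
  · have hne : ¬ (height p.1 = 0 ∧ height p.2 = 0) := fun hc => hf (mem_filter.2 ⟨hp, hc⟩)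
    obtain ⟨i, hi⟩ : ∃ i, x = y + 2 * (i + 1) := ⟨(x - y) / 2 - 1, by omega⟩
    have hj : j = y + (i + 1) := by omega
    rw [hi, hj]
    calc 3 * (d ^ (y + 2 * (i + 1)) * Δ ^ y)
        = (d ^ y * Δ ^ y * d ^ (i + 1)) * (3 * d ^ (i + 1)) := by ring
      _ ≤ (d ^ y * Δ ^ y * d ^ (i + 1)) * Δ ^ (i + 1) := by
          gcongr
          calc 3 * d ^ (i + 1) ≤ 3 ^ (i + 1) * d ^ (i + 1) := by
                gcongr
                exact Nat.le_self_pow (by omega) 3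
            _ = (3 * d) ^ (i + 1) := by rw [mul_pow]
            _ ≤ _ := by gcongr
      _ = (d * Δ) ^ (y + (i + 1)) := by rw [mul_pow]; ring

/-- At most half of the 4^j cuts are flat, and the others count one third: 1/2 + 1/2 · 1/3 = 2/3. -/
theorem sum_weight_le {d Δ j : ℕ} (h : 3 * d ≤ Δ) (hj : 0 < j) :
    3 * ∑ p ∈ cuts (2 * j), weight d Δ p ≤ 2 * (4 * (d * Δ)) ^ j := by
  rw [mul_sum]
  refine (sum_le_sum fun p hp => weight_le h hp).trans ?_
  rw [← sum_filter_add_sum_filter_not (cuts (2 * j)) (· ∈ flatCuts (2 * j))]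
  have hsub : flatCuts (2 * j) ⊆ cuts (2 * j) := filter_subset _ _
  have e1 : (cuts (2 * j)).filter (· ∈ flatCuts (2 * j)) = flatCuts (2 * j) := by
    ext p; simp only [mem_filter]; exact ⟨fun h => h.2, fun h => ⟨hsub h, h⟩⟩
  have e2 : (cuts (2 * j)).filter (¬ · ∈ flatCuts (2 * j)) = cuts (2 * j) \ flatCuts (2 * j) := by
    ext p; simp
  rw [sum_congr rfl (g := fun _ => 3 * (d * Δ) ^ j)
    (fun p hp => by rw [if_pos (mem_filter.1 hp).2]),
    sum_congr rfl (s₁ := (cuts (2 * j)).filter (¬ · ∈ flatCuts (2 * j))) (g := fun _ => (d * Δ) ^ j)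
    (fun p hp => by rw [if_neg (mem_filter.1 hp).2])]
  rw [sum_const, sum_const, e1, e2, smul_eq_mul, smul_eq_mul, card_sdiff_of_subset hsub]
  have h1 := two_mul_card_flatCuts (m := 2 * j) (by omega)
  have h2 := card_le_card hsub
  rw [card_cuts] at *
  obtain ⟨c, hc⟩ := Nat.exists_eq_add_of_le h2
  rw [hc, Nat.add_sub_cancel_left, mul_pow 4 (d * Δ) j, hc]
  nlinarith [Nat.zero_le ((d * Δ) ^ j)]

end UpDown

/-! ## Counting walks -/

namespace Matrix

open Finset UpDown

variable {V : Type*} [Fintype V] [DecidableEq V]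

/-- The product of the matrices that correspond to the letters of a word. -/
def wordProd (U D : Matrix V V ℕ) (w : List Bool) : Matrix V V ℕ :=
  (w.map fun b => if b then U else D).prod

theorem add_pow_eq_sum_words (U D : Matrix V V ℕ) (n : ℕ) :
    (U + D) ^ n = ∑ w ∈ words n, wordProd U D w := by
  induction n with
  | zero => simp [words, wordProd]
  | succ n ih =>
    rw [pow_succ', ih, sum_words_succ, add_mul, mul_sum, mul_sum]
    simp [wordProd]

theorem sum_row_wordProd_le {U D : Matrix V V ℕ} {d Δ : ℕ} (hU : ∀ v, ∑ w, U v w ≤ d)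
    (hD : ∀ v, ∑ w, D v w ≤ Δ) (w : List Bool) (v : V) :
    ∑ x, wordProd U D w v x ≤ d ^ w.count true * Δ ^ w.count false := by
  induction w generalizing v with
  | nil => simp [wordProd, Matrix.one_apply]
  | cons b w ih =>
    have hstep : ∀ (M : Matrix V V ℕ) (r : ℕ), (∑ w, M v w ≤ r) →
        ∑ x, (M * wordProd U D w) v x ≤ r * (d ^ w.count true * Δ ^ w.count false) := by
      intro M r hM
      simp only [Matrix.mul_apply]
      rw [sum_comm]
      simp only [← mul_sum]
      calc ∑ y, M v y * ∑ x, wordProd U D w y x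
          ≤ ∑ y, M v y * (d ^ w.count true * Δ ^ w.count false) :=
            sum_le_sum fun y _ => Nat.mul_le_mul_left _ (ih y)
        _ ≤ _ := by rw [← sum_mul]; gcongr
    cases b
    · have := hstep D Δ (hD v)
      simp only [wordProd, List.map_cons, List.prod_cons] at this ⊢
      refine this.trans (le_of_eq ?_)
      simp [pow_succ]; ring
    · have := hstep U d (hU v)
      simp only [wordProd, List.map_cons, List.prod_cons] at this ⊢
      refine this.trans (le_of_eq ?_)
      simp [pow_succ]; ring

/-- Column sums count walks backwards from their end, which exchanges the roles of up and down
steps. -/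
theorem sum_col_wordProd_le {U D : Matrix V V ℕ} {d Δ : ℕ} (hU : ∀ v, ∑ w, U w v ≤ Δ)
    (hD : ∀ v, ∑ w, D w v ≤ d) (w : List Bool) (v : V) :
    ∑ x, wordProd U D w x v ≤ d ^ w.count false * Δ ^ w.count true := by
  induction w using List.reverseRecOn generalizing v with
  | nil => simp [wordProd, Matrix.one_apply]
  | append_singleton w b ih =>
    have hstep : ∀ (M : Matrix V V ℕ) (r : ℕ), (∑ w, M w v ≤ r) →
        ∑ x, (wordProd U D w * M) x v ≤ (d ^ w.count false * Δ ^ w.count true) * r := by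
      intro M r hM
      simp only [Matrix.mul_apply]
      rw [sum_comm]
      simp only [← sum_mul]
      calc ∑ y, (∑ x, wordProd U D w x y) * M y v
          ≤ ∑ y, (d ^ w.count false * Δ ^ w.count true) * M y v :=
            sum_le_sum fun y _ => Nat.mul_le_mul_right _ (ih y)
        _ ≤ _ := by rw [← mul_sum]; gcongr
    cases b
    · have := hstep D d (hD v)
      simp only [wordProd, List.map_append, List.prod_append] at this ⊢
      refine le_trans (le_of_eq (by simp)) (this.trans (le_of_eq ?_))
      simp [pow_succ]; ring
    · have := hstep U Δ (hU v)
      simp only [wordProd, List.map_append, List.prod_append] at this ⊢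
      refine le_trans (le_of_eq (by simp)) (this.trans (le_of_eq ?_))
      simp [pow_succ]; ring

/-- The middle step costs no factor: once both of its ends are known there is at most one edge. -/
theorem mul_mul_apply_le {X A Y : Matrix V V ℕ} (hA : ∀ x y, A x y ≤ 1) (v u : V) :
    (X * A * Y) v u ≤ (∑ x, X v x) * ∑ y, Y y u := by
  simp only [Matrix.mul_apply]
  rw [mul_sum]
  refine sum_le_sum fun y _ => ?_
  gcongr with x
  calc X v x * A x y ≤ X v x * 1 := Nat.mul_le_mul_left _ (hA x y)
    _ = _ := mul_one _

end Matrix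

/-! ### Walks between two vertices of a degenerate graph -/

namespace SimpleGraph

open Finset UpDown Matrix

variable {V : Type*} [Fintype V] [DecidableEq V]

theorem adjMatrix_pow_le_of_maxDegree (G : SimpleGraph V) [DecidableRel G.Adj] {Δ : ℕ}
    (hΔ : G.maxDegree ≤ Δ) (m : ℕ) (v u : V) :
    ((G.adjMatrix ℕ) ^ (m + 1)) v u ≤ Δ ^ m := by
  have hA : ∀ x y, G.adjMatrix ℕ x y ≤ 1 := fun x y => by
    rw [adjMatrix_apply]; split_ifs <;> simp
  have hr : ∀ x, ∑ y, G.adjMatrix ℕ x y ≤ Δ := fun x => by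
    simp only [adjMatrix_apply, sum_boole, Nat.cast_id]
    rw [← neighborFinset_eq_filter]; exact (G.degree_le_maxDegree x).trans hΔ
  have h1 := sum_row_wordProd_le (U := 0) (D := G.adjMatrix ℕ) (d := 0) (Δ := Δ) (by simp) hr
    (List.replicate m false) v
  have h2 : wordProd 0 (G.adjMatrix ℕ) (List.replicate m false) = (G.adjMatrix ℕ) ^ m := by
    simp [wordProd]
  rw [h2] at h1
  have h3 := mul_mul_apply_le (X := (G.adjMatrix ℕ) ^ m) (Y := 1) hA v u
  rw [mul_one, ← pow_succ] at h3
  refine h3.trans ?_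
  have : ∑ y, (1 : Matrix V V ℕ) y u = 1 := by simp [Matrix.one_apply]
  rw [this, mul_one]
  refine h1.trans ?_
  simp [List.count_replicate]

theorem three_mul_adjMatrix_pow_le (G : SimpleGraph V) [DecidableRel G.Adj] {d Δ : ℕ}
    (hd : IsDegenerate G d) (hΔ : G.maxDegree ≤ Δ) {j : ℕ} (hj : 2 ≤ j) (v u : V) :
    3 * ((G.adjMatrix ℕ) ^ (2 * j + 1)) v u ≤ 2 * (4 * (d * Δ)) ^ j := by
  classical
  rcases le_or_gt Δ (3 * d) with h | h
  -- Here Δ² ≤ 3dΔ, and the degree bound suffices because 3 · 3^j ≤ 2 · 4^j from j = 2 on (27 ≤ 32).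
  · calc 3 * ((G.adjMatrix ℕ) ^ (2 * j + 1)) v u ≤ 3 * Δ ^ (2 * j) := by
          gcongr; exact adjMatrix_pow_le_of_maxDegree G hΔ _ _ _
      _ ≤ 3 * (3 * (d * Δ)) ^ j := by
          rw [pow_mul]; gcongr; nlinarith
      _ = (3 * 3 ^ j) * (d * Δ) ^ j := by rw [mul_pow]; ring
      _ ≤ (2 * 4 ^ j) * (d * Δ) ^ j := by
          refine Nat.mul_le_mul_right _ ?_
          clear hd v u
          induction j, hj using Nat.le_induction with
          | base => norm_num
          | succ j _ ih => rw [pow_succ, pow_succ]; omega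
      _ = _ := by rw [mul_pow]; ring
  · obtain ⟨o, ho⟩ := hd
    set U : Matrix V V ℕ := fun v w => if G.Adj v w ∧ o.lt v w then 1 else 0 with hU
    set D : Matrix V V ℕ := fun v w => if G.Adj v w ∧ o.lt w v then 1 else 0 with hD
    have hA : G.adjMatrix ℕ = U + D := by
      ext x y
      rw [adjMatrix_apply, Matrix.add_apply]
      simp only [hU, hD]
      by_cases hxy : G.Adj x y
      · rcases @lt_trichotomy V o x y with h1 | h1 | h1
        · have h2 : ¬ o.lt y x := @lt_asymm V o.toPreorder _ _ h1
          have h1' : o.lt x y := h1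
          simp [hxy, h1', h2]
        · exact absurd h1 hxy.ne
        · have h2 : ¬ o.lt x y := @lt_asymm V o.toPreorder _ _ h1
          have h1' : o.lt y x := h1
          simp [hxy, h1', h2]
      · simp [hxy]
    have hdeg : ∀ v, (univ.filter fun w => G.Adj v w).card ≤ Δ := fun v => by
      rw [← neighborFinset_eq_filter]; exact (G.degree_le_maxDegree v).trans hΔ
    have hup : ∀ v, (univ.filter fun w => G.Adj v w ∧ o.lt v w).card ≤ d := fun v => by
      have := ho v
      rw [← Set.coe_toFinset {w | G.Adj v w ∧ o.lt v w}, Set.encard_coe_eq_coe_finsetCard] at this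
      refine le_trans (card_le_card fun w hw => ?_) (Nat.cast_le.1 this)
      simpa using hw
    have hU1 : ∀ v, ∑ w, U v w ≤ d := fun v => by
      simp only [hU, sum_boole]; simpa using hup v
    have hU2 : ∀ v, ∑ w, U w v ≤ Δ := fun v => by
      simp only [hU, sum_boole]
      refine le_trans ?_ (hdeg v)
      rw [Nat.cast_id]
      exact card_le_card fun w hw => by simp at hw ⊢; exact hw.1.symm
    have hD1 : ∀ v, ∑ w, D v w ≤ Δ := fun v => by
      simp only [hD, sum_boole]
      refine le_trans ?_ (hdeg v)
      rw [Nat.cast_id]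
      exact card_le_card fun w hw => by simp at hw ⊢; exact hw.1
    have hD2 : ∀ v, ∑ w, D w v ≤ d := fun v => by
      simp only [hD, sum_boole]
      refine le_trans ?_ (hup v)
      rw [Nat.cast_id]
      exact card_le_card fun w hw => by simp at hw ⊢; exact ⟨hw.1.symm, hw.2⟩
    have hone : ∀ x y, (U + D) x y ≤ 1 := fun x y => by
      rw [← hA, adjMatrix_apply]; split_ifs <;> simp
    refine le_trans ?_ (sum_weight_le h.le (by omega : 0 < j))
    gcongr
    -- Expand the power of U + D into words and group them by their cuts; the two words of a cut add
    -- up to a product with U + D in the middle.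
    rw [hA, add_pow_eq_sum_words, sum_words_eq (by simp), Matrix.sum_apply]
    refine sum_le_sum fun p _ => ?_
    have e : wordProd U D (p.1 ++ true :: p.2) + wordProd U D (p.1 ++ false :: p.2) =
        wordProd U D p.1 * (U + D) * wordProd U D p.2 := by
      simp [wordProd, mul_add, add_mul, mul_assoc]
    rw [e]
    exact (mul_mul_apply_le hone v u).trans
      (Nat.mul_le_mul (sum_row_wordProd_le hU1 hD1 _ _) (sum_col_wordProd_le hU2 hD2 _ _))

/-- The vertex lists of the walks of length `m` from `v` to `u`. -/
def walkLists (G : SimpleGraph V) [DecidableRel G.Adj] : ℕ → V → V → Finset (List V)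
  | 0, v, u => if v = u then {[v]} else ∅
  | m + 1, v, u => (univ.filter (G.Adj v)).biUnion fun w => (walkLists G m w u).image (List.cons v)

theorem card_walkLists_le (G : SimpleGraph V) [DecidableRel G.Adj] (m : ℕ) (v u : V) :
    (walkLists G m v u).card ≤ ((G.adjMatrix ℕ) ^ m) v u := by
  induction m generalizing v with
  | zero => rw [walkLists, pow_zero, Matrix.one_apply]; split_ifs <;> simp
  | succ m ih =>
    rw [walkLists, pow_succ', Matrix.mul_apply]
    refine card_biUnion_le.trans ?_
    rw [sum_filter]
    refine sum_le_sum fun w _ => ?_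
    rw [adjMatrix_apply]
    split_ifs
    · rw [one_mul]; exact card_image_le.trans (ih w)
    · simp

theorem mem_walkLists (G : SimpleGraph V) [DecidableRel G.Adj] {m : ℕ} {v u : V} {l : List V}
    (hl : l.length = m + 1) (hv : l.head? = some v) (hu : l.getLast? = some u)
    (hc : l.IsChain G.Adj) : l ∈ walkLists G m v u := by
  induction m generalizing v l with
  | zero =>
    obtain ⟨a, rfl⟩ := List.length_eq_one_iff.1 hl
    simp at hv hu
    subst hv hu
    simp [walkLists]
  | succ m ih =>
    rcases l with _ | ⟨a, _ | ⟨b, l⟩⟩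
    · simp at hl
    · simp at hl
    · simp at hv
      subst hv
      rw [List.isChain_cons_cons] at hc
      simp only [walkLists, mem_biUnion, mem_filter, mem_univ, true_and, mem_image]
      exact ⟨b, hc.1, b :: l, ih (by simpa using hl) rfl (by simpa using hu) hc.2, rfl⟩

end SimpleGraph

namespace RecursiveWalk

open Finset

/-! ## Values of timed computations -/

section Timed

variable {α β : Type}

@[simp] theorem val_bind (x : Timed α) (f : α → Timed β) : (x >>= f).val = (f x.val).val := rfl
@[simp] theorem time_bind (x : Timed α) (f : α → Timed β) :
    (x >>= f).time = x.time + (f x.val).time := rfl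
@[simp] theorem val_pure (a : α) : (pure a : Timed α).val = a := rfl
@[simp] theorem time_pure (a : α) : (pure a : Timed α).time = 0 := rfl
@[simp] theorem val_op (a : α) : (op a).val = a := rfl
@[simp] theorem time_op (a : α) : (op a).time = 1 := rfl

theorem findT_val (test : α → Timed Bool) (l : List α) :
    (findT test l).val = l.find? fun x => (test x).val := by
  induction l with
  | nil => simp [findT]
  | cons x l ih =>
    simp only [findT, val_bind, List.find?_cons]
    cases h : (test x).val <;> simp [ih]

theorem anyT_val (test : α → Timed Bool) (l : List α) :
    (anyT test l).val = l.any fun x => (test x).val := by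
  rw [Bool.eq_iff_iff, anyT, val_bind, findT_val, val_op, List.find?_isSome, List.any_eq_true]

theorem filterT_val (test : α → Timed Bool) (l : List α) :
    (filterT test l).val = l.filter fun x => (test x).val := by
  induction l with
  | nil => simp [filterT]
  | cons x l ih =>
    simp only [filterT, val_bind, List.filter_cons]
    cases h : (test x).val <;> simp [ih]

end Timed

variable {n q : ℕ}

theorem fourForbidden_val (σ : Table n q) (u v : Fin n) (a : Fin q) :
    (fourForbidden σ u v a).val = true ↔
      ∃ x, (σ s(u, x) = some a ∨ σ s(v, x) = some a) ∨
        (σ s(u, x) ≠ none ∧ ∃ y, σ s(x, y) = some a ∧ σ s(y, v) = σ s(u, x)) := by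
  simp only [fourForbidden, anyT_val, val_bind, val_op, List.any_eq_true, List.mem_finRange,
    true_and]
  refine exists_congr fun x => ?_
  by_cases h1 : σ s(u, x) = some a ∨ σ s(v, x) = some a
  · simp [h1]
  · by_cases h2 : σ s(u, x) = none
    · rw [h2] at h1 ⊢
      simp_all
    · simp only [h1, decide_false, Bool.false_eq_true, if_false, h2, anyT_val, val_bind, val_op,
        List.any_eq_true, List.mem_finRange, true_and, false_or]
      exact ⟨fun ⟨y, hy⟩ => ⟨h2, y, of_decide_eq_true hy⟩,
        fun ⟨_, y, hy⟩ => ⟨y, decide_eq_true hy⟩⟩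

theorem mem_available {σ : Table n q} {u v : Fin n} {a : Fin q} :
    a ∈ (available σ u v).val ↔ ¬ (fourForbidden σ u v a).val = true := by
  simp [available, filterT_val]

theorem nodup_available (σ : Table n q) (u v : Fin n) : (available σ u v).val.Nodup := by
  rw [available, filterT_val]
  exact (List.nodup_finRange q).filter _

/-! ## Partial colourings without conflicts -/

/-- A proper partial edge colouring without bichromatic 4-cycles. -/
structure Valid (G : SimpleGraph (Fin n)) (σ : Table n q) : Prop where
  adj : ∀ u v, σ s(u, v) ≠ none → G.Adj u v
  proper : ∀ u x y, σ s(u, x) ≠ none → σ s(u, x) = σ s(u, y) → x = y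
  four : ∀ u x y v, σ s(u, x) ≠ none → σ s(y, v) = σ s(u, x) → σ s(x, y) ≠ none →
    σ s(v, u) = σ s(x, y) → σ s(u, x) = σ s(x, y)

/-- Every edge of the graph has a colour. -/
def Full (G : SimpleGraph (Fin n)) (σ : Table n q) : Prop := ∀ u v, G.Adj u v → σ s(u, v) ≠ none

variable {G : SimpleGraph (Fin n)} {σ : Table n q}

theorem Valid.diag (h : Valid G σ) (u : Fin n) : σ s(u, u) = none := by
  by_contra hc
  exact G.loopless.irrefl u (h.adj u u hc)

theorem valid_empty (G : SimpleGraph (Fin n)) : Valid G (fun _ => none : Table n q) :=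
  ⟨fun _ _ h => absurd rfl h, fun _ _ _ h => absurd rfl h, fun _ _ _ _ h => absurd rfl h⟩

theorem Valid.update_none (h : Valid G σ) (e : Sym2 (Fin n)) :
    Valid G (Function.update σ e none) := by
  have key : ∀ z, Function.update σ e none z ≠ none → σ z = Function.update σ e none z := by
    intro z hz
    by_cases hze : z = e
    · subst hze; simp at hz
    · rw [Function.update_of_ne hze]
  refine ⟨fun u v huv => h.adj u v (by rwa [key _ huv]), fun u x y h1 h2 => ?_,
    fun u x y v h1 h2 h3 h4 => ?_⟩
  · refine h.proper u x y (by rwa [key _ h1]) ?_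
    rw [key _ h1, key _ (h2 ▸ h1), h2]
  · rw [← key _ h1, ← key _ h3]
    refine h.four u x y v (by rwa [key _ h1]) ?_ (by rwa [key _ h3]) ?_
    · rw [key _ h1, key _ (h2.symm ▸ h1), h2]
    · rw [key _ h3, key _ (h4.symm ▸ h3), h4]

/-- Any new conflict must involve the edge uv, and 4-availability excludes exactly these. Degenerate
closed walks of length 4 do no harm, since the field `four` only concludes that two colours agree.
-/
theorem Valid.update_available (h : Valid G σ) {u v : Fin n} (huv : G.Adj u v)
    {a : Fin q} (ha : a ∈ (available σ u v).val) :
    Valid G (Function.update σ s(u, v) (some a)) := by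
  rw [mem_available, fourForbidden_val] at ha
  push Not at ha
  set τ := Function.update σ s(u, v) (some a) with hτ
  have he : τ s(u, v) = some a := by simp [hτ]
  have hne : ∀ z, z ≠ s(u, v) → τ z = σ z := fun z hz => by rw [hτ, Function.update_of_ne hz]
  have hadj : ∀ x y, τ s(x, y) ≠ none → G.Adj x y := by
    intro x y hxy
    by_cases hz : s(x, y) = s(u, v)
    · have := G.mem_edgeSet.2 huv
      rw [← hz] at this
      exact this
    · rw [hne _ hz] at hxy
      exact h.adj _ _ hxy
  have hfree : ∀ w x y, s(w, x) = s(u, v) → s(w, y) ≠ s(u, v) → τ s(w, y) ≠ some a := by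
    intro w x y h1 h2
    rw [hne _ h2]
    rcases Sym2.eq_iff.1 h1 with ⟨rfl, rfl⟩ | ⟨rfl, rfl⟩
    · exact (ha y).1.1
    · exact (ha y).1.2
  have hprop : ∀ w x y, τ s(w, x) ≠ none → τ s(w, x) = τ s(w, y) → x = y := by
    intro w x y h1 h2
    by_cases hx : s(w, x) = s(u, v) <;> by_cases hy : s(w, y) = s(u, v)
    · exact Sym2.congr_right.1 (hx.trans hy.symm)
    · rw [hx, he] at h2
      exact absurd h2.symm (hfree _ _ _ hx hy)
    · rw [hy, he] at h2
      exact absurd h2 (hfree _ _ _ hy hx)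
    · rw [hne _ hx] at h1 h2
      rw [hne _ hy] at h2
      exact h.proper w x y h1 h2
  have hfour : ∀ w x y z, s(w, x) = s(u, v) → τ s(y, z) = τ s(w, x) → τ s(x, y) ≠ none →
      τ s(z, w) = τ s(x, y) → τ s(w, x) = τ s(x, y) := by
    intro w x y z hw h2 h3 h4
    by_contra hc
    have h5 : s(x, y) ≠ s(u, v) := fun h5 => hc (by rw [hw, h5])
    have h6 : s(z, w) ≠ s(u, v) := fun h6 => hc (by rw [← h4, hw, h6])
    have h7 : s(y, z) ≠ s(u, v) := by
      intro h7
      rcases Sym2.eq_iff.1 (hw.trans h7.symm) with ⟨rfl, rfl⟩ | ⟨rfl, rfl⟩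
      · exact h5 (by rw [Sym2.eq_swap]; exact hw)
      · exact (hadj _ _ h3).ne rfl
    rw [hne _ h5] at h3
    rw [hne _ h5, hne _ h6] at h4
    rw [hw, he, hne _ h7] at h2
    rcases Sym2.eq_iff.1 hw with ⟨rfl, rfl⟩ | ⟨rfl, rfl⟩
    · refine (ha z).2 ?_ y ?_ ?_
      · rwa [Sym2.eq_swap, h4]
      · rwa [Sym2.eq_swap]
      · rw [Sym2.eq_swap, ← h4, Sym2.eq_swap]
    · exact (ha y).2 h3 z h2 h4
  refine ⟨hadj, hprop, fun w x y z h1 h2 h3 h4 => ?_⟩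
  -- The condition is invariant under rotating the closed walk, so `hfour` covers every position of
  -- the new edge.
  by_cases e1 : s(w, x) = s(u, v)
  · exact hfour _ _ _ _ e1 h2 h3 h4
  by_cases e2 : s(x, y) = s(u, v)
  · have := hfour x y z w e2 h4 (by rwa [h2]) h2.symm
    rw [this, h2]
  by_cases e3 : s(y, z) = s(u, v)
  · have := hfour y z w x e3 h2.symm (by rwa [h4]) h4.symm
    rw [← h2, this, h4]
  by_cases e4 : s(z, w) = s(u, v)
  · have := hfour z w x y e4 h4.symm h1 h2
    rw [← this, h4]
  rw [hne _ e1] at *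
  rw [hne _ e2] at *
  rw [hne _ e3] at *
  rw [hne _ e4] at *
  exact h.four w x y z h1 h2 h3 h4

/-- The forbidden colours number at most |C u ∪ C v| + |T| with |T| ≤ |C u ∩ C v|, that is, at most
|C u| + |C v|. -/
theorem Valid.le_length_available [DecidableRel G.Adj] (h : Valid G σ) (u v : Fin n) :
    q ≤ (available σ u v).val.length + 2 * G.maxDegree := by
  classical
  set F : Finset (Fin q) := univ.filter fun a => (fourForbidden σ u v a).val = true with hF
  set C : Fin n → Finset (Fin q) := fun w => univ.filter fun a => ∃ x, σ s(w, x) = some a with hC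
  set T : Finset (Fin q) := univ.filter fun a =>
    ∃ x y, σ s(u, x) ≠ none ∧ σ s(x, y) = some a ∧ σ s(y, v) = σ s(u, x) with hT
  have hCle : ∀ w, (C w).card ≤ G.maxDegree := by
    intro w
    refine le_trans ?_ (G.degree_le_maxDegree w)
    rw [← G.card_neighborFinset_eq_degree]
    have : ((C w).image some) ⊆ (G.neighborFinset w).image (fun x => σ s(w, x)) := by
      intro o ho
      obtain ⟨a, ha, rfl⟩ := mem_image.1 ho
      simp only [hC, mem_filter, mem_univ, true_and] at ha
      obtain ⟨x, hx⟩ := ha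
      refine mem_image.2 ⟨x, ?_, hx⟩
      rw [SimpleGraph.mem_neighborFinset]
      exact h.adj _ _ (by simp [hx])
    have h2 := (card_le_card this).trans card_image_le
    rwa [card_image_of_injective _ (Option.some_injective _)] at h2
  -- The common colour c of ux and yv determines x and y by properness, and thereby the colour of
  -- xy.
  have hTle : T.card ≤ (C u ∩ C v).card := by
    refine card_le_card_of_forall_subsingleton
      (fun a c => ∃ x y, σ s(u, x) = some c ∧ σ s(x, y) = some a ∧ σ s(y, v) = some c) ?_ ?_
    · intro a ha
      simp only [hT, mem_filter, mem_univ, true_and] at ha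
      obtain ⟨x, y, h1, h2, h3⟩ := ha
      obtain ⟨c, hc⟩ := Option.ne_none_iff_exists'.1 h1
      rw [hc] at h3
      refine ⟨c, ?_, x, y, hc, h2, h3⟩
      simp only [hC, mem_inter, mem_filter, mem_univ, true_and]
      exact ⟨⟨x, hc⟩, ⟨y, by rwa [Sym2.eq_swap]⟩⟩
    · rintro c - a ⟨-, x, y, h1, h2, h3⟩ a' ⟨-, x', y', h1', h2', h3'⟩
      obtain rfl := h.proper u x x' (by simp [h1]) (h1.trans h1'.symm)
      rw [Sym2.eq_swap] at h3 h3'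
      obtain rfl := h.proper v y y' (by simp [h3]) (h3.trans h3'.symm)
      rw [h2] at h2'
      exact Option.some_injective _ h2'
  have hFle : F ⊆ (C u ∪ C v) ∪ T := by
    intro a ha
    simp only [hF, mem_filter, mem_univ, true_and, fourForbidden_val] at ha
    simp only [hC, hT, mem_union, mem_filter, mem_univ, true_and]
    obtain ⟨x, (h1 | h1) | ⟨h1, y, h2, h3⟩⟩ := ha
    · exact Or.inl (Or.inl ⟨x, h1⟩)
    · exact Or.inl (Or.inr ⟨x, h1⟩)
    · exact Or.inr ⟨x, y, h1, h2, h3⟩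
  have h1 := (card_le_card hFle).trans (card_union_le _ _)
  have h2 := card_union_add_card_inter (C u) (C v)
  have h3 : (available σ u v).val.toFinset = Fᶜ := by
    ext a; simp [mem_available, hF]
  have h4 := List.toFinset_card_of_nodup (nodup_available σ u v)
  rw [h3, card_compl, Fintype.card_fin] at h4
  have := hCle u
  have := hCle v
  omega

/-! ## The initial colouring -/

theorem greedy_spec [DecidableRel G.Adj] (hq : 2 * G.maxDegree < q ∨ ∀ u v, ¬ G.Adj u v)
    (l : List (Fin n × Fin n)) (hl : l.Nodup) (σ : Table n q) (hσ : Valid G σ)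
    (h2 : ∀ u v, u < v → G.Adj u v → (u, v) ∈ l ∨ σ s(u, v) ≠ none) :
    Valid G (greedy G l σ).val ∧ Full G (greedy G l σ).val := by
  induction l generalizing σ with
  | nil =>
    refine ⟨hσ, fun u v huv => ?_⟩
    simp only [greedy, val_op]
    rcases lt_trichotomy u v with h | rfl | h
    · simpa using h2 u v h huv
    · exact absurd huv (G.loopless.irrefl u)
    · rw [Sym2.eq_swap]
      simpa using h2 v u h huv.symm
  | cons e l ih =>
    obtain ⟨u, v⟩ := e
    simp only [greedy, val_bind, val_op]
    by_cases hb : u < v ∧ G.Adj u v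
    · simp only [hb, and_self, decide_true, if_true, val_bind, val_op]
      have hA : (available σ u v).val ≠ [] := by
        intro hc
        have := hσ.le_length_available u v
        rw [hc] at this
        rcases hq with hq | hq
        · simp at this; omega
        · exact hq u v hb.2
      obtain ⟨a, A, hA'⟩ := List.exists_cons_of_ne_nil hA
      refine ih (List.nodup_cons.1 hl).2 _ ?_ ?_
      · rw [hA', List.head?_cons]
        exact hσ.update_available hb.2 (by simp [hA'])
      · intro x y hxy hadj
        by_cases hz : s(x, y) = s(u, v)
        · right; rw [hz]; simp [hA']
        · rw [Function.update_of_ne hz]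
          rcases h2 x y hxy hadj with h | h
          · rcases List.mem_cons.1 h with h | h
            · exact absurd (by simp_all) hz
            · exact Or.inl h
          · exact Or.inr h
    · simp only [hb, decide_false, Bool.false_eq_true, if_false]
      refine ih (List.nodup_cons.1 hl).2 _ hσ ?_
      intro x y hxy hadj
      rcases h2 x y hxy hadj with h | h
      · rcases List.mem_cons.1 h with h | h
        · simp only [Prod.mk.injEq] at h
          exact absurd (h.1 ▸ h.2 ▸ ⟨hxy, hadj⟩) hb
        · exact Or.inl h
      · exact Or.inr h

end RecursiveWalk

namespace RecursiveWalk

variable {n q : ℕ} {G : SimpleGraph (Fin n)} {σ : Table n q}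

/-! ## Cycles as lists of vertices -/

/-- The edges of a cycle that is given by the list of its vertices. -/
def edgeList (C : List (Fin n)) : List (Sym2 (Fin n)) :=
  (C.zip (C.rotate 1)).map fun e => s(e.1, e.2)

@[simp] theorem length_edgeList (C : List (Fin n)) : (edgeList C).length = C.length := by
  simp [edgeList]

theorem getElem_edgeList (C : List (Fin n)) (i : ℕ) (h : i < (edgeList C).length) :
    (edgeList C)[i] = s(C[i]'(by simpa using h),
      C[(i + 1) % C.length]'(Nat.mod_lt _ (by simp at h; omega))) := by
  simp [edgeList, List.getElem_rotate]

/-- With only two vertices the two edges going forth and back would coincide. -/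
theorem nodup_edgeList {C : List (Fin n)} (hC : C.Nodup) (h3 : 3 ≤ C.length) :
    (edgeList C).Nodup := by
  rw [List.nodup_iff_injective_getElem]
  rintro ⟨i, hi⟩ ⟨j, hj⟩ h
  simp only [getElem_edgeList] at h
  simp only [length_edgeList] at hi hj
  rcases Sym2.eq_iff.1 h with ⟨h1, -⟩ | ⟨h1, h2⟩
  · have := hC.getElem_inj_iff.1 h1
    simpa using this
  · have e1 := hC.getElem_inj_iff.1 h1
    have e2 := hC.getElem_inj_iff.1 h2
    exfalso
    rcases Nat.lt_or_ge (i + 1) C.length with h4 | h4 <;>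
      rcases Nat.lt_or_ge (j + 1) C.length with h5 | h5
    · rw [Nat.mod_eq_of_lt h5] at e1; rw [Nat.mod_eq_of_lt h4] at e2; omega
    · have : j + 1 = C.length := by omega
      rw [this, Nat.mod_self] at e1; rw [Nat.mod_eq_of_lt h4] at e2; omega
    · have : i + 1 = C.length := by omega
      rw [this, Nat.mod_self] at e2; rw [Nat.mod_eq_of_lt h5] at e1; omega
    · have h6 : i + 1 = C.length := by omega
      have h7 : j + 1 = C.length := by omega
      rw [h7, Nat.mod_self] at e1; rw [h6, Nat.mod_self] at e2; omega

/-- Two cycles have an edge in common. -/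
def Meets (C D : List (Fin n)) : Prop := ∃ e ∈ edgeList C, e ∈ edgeList D

/-- All edges of the cycle are coloured, and the colours alternate. -/
structure Bichromatic (σ : Table n q) (C : List (Fin n)) : Prop where
  nodup : C.Nodup
  three_le : 3 ≤ C.length
  colored : ∀ e ∈ edgeList C, σ e ≠ none
  periodic : ∀ i (hi : i < C.length), σ ((edgeList C)[(i + 2) % C.length]'(by
    simpa using Nat.mod_lt _ (by omega))) = σ ((edgeList C)[i]'(by simpa using hi))

/-- The cycle is represented as the algorithm does it: it starts at its least vertex and continues
with the smaller neighbour of that vertex. -/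
def Canonical (C : List (Fin n)) : Prop := (canonicalT C).val = true

theorem canonical_iff {C : List (Fin n)} : Canonical C ↔ ∃ v x y l, C = v :: x :: y :: l ∧
    (∀ w ∈ x :: y :: l, v ≤ w) ∧ x < (y :: l).getLast (List.cons_ne_nil y l) := by
  unfold Canonical
  rcases C with _ | ⟨v, _ | ⟨x, _ | ⟨y, l⟩⟩⟩
  · simp [canonicalT]
  · simp [canonicalT]
  · simp [canonicalT]
  · constructor
    · intro h
      refine ⟨v, x, y, l, rfl, ?_⟩
      simp only [canonicalT, val_bind, anyT_val, val_op, Bool.and_eq_true, Bool.not_eq_true',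
        List.any_eq_false, decide_eq_true_eq, not_lt] at h
      exact h
    · rintro ⟨v', x', y', l', h, h1⟩
      simp only [List.cons.injEq] at h
      obtain ⟨rfl, rfl, rfl, rfl⟩ := h
      simp only [canonicalT, val_bind, anyT_val, val_op, Bool.and_eq_true, Bool.not_eq_true',
        List.any_eq_false, decide_eq_true_eq, not_lt]
      exact h1

theorem Bichromatic.color_eq (h : Bichromatic σ C) (i : ℕ) (hi : i < C.length) :
    σ ((edgeList C)[i]'(by simpa using hi)) =
      σ ((edgeList C)[i % 2]'(by have := h.three_le; simp; omega)) := by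
  induction i using Nat.strong_induction_on with
  | _ i ih =>
    rcases Nat.lt_or_ge i 2 with h2 | h2
    · simp [Nat.mod_eq_of_lt h2]
    · have h1 := ih (i - 2) (by omega) (by omega)
      have h3 := h.periodic (i - 2) (by omega)
      have e : (i - 2 + 2) % C.length = i := by
        rw [Nat.sub_add_cancel h2, Nat.mod_eq_of_lt hi]
      simp only [e] at h3
      rw [h3, h1]
      congr 2
      omega

theorem Valid.edge_adj (hσ : Valid G σ) {e : Sym2 (Fin n)} (he : σ e ≠ none) : e ∈ G.edgeSet := by
  induction e with
  | _ u v => exact hσ.adj u v he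

theorem Bichromatic.first_ne (h : Bichromatic σ C) (hσ : Valid G σ) :
    σ ((edgeList C)[0]'(by have := h.three_le; simp; omega)) ≠
      σ ((edgeList C)[1]'(by have := h.three_le; simp; omega)) := by
  have h3 := h.three_le
  intro hc
  have h0 := h.colored _ (List.getElem_mem (l := edgeList C) (n := 0) (by simp; omega))
  simp only [getElem_edgeList] at hc h0
  have e1 : (0 + 1) % C.length = 1 := Nat.mod_eq_of_lt (by omega)
  have e2 : (1 + 1) % C.length = 2 := Nat.mod_eq_of_lt (by omega)
  simp only [e1, e2] at hc h0
  rw [Sym2.eq_swap] at hc h0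
  have := h.nodup.getElem_inj_iff.1 (hσ.proper _ _ _ h0 hc)
  omega

/-- On an odd cycle, period 2 carries the colour of edge 0 to the last edge and from there, around
the corner, to edge 1. -/
theorem Bichromatic.even (h : Bichromatic σ C) (hσ : Valid G σ) : Even C.length := by
  have h3 := h.three_le
  by_contra ho
  have ho' := Nat.not_even_iff.1 ho
  have h1 := h.color_eq (C.length - 1) (by omega)
  have h2 := h.periodic (C.length - 1) (by omega)
  have e1 : (C.length - 1 + 2) % C.length = 1 := by
    rw [show C.length - 1 + 2 = 1 + C.length by omega, Nat.add_mod_right]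
    exact Nat.mod_eq_of_lt (by omega)
  have e2 : (C.length - 1) % 2 = 0 := by omega
  simp only [e1] at h2
  simp only [e2] at h1
  exact h.first_ne hσ (by rw [← h1, ← h2])

theorem Bichromatic.six_le (h : Bichromatic σ C) (hσ : Valid G σ) : 6 ≤ C.length := by
  have h3 := h.three_le
  have he := Nat.even_iff.1 (h.even hσ)
  by_contra hc
  have h4 : C.length = 4 := by omega
  have hne := h.first_ne hσ
  have c0 := h.colored _ (List.getElem_mem (l := edgeList C) (n := 0) (by simp; omega))
  have c1 := h.colored _ (List.getElem_mem (l := edgeList C) (n := 1) (by simp; omega))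
  have p2 := h.color_eq 2 (by omega)
  have p3 := h.color_eq 3 (by omega)
  simp only [getElem_edgeList, h4] at *
  norm_num at *
  exact hne (hσ.four _ _ _ _ c0 p2 c1 p3)

/-! ## Following two colours -/

/-- From the head of the list to `v₀`, the colours of the edges are `a, b, a, b, …`, and `v₀` does
not occur after the first entry. -/
def Alternating (σ : Table n q) (v₀ : Fin n) : List (Fin n) → Fin q → Fin q → Prop
  | [], _, _ => False
  | [x], a, _ => σ s(x, v₀) = some a
  | x :: y :: l, a, b => y ≠ v₀ ∧ σ s(x, y) = some a ∧ Alternating σ v₀ (y :: l) b a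

/-- Properness leaves at most one edge of the required colour at the current vertex, so the search
result is the only possible continuation. -/
theorem traceT_eq_some_iff (hσ : Valid G σ) {v₀ : Fin n} {k : ℕ} {cur : Fin n} {a b : Fin q}
    {l : List (Fin n)} : (traceT σ v₀ k cur a b).val = some l ↔
      l.head? = some cur ∧ l.length ≤ k ∧ Alternating σ v₀ l a b := by
  induction k generalizing cur a b l with
  | zero =>
    simp only [traceT, val_op, reduceCtorEq, false_iff, not_and]
    intro h1 h2
    rw [List.length_eq_zero_iff.1 (Nat.le_zero.1 h2)] at h1
    simp at h1
  | succ k ih =>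
    have hfind : (findT (fun w => do
      let c ← op (σ s(cur, w))
      op (decide (c = some a))) (List.finRange n)).val =
        (List.finRange n).find? fun w => decide (σ s(cur, w) = some a) := by
      rw [findT_val]; rfl
    rw [traceT, val_bind, hfind]
    rcases ho : (List.finRange n).find? (fun w => decide (σ s(cur, w) = some a)) with _ | w
    · simp only [val_op, reduceCtorEq, false_iff, not_and]
      rw [List.find?_eq_none] at ho
      intro h1 _ h3
      rcases l with _ | ⟨x, _ | ⟨y, l⟩⟩
      · simp at h1
      · simp at h1; subst h1
        exact ho v₀ (List.mem_finRange _) (decide_eq_true (show σ s(x, v₀) = some a from h3))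
      · simp at h1; subst h1
        exact ho y (List.mem_finRange _) (by simpa using h3.2.1)
    · have hw : σ s(cur, w) = some a := by simpa using List.find?_some ho
      have huniq : ∀ x, σ s(cur, x) = some a → x = w := fun x hx =>
        hσ.proper cur x w (by simp [hx]) (hx.trans hw.symm)
      simp only [val_bind, val_op]
      by_cases hc : w = v₀
      · subst hc
        simp only [decide_true, if_true, val_op, Option.some.injEq]
        constructor
        · rintro rfl
          exact ⟨rfl, by simp, hw⟩
        · rintro ⟨h1, -, h3⟩
          rcases l with _ | ⟨x, _ | ⟨y, l⟩⟩
          · simp at h1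
          · simp at h1; rw [h1]
          · simp at h1; subst h1
            exact absurd (huniq y h3.2.1) h3.1
      · simp only [hc, decide_false, Bool.false_eq_true, if_false, val_bind, val_op,
          Option.map_eq_some_iff]
        constructor
        · rintro ⟨l', h1, rfl⟩
          obtain ⟨h1, h2, h3⟩ := ih.1 h1
          rcases l' with _ | ⟨y, l'⟩
          · simp at h1
          · simp at h1; subst h1
            exact ⟨rfl, by simpa using h2, hc, hw, h3⟩
        · rintro ⟨h1, h2, h3⟩
          rcases l with _ | ⟨x, _ | ⟨y, l⟩⟩
          · simp at h1
          · simp at h1; subst h1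
            exact absurd (huniq v₀ h3).symm hc
          · simp at h1; subst h1
            obtain rfl := huniq y h3.2.1
            exact ⟨y :: l, ih.2 ⟨rfl, by simpa using h2, h3.2.2⟩, rfl⟩

theorem Alternating.getElem {v₀ : Fin n} {l : List (Fin n)} {a b : Fin q}
    (h : Alternating σ v₀ l a b) (i : ℕ) (hi : i < l.length) :
    σ s(l[i], (l ++ [v₀])[i + 1]'(by simp; omega)) = some (if i % 2 = 0 then a else b) := by
  induction l generalizing i a b with
  | nil => simp at hi
  | cons x l ih =>
    rcases l with _ | ⟨y, l⟩
    · simp at hi; subst hi; exact h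
    · rcases i with _ | i
      · simpa using h.2.1
      · have := ih h.2.2 i (by simpa using hi)
        simp only [List.cons_append, List.getElem_cons_succ] at this ⊢
        rw [this]
        congr 1
        split_ifs <;> first | rfl | omega

theorem Alternating.ne_getElem {v₀ : Fin n} {l : List (Fin n)} {a b : Fin q}
    (h : Alternating σ v₀ l a b) (i : ℕ) (hi : i + 1 < l.length) : l[i + 1] ≠ v₀ := by
  induction l generalizing i a b with
  | nil => simp at hi
  | cons x l ih =>
    rcases l with _ | ⟨y, l⟩
    · simp at hi
    · rcases i with _ | i
      · simpa using h.1
      · exact ih h.2.2 i (by simpa using hi)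

theorem alternating_of_getElem {v₀ : Fin n} {l : List (Fin n)} {a b : Fin q} (hne : l ≠ [])
    (h1 : ∀ i (hi : i < l.length), σ s(l[i], (l ++ [v₀])[i + 1]'(by simp; omega)) =
      some (if i % 2 = 0 then a else b))
    (h2 : ∀ i (hi : i + 1 < l.length), l[i + 1] ≠ v₀) : Alternating σ v₀ l a b := by
  induction l generalizing a b with
  | nil => exact absurd rfl hne
  | cons x l ih =>
    rcases l with _ | ⟨y, l⟩
    · simpa [Alternating] using h1 0 (by simp)
    · refine ⟨by simpa using h2 0 (by simp), h1 0 (by simp), ih (by simp) ?_ ?_⟩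
      · intro i hi
        have := h1 (i + 1) (by simpa using hi)
        simp only [List.cons_append, List.getElem_cons_succ] at this ⊢
        rw [this]
        congr 1
        split_ifs <;> first | rfl | omega
      · intro i hi
        exact h2 (i + 1) (by simpa using hi)

section Closed

variable {x : ℕ → Fin n} {L : ℕ} {a b : Fin q}

/-- If two vertices at odd distance coincide, the first and the last edge between them have the same
colour, so their inner ends coincide too. Repeating this ends with a coloured loop. -/
theorem fold_inward (hσ : Valid G σ) (hc : ∀ i < L, σ s(x i, x (i + 1)) =
      some (if i % 2 = 0 then a else b)) {i m : ℕ} (hm : i + (2 * m + 1) ≤ L) :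
    x i ≠ x (i + (2 * m + 1)) := by
  induction m generalizing i with
  | zero =>
    intro h
    have := hc i (by omega)
    rw [show i + (2 * 0 + 1) = i + 1 by ring] at h
    rw [← h, hσ.diag] at this
    simp at this
  | succ m ih =>
    intro h
    have h1 := hc i (by omega)
    have h2 := hc (i + (2 * m + 2)) (by omega)
    rw [show i + (2 * m + 2) + 1 = i + (2 * (m + 1) + 1) by ring, ← h, Sym2.eq_swap,
      show (i + (2 * m + 2)) % 2 = i % 2 by omega, ← h1] at h2
    have := hσ.proper _ _ _ (by rw [h2, h1]; simp) h2
    apply ih (i := i + 1) (by omega)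
    rw [← this]
    congr 1
    ring

/-- At even distance the edges entering two coinciding vertices have the same colour, so the
coincidence moves back to the start, where the trace would already have closed. -/
theorem shift_down (hσ : Valid G σ) (hc : ∀ i < L, σ s(x i, x (i + 1)) =
      some (if i % 2 = 0 then a else b)) {i m : ℕ} (hm : i + 2 * m ≤ L) (h : x i = x (i + 2 * m)) :
    x 0 = x (2 * m) := by
  induction i with
  | zero => simpa using h
  | succ i ih =>
    apply ih (by omega)
    have h1 := hc i (by omega)
    have h2 := hc (i + 2 * m) (by omega)
    rw [show (i + 2 * m) % 2 = i % 2 by omega,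
      show i + 2 * m + 1 = i + 1 + 2 * m by ring, ← h, ← h1, Sym2.eq_swap,
      Sym2.eq_swap (a := x i)] at h2
    rw [Sym2.eq_swap] at h1
    exact (hσ.proper _ _ _ (by rw [h2, h1]; simp) h2).symm

theorem injective_of_alternating (hσ : Valid G σ) (hc : ∀ i < L, σ s(x i, x (i + 1)) =
      some (if i % 2 = 0 then a else b)) (hne : ∀ i, 0 < i → i < L → x i ≠ x 0)
    {i j : ℕ} (hij : i < j) (hj : j < L) : x i ≠ x j := by
  rcases Nat.even_or_odd (j - i) with ⟨m, hm⟩ | ⟨m, hm⟩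
  · intro h
    rw [show j = i + 2 * m by omega] at h
    exact hne (2 * m) (by omega) (by omega) (shift_down hσ hc (by omega) h).symm
  · rw [show j = i + (2 * m + 1) by omega]
    exact fold_inward hσ hc (by omega)

theorem even_of_alternating (hσ : Valid G σ) (hc : ∀ i < L, σ s(x i, x (i + 1)) =
      some (if i % 2 = 0 then a else b)) (hL : x L = x 0) : Even L := by
  by_contra ho
  obtain ⟨m, hm⟩ := Nat.not_even_iff_odd.1 ho
  have := fold_inward hσ hc (i := 0) (m := m) (by omega)
  rw [zero_add, ← hm] at this
  exact this hL.symm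

end Closed

/-- The bound on the length excludes a trace that runs back and forth along one edge, which happens
for a = b. -/
theorem bichromatic_of_trace (hσ : Valid G σ) {v : Fin n} {k : ℕ} {a b : Fin q}
    {C : List (Fin n)} (h : (traceT σ v k v a b).val = some C) (h3 : 3 ≤ C.length) :
    Bichromatic σ C ∧ C.length ≤ k := by
  obtain ⟨h1, h2, halt⟩ := (traceT_eq_some_iff hσ).1 h
  refine ⟨?_, h2⟩
  set x : ℕ → Fin n := fun i => (C ++ [v]).getD i v with hx
  have hxi : ∀ i (hi : i < C.length), x i = C[i] := fun i hi => by
    simp only [hx]; rw [List.getD_eq_getElem _ _ (by simp; omega), List.getElem_append_left hi]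
  have hxL : x C.length = v := by
    simp only [hx]; rw [List.getD_eq_getElem _ _ (by simp)]; simp
  have hx0 : x 0 = v := by
    rw [hxi 0 (by omega)]
    rcases C with _ | ⟨y, C⟩
    · simp at h1
    · simpa using h1
  have hc : ∀ i < C.length, σ s(x i, x (i + 1)) = some (if i % 2 = 0 then a else b) := by
    intro i hi
    have := halt.getElem i hi
    rw [← hxi i hi] at this
    rw [← this]
    congr 2
    simp only [hx]
    rw [List.getD_eq_getElem _ _ (by simp; omega)]
  have hne : ∀ i, 0 < i → i < C.length → x i ≠ x 0 := by
    intro i h0 hi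
    obtain ⟨i, rfl⟩ : ∃ j, i = j + 1 := ⟨i - 1, by omega⟩
    rw [hx0, hxi _ hi]
    exact halt.ne_getElem i hi
  have hE := Nat.even_iff.1 (even_of_alternating hσ hc (hxL.trans hx0.symm))
  have hedge : ∀ i (hi : i < C.length), (edgeList C)[i]'(by simpa using hi) =
      s(x i, x (i + 1)) := by
    intro i hi
    rw [getElem_edgeList, hxi i hi]
    congr 1
    rcases Nat.lt_or_ge (i + 1) C.length with h4 | h4
    · rw [hxi _ h4]; simp [Nat.mod_eq_of_lt h4]
    · have : i + 1 = C.length := by omega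
      rw [this, hxL, ← hx0, hxi 0 (by omega)]
      simp
  refine ⟨?_, h3, ?_, ?_⟩
  · rw [List.nodup_iff_pairwise_ne, List.pairwise_iff_getElem]
    intro i j hi hj hij
    rw [← hxi i hi, ← hxi j hj]
    exact injective_of_alternating hσ hc hne hij hj
  · intro e he
    obtain ⟨i, hi, rfl⟩ := List.getElem_of_mem he
    rw [length_edgeList] at hi
    rw [hedge i hi, hc i hi]; simp
  · intro i hi
    rw [hedge i hi, hc i hi, hedge _ (Nat.mod_lt _ (by omega)), hc _ (Nat.mod_lt _ (by omega))]
    have : (i + 2) % C.length % 2 = i % 2 := by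
      rw [Nat.mod_mod_of_dvd _ (Nat.dvd_of_mod_eq_zero hE)]; omega
    rw [this]

theorem trace_of_bichromatic (hσ : Valid G σ) {C : List (Fin n)} (h : Bichromatic σ C) :
    ∃ v a b, (traceT σ v n v a b).val = some C := by
  have h3 := h.three_le
  obtain ⟨a, ha⟩ := Option.ne_none_iff_exists'.1
    (h.colored _ (List.getElem_mem (l := edgeList C) (n := 0) (by simp; omega)))
  obtain ⟨b, hb⟩ := Option.ne_none_iff_exists'.1
    (h.colored _ (List.getElem_mem (l := edgeList C) (n := 1) (by simp; omega)))
  refine ⟨C[0], a, b, (traceT_eq_some_iff hσ).2 ⟨?_, ?_, ?_⟩⟩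
  · rw [List.head?_eq_getElem?, List.getElem?_eq_getElem]
  · simpa using h.nodup.length_le_card
  · refine alternating_of_getElem (by intro hc; simp [hc] at h3) ?_ ?_
    · intro i hi
      have h4 := h.color_eq i hi
      have h5 : (edgeList C)[i]'(by simpa using hi) =
          s(C[i], (C ++ [C[0]])[i + 1]'(by simp; omega)) := by
        rw [getElem_edgeList]
        congr 1
        rcases Nat.lt_or_ge (i + 1) C.length with h6 | h6
        · rw [List.getElem_append_left h6]; simp [Nat.mod_eq_of_lt h6]
        · have : i + 1 = C.length := by omega
          simp [this]
      rw [← h5, h4]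
      rcases Nat.mod_two_eq_zero_or_one i with h6 | h6
      · simp only [h6, ha]; simp
      · simp only [h6, hb]; simp
    · intro i hi hc
      have := h.nodup.getElem_inj_iff.1 hc
      omega

/-! ## The selection of the first bichromatic cycle -/

theorem meetT_val {C D : List (Fin n)} : (meetT C D).val = true ↔ Meets C D := by
  simp only [meetT, edgesT, val_bind, anyT_val, val_op, List.any_eq_true, decide_eq_true_eq, Meets,
    edgeList, List.mem_map]
  constructor
  · rintro ⟨e, he, e', he', h⟩
    exact ⟨_, ⟨e, he, rfl⟩, e', he', h.symm⟩
  · rintro ⟨_, ⟨e, he, rfl⟩, e', he', h⟩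
    exact ⟨e, he, e', he', h.symm⟩

theorem precedesT_val {C D : List (Fin n)} : (precedesT C D).val = true ↔ C < D := by
  induction C generalizing D with
  | nil => cases D <;> simp [precedesT]
  | cons x C ih =>
    rcases D with _ | ⟨y, D⟩
    · simp [precedesT]
    · simp only [precedesT, val_bind, val_op]
      rw [List.cons_lt_cons_iff]
      rcases lt_trichotomy x y with h | rfl | h
      · simp [h]
      · simp [ih]
      · simp [h, h.not_gt, h.ne']

/-- The cycle shares an edge with `top`, if there is a cycle `top`. -/
def MeetsTop (top : Option (List (Fin n))) (C : List (Fin n)) : Prop := ∀ D ∈ top, Meets D C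

theorem betterT_val {top best : Option (List (Fin n))} {C : List (Fin n)} :
    (betterT top best C).val = true ↔ Canonical C ∧ MeetsTop top C ∧ ∀ D ∈ best, C < D := by
  have h1 : (match top with
    | none => op true
    | some D => meetT D C : Timed Bool).val = true ↔ MeetsTop top C := by
    cases top <;> simp [MeetsTop, meetT_val]
  have h2 : (match best with
    | none => op true
    | some D => precedesT C D : Timed Bool).val = true ↔ ∀ D ∈ best, C < D := by
    cases best <;> simp [precedesT_val]
  rw [← h1, ← h2]
  simp only [betterT, val_bind, val_op, Bool.and_eq_true, Canonical, and_assoc]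

/-- The cycle is found by following two colours, is canonical, and meets `top`. -/
def Found (σ : Table n q) (top : Option (List (Fin n))) (l : List (Fin n × Fin q × Fin q))
    (C : List (Fin n)) : Prop :=
  (∃ e ∈ l, (traceT σ e.1 n e.1 e.2.1 e.2.2).val = some C) ∧ Canonical C ∧ MeetsTop top C

/-- The two halves together say that the scan returns a least candidate, generalised over the best
cycle known so far to allow induction. -/
theorem selectFrom_spec (σ : Table n q) (top : Option (List (Fin n)))
    (l : List (Fin n × Fin q × Fin q)) (best : Option (List (Fin n))) :
    (∀ C ∈ (selectFrom σ top l best).val, C ∈ best ∨ Found σ top l C) ∧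
      ∀ C, C ∈ best ∨ Found σ top l C → ∃ D ∈ (selectFrom σ top l best).val, D ≤ C := by
  induction l generalizing best with
  | nil =>
    simp only [selectFrom, val_op, Found, List.not_mem_nil, false_and, exists_false, or_false]
    exact ⟨fun C h => h, fun C h => ⟨C, h, le_rfl⟩⟩
  | cons e l ih =>
    obtain ⟨v, a, b⟩ := e
    rcases ho : (traceT σ v n v a b).val with _ | C₀
    · have hs : (selectFrom σ top ((v, a, b) :: l) best).val = (selectFrom σ top l best).val := by
        simp [selectFrom, ho]
      have hF : ∀ C, Found σ top ((v, a, b) :: l) C ↔ Found σ top l C := fun C => by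
        simp [Found, ho]
      simp only [hs, hF]
      exact ih best
    · have hs : (selectFrom σ top ((v, a, b) :: l) best).val =
          (selectFrom σ top l (if (betterT top best C₀).val then some C₀ else best)).val := by
        simp [selectFrom, ho]
      have hF : ∀ C, Found σ top ((v, a, b) :: l) C ↔
          (C = C₀ ∧ Canonical C ∧ MeetsTop top C) ∨ Found σ top l C := fun C => by
        simp only [Found, List.mem_cons, exists_eq_or_imp, ho, Option.some.injEq]
        rw [eq_comm]
        tauto
      rw [hs]
      obtain ⟨ih1, ih2⟩ := ih (if (betterT top best C₀).val then some C₀ else best)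
      constructor
      · intro C hC
        rw [hF]
        rcases ih1 C hC with h | h
        · split_ifs at h with hb
          · rw [Option.mem_some_iff] at h
            subst h
            have := betterT_val.1 hb
            exact Or.inr (Or.inl ⟨rfl, this.1, this.2.1⟩)
          · exact Or.inl h
        · exact Or.inr (Or.inr h)
      · intro C hC
        rw [hF] at hC
        rcases hC with h | ⟨rfl, h1, h2⟩ | h
        · by_cases hb : (betterT top best C₀).val = true
          · obtain ⟨D, hD, hle⟩ := ih2 C₀ (by simp [hb])
            exact ⟨D, hD, hle.trans ((betterT_val.1 hb).2.2 C h).le⟩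
          · exact ih2 C (by simp only [hb]; exact Or.inl h)
        · by_cases hb : (betterT top best C).val = true
          · exact ih2 C (by simp [hb])
          · have hb' : ¬ ∀ D ∈ best, C < D := fun h3 => hb (betterT_val.2 ⟨h1, h2, h3⟩)
            push Not at hb'
            obtain ⟨D, hD, hle⟩ := hb'
            obtain ⟨D', hD', hle'⟩ := ih2 D (by simp only [hb]; exact Or.inl hD)
            exact ⟨D', hD', hle'.trans hle⟩
        · exact ih2 C (Or.inr h)

theorem found_iff (hσ : Valid G σ) {top : Option (List (Fin n))} {C : List (Fin n)} :
    Found σ top (List.finRange n ×ˢ (List.finRange q ×ˢ List.finRange q)) C ↔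
      Bichromatic σ C ∧ Canonical C ∧ MeetsTop top C := by
  constructor
  · rintro ⟨⟨e, -, h⟩, h1, h2⟩
    refine ⟨(bichromatic_of_trace hσ h ?_).1, h1, h2⟩
    obtain ⟨v, x, y, l, rfl, -⟩ := canonical_iff.1 h1
    simp
  · rintro ⟨h, h1, h2⟩
    obtain ⟨v, a, b, ht⟩ := trace_of_bichromatic hσ h
    refine ⟨⟨(v, a, b), ?_, ht⟩, h1, h2⟩
    simp [List.mem_product]

theorem select_some (hσ : Valid G σ) {top : Option (List (Fin n))} {C : List (Fin n)}
    (h : (select σ top).val = some C) : Bichromatic σ C ∧ Canonical C ∧ MeetsTop top C ∧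
      ∀ D, Bichromatic σ D → Canonical D → MeetsTop top D → C ≤ D := by
  obtain ⟨h1, h2⟩ := selectFrom_spec σ top
    (List.finRange n ×ˢ (List.finRange q ×ˢ List.finRange q)) none
  have h3 := (found_iff hσ).1 ((h1 C h).resolve_left (by simp))
  refine ⟨h3.1, h3.2.1, h3.2.2, fun D d1 d2 d3 => ?_⟩
  obtain ⟨D', hD', hle⟩ := h2 D (Or.inr ((found_iff hσ).2 ⟨d1, d2, d3⟩))
  have : (select σ top).val = some D' := hD'
  rw [h, Option.some.injEq] at this
  rwa [this]

theorem select_none (hσ : Valid G σ) {top : Option (List (Fin n))}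
    (h : (select σ top).val = none) (D : List (Fin n)) (hb : Bichromatic σ D)
    (hc : Canonical D) : ¬ MeetsTop top D := by
  intro hm
  obtain ⟨D', hD', -⟩ := (selectFrom_spec σ top
    (List.finRange n ×ˢ (List.finRange q ×ˢ List.finRange q)) none).2 D
    (Or.inr ((found_iff hσ).2 ⟨hb, hc, hm⟩))
  have : (select σ top).val = some D' := hD'
  rw [h] at this
  simp at this

end RecursiveWalk

namespace RecursiveWalk

variable {n q : ℕ} {G : SimpleGraph (Fin n)} {σ : Table n q}

theorem canonical_iff_getElem {C : List (Fin n)} : Canonical C ↔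
    ∃ h : 3 ≤ C.length, (∀ w ∈ C, C[0] ≤ w) ∧ C[1] < C[C.length - 1] := by
  rw [canonical_iff]
  constructor
  · rintro ⟨v, x, y, l, rfl, h1, h2⟩
    refine ⟨by simp, ?_, ?_⟩
    · intro w hw
      rcases List.mem_cons.1 hw with rfl | hw
      · simp
      · exact h1 w hw
    · rw [List.getLast_eq_getElem] at h2
      simpa using h2
  · rintro ⟨h, h1, h2⟩
    rcases C with _ | ⟨v, _ | ⟨x, _ | ⟨y, l⟩⟩⟩
    · simp at h
    · simp at h
    · simp at h
    · refine ⟨v, x, y, l, rfl, fun w hw => h1 w (List.mem_cons_of_mem _ hw), ?_⟩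
      rw [List.getLast_eq_getElem]
      simpa using h2

/-! ## Colourings without bichromatic cycles are acyclic -/

theorem bichromatic_of_two_colors (hσ : Valid G σ) {C : List (Fin n)} (hC : C.Nodup)
    (h3 : 3 ≤ C.length) (hc : ∀ e ∈ edgeList C, σ e ≠ none) {o₁ o₂ : Option (Fin q)}
    (h : ∀ e ∈ edgeList C, σ e = o₁ ∨ σ e = o₂) : Bichromatic σ C := by
  -- Consecutive edges differ in colour by properness, because vertices two apart on the cycle are
  -- distinct. With two colours available, they must alternate.
  have hne : ∀ i (hi : i < C.length), σ ((edgeList C)[i]'(by simpa using hi)) ≠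
      σ ((edgeList C)[(i + 1) % C.length]'(by simpa using Nat.mod_lt _ (by omega))) := by
    intro i hi hcol
    have h0 := hc _ (List.getElem_mem (l := edgeList C) (n := i) (by simpa using hi))
    simp only [getElem_edgeList, Nat.mod_add_mod] at hcol h0
    rw [Sym2.eq_swap] at hcol h0
    have h1 := hC.getElem_inj_iff.1 (hσ.proper _ _ _ h0 hcol)
    rcases Nat.lt_or_ge (i + 1 + 1) C.length with h4 | h4
    · rw [Nat.mod_eq_of_lt h4] at h1; omega
    · have h5 : (i + 1 + 1) % C.length = i + 2 - C.length := by
        rw [Nat.mod_eq_sub_mod h4, Nat.mod_eq_of_lt (by omega)]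
      omega
  refine ⟨hC, h3, hc, fun i hi => ?_⟩
  have h1 := hne i hi
  have h2 := hne ((i + 1) % C.length) (Nat.mod_lt _ (by omega))
  simp only [Nat.mod_add_mod] at h2
  have e0 := h _ (List.getElem_mem (l := edgeList C) (n := i) (by simpa using hi))
  have e1 := h _ (List.getElem_mem (l := edgeList C) (n := (i + 1) % C.length)
    (by simpa using Nat.mod_lt _ (by omega)))
  have e2 := h _ (List.getElem_mem (l := edgeList C) (n := (i + 1 + 1) % C.length)
    (by simpa using Nat.mod_lt _ (by omega)))
  rcases e0 with e0 | e0 <;> rcases e1 with e1 | e1 <;> rcases e2 with e2 | e2 <;>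
    simp_all

theorem holdsAcyclicColoring (hσ : Valid G σ) (hf : Full G σ)
    (h : ∀ C, Bichromatic σ C → ¬ Canonical C) : HoldsAcyclicColoring G σ := by
  have hsome : ∀ e : G.edgeSet, (σ (e : Sym2 (Fin n))).isSome := by
    rintro ⟨e, he⟩
    induction e with
    | _ u v => exact Option.isSome_iff_ne_none.2 (hf u v he)
  refine ⟨fun e => (σ e).get (hsome e), ⟨?_, ?_⟩, fun e => by simp⟩
  · rintro ⟨e, he⟩ ⟨f, hf'⟩ hef ⟨v, hve, hvf⟩ hc
    apply hef
    obtain ⟨x, rfl⟩ := Sym2.mem_iff_exists.1 hve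
    obtain ⟨y, rfl⟩ := Sym2.mem_iff_exists.1 hvf
    have hxy : σ s(v, x) = σ s(v, y) := Option.get_inj.1 hc
    have := hσ.proper v x y (hf v x he) hxy
    subst this
    rfl
  · intro v p hp hcard
    obtain ⟨a, b, -, hab⟩ := Set.ncard_eq_two.1 hcard
    have hcol : ∀ e ∈ p.edges, σ e = some a ∨ σ e = some b := by
      intro e he
      have hmem : (σ e).get (hsome ⟨e, p.edges_subset_edgeSet he⟩) ∈ ({a, b} : Set (Fin q)) := by
        rw [← hab]
        exact ⟨⟨e, p.edges_subset_edgeSet he⟩, he, rfl⟩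
      rcases hmem with hm | hm
      · left; rw [← hm, Option.some_get]
      · right; rw [← hm, Option.some_get]
    obtain ⟨m, hm, hmin⟩ := p.support.toFinset.exists_min_image id
      ⟨v, by simp⟩
    rw [List.mem_toFinset] at hm
    -- Start the cycle at its least vertex, and reverse it if necessary, to obtain the
    -- representation that the algorithm would find.
    obtain ⟨r, hr, hre, hrs, hsnd⟩ : ∃ r : G.Walk m m, r.IsCycle ∧ (∀ e ∈ r.edges, e ∈ p.edges) ∧
        (∀ w ∈ r.support, m ≤ w) ∧ r.snd < r.penultimate := by
      have h1 : (p.rotate m hm).IsCycle := hp.rotate hm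
      have h2 : ∀ e ∈ (p.rotate m hm).edges, e ∈ p.edges := fun e he =>
        (p.rotate_edges m hm).mem_iff.1 he
      have h3 : ∀ w ∈ (p.rotate m hm).support, m ≤ w := fun w hw =>
        hmin w (by simpa using (p.mem_support_rotate_iff m hm).1 hw)
      rcases lt_or_gt_of_ne h1.snd_ne_penultimate with h4 | h4
      · exact ⟨_, h1, h2, h3, h4⟩
      · exact ⟨_, h1.reverse, fun e he => h2 e (by simpa using he),
          fun w hw => h3 w (by simpa using hw), by simpa using h4⟩
    set C := List.ofFn fun i : Fin r.length => r.getVert i with hC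
    have hlen : C.length = r.length := by simp [hC]
    have h3 : 3 ≤ C.length := hlen ▸ hr.three_le_length
    have hget : ∀ i (hi : i < C.length), C[i] = r.getVert i := fun i hi => by simp [hC]
    have hedge : ∀ e ∈ edgeList C, e ∈ r.edges := by
      intro e he
      obtain ⟨i, hi, rfl⟩ := List.getElem_of_mem he
      rw [length_edgeList] at hi
      have hd : i < r.darts.length := by rw [r.length_darts, ← hlen]; exact hi
      have hmem := List.getElem_mem hd
      rw [SimpleGraph.Walk.darts_getElem_eq_getVert] at hmem
      rw [getElem_edgeList, hget, hget]
      have e1 : r.getVert ((i + 1) % C.length) = r.getVert (i + 1) := by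
        rcases Nat.lt_or_ge (i + 1) C.length with h4 | h4
        · rw [Nat.mod_eq_of_lt h4]
        · have : i + 1 = C.length := by omega
          rw [this, Nat.mod_self, hlen, r.getVert_zero, r.getVert_length]
      rw [e1]
      exact List.mem_map_of_mem (f := SimpleGraph.Dart.edge) hmem
    have hnd : C.Nodup := by
      rw [hC, List.nodup_ofFn]
      intro i j hij
      have := hr.getVert_injOn' (by simp; omega) (by simp; omega) hij
      exact Fin.ext this
    refine h C (bichromatic_of_two_colors hσ hnd h3 (fun e he => ?_)
      (fun e he => hcol e (hre e (hedge e he)))) (canonical_iff_getElem.2 ⟨h3, ?_, ?_⟩)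
    · rcases hcol e (hre e (hedge e he)) with h4 | h4 <;> simp [h4]
    · intro w hw
      obtain ⟨i, hi, rfl⟩ := List.getElem_of_mem hw
      rw [hget, hget, r.getVert_zero]
      exact hrs _ (r.getVert_mem_support i)
    · rw [hget, hget, hlen]
      exact hsnd

/-! ## Counting cycles through an edge -/

/-- The lists that represent the cycles of even length at least 6 of the graph. -/
structure IsEvenCycle (G : SimpleGraph (Fin n)) (C : List (Fin n)) : Prop where
  canonical : Canonical C
  nodup : C.Nodup
  even : Even C.length
  six_le : 6 ≤ C.length
  adj : ∀ e ∈ edgeList C, e ∈ G.edgeSet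

theorem Bichromatic.isEvenCycle {C : List (Fin n)} (h : Bichromatic σ C) (hσ : Valid G σ)
    (hC : Canonical C) : IsEvenCycle G C :=
  ⟨hC, h.nodup, h.even hσ, h.six_le hσ, fun e he => hσ.edge_adj (h.colored e he)⟩

theorem Canonical.eq_of_isRotated {C D : List (Fin n)} (hC : Canonical C) (hD : Canonical D)
    (hn : C.Nodup) (h : C ~r D) : C = D := by
  obtain ⟨c3, c1, -⟩ := canonical_iff_getElem.1 hC
  obtain ⟨d3, d1, -⟩ := canonical_iff_getElem.1 hD
  obtain ⟨k, rfl⟩ := h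
  have hk : (C.rotate k)[0] = C[k % C.length]'(Nat.mod_lt _ (by omega)) := by
    simp [List.getElem_rotate]
  have h1 := c1 _ (List.getElem_mem (l := C) (n := k % C.length) (Nat.mod_lt _ (by omega)))
  have h2 := d1 C[0] (by simp [List.mem_rotate])
  rw [hk] at h2
  have := hn.getElem_inj_iff.1 (le_antisymm h1 h2)
  rw [← List.rotate_mod, ← this, List.rotate_zero]

theorem Canonical.not_isRotated_reverse {C D : List (Fin n)} (hC : Canonical C) (hD : Canonical D)
    (hn : D.Nodup) : ¬ D.reverse ~r C := by
  intro h
  obtain ⟨c3, c1, c2⟩ := canonical_iff_getElem.1 hC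
  obtain ⟨d3, d1, d2⟩ := canonical_iff_getElem.1 hD
  have hlen : C.length = D.length := by simpa using h.perm.length_eq.symm
  obtain ⟨m, hml, rfl⟩ : ∃ m < D.length, D.reverse.rotate m = C := by
    obtain ⟨k, rfl⟩ := h
    exact ⟨k % D.reverse.length, by simpa using Nat.mod_lt k (by omega), List.rotate_mod _ _⟩
  have h1 := c1 D[0] (by simp [List.mem_rotate])
  have h2 : (D.reverse.rotate m)[0] = D[D.length - 1 - m] := by
    simp [List.getElem_rotate, Nat.mod_eq_of_lt hml]
  have h3 := d1 _ (List.getElem_mem (l := D) (n := D.length - 1 - m) (by omega))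
  rw [h2] at h1
  have h4 := hn.getElem_inj_iff.1 (le_antisymm h3 h1)
  have h5 : m = D.length - 1 := by omega
  have e1 : (D.reverse.rotate m)[1] = D[D.length - 1] := by
    simp only [List.getElem_rotate, List.getElem_reverse, List.length_reverse, h5]
    congr 1
    rw [show 1 + (D.length - 1) = D.length by omega, Nat.mod_self]
    omega
  have e2 : (D.reverse.rotate m)[(D.reverse.rotate m).length - 1] = D[1] := by
    simp only [List.getElem_rotate, List.getElem_reverse, List.length_reverse, h5,
      List.length_rotate]
    congr 1
    rw [show D.length - 1 + (D.length - 1) = (D.length - 2) + D.length by omega, Nat.add_mod_right,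
      Nat.mod_eq_of_lt (by omega)]
    omega
  rw [e1, e2] at c2
  exact lt_asymm c2 d2

/-- Starting just after the edge vu, the cycle without this edge is a walk between v and u; whether
it has to be reversed depends on the direction in which the cycle uses the edge. -/
theorem IsEvenCycle.exists_walkList [DecidableRel G.Adj] {C : List (Fin n)} (h : IsEvenCycle G C)
    {v u : Fin n} (he : s(v, u) ∈ edgeList C) :
    ∃ l ∈ G.walkLists (C.length - 1) v u, C ~r l ∨ C ~r l.reverse := by
  have h6 := h.six_le
  obtain ⟨i, hi, hi'⟩ := List.getElem_of_mem he
  rw [length_edgeList] at hi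
  rw [getElem_edgeList] at hi'
  set D := C.rotate (i + 1) with hD
  have hlen : D.length = C.length := by simp [hD]
  have hget : ∀ j (hj : j < D.length), D[j] = C[(j + (i + 1)) % C.length]'(Nat.mod_lt _ (by omega)) :=
    fun j hj => by simp [hD, List.getElem_rotate]
  have hchain : D.IsChain G.Adj := by
    rw [List.isChain_iff_getElem]
    intro j hj
    rw [hget, hget]
    have := h.adj _ (List.getElem_mem (l := edgeList C) (n := (j + (i + 1)) % C.length)
      (by simpa using Nat.mod_lt _ (by omega)))
    rw [getElem_edgeList] at this
    simp only [Nat.mod_add_mod] at this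
    rw [SimpleGraph.mem_edgeSet] at this
    convert this using 3
    ring
  have hhead : D.head? = some (C[(i + 1) % C.length]'(Nat.mod_lt _ (by omega))) := by
    rw [List.head?_eq_getElem?, List.getElem?_eq_getElem (by omega), hget]
    simp
  have hlast : D.getLast? = some C[i] := by
    rw [List.getLast?_eq_getElem?, List.getElem?_eq_getElem (by omega), hget]
    congr 2
    rw [hlen, show C.length - 1 + (i + 1) = i + C.length by omega, Nat.add_mod_right,
      Nat.mod_eq_of_lt hi]
  have hrot : C ~r D := ⟨i + 1, rfl⟩
  rcases Sym2.eq_iff.1 hi' with ⟨h1, h2⟩ | ⟨h1, h2⟩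
  · refine ⟨D.reverse, G.mem_walkLists (by simp; omega) ?_ ?_ ?_, Or.inr (by simpa using hrot)⟩
    · rw [List.head?_reverse, hlast, h1]
    · rw [List.getLast?_reverse, hhead, h2]
    · rw [List.isChain_reverse]
      exact hchain.imp fun _ _ h => h.symm
  · refine ⟨D, G.mem_walkLists (by omega) ?_ ?_ hchain, Or.inl hrot⟩
    · rw [hhead, h2]
    · rw [hlast, h1]

open Finset

theorem finite_isEvenCycle (G : SimpleGraph (Fin n)) : {C | IsEvenCycle G C}.Finite :=
  (List.finite_length_le (Fin n) n).subset fun C hC => by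
    simpa using hC.nodup.length_le_card

/-- The finite set of the cycles of even length at least 6. -/
noncomputable def evenCycles (G : SimpleGraph (Fin n)) : Finset (List (Fin n)) :=
  (finite_isEvenCycle G).toFinset

@[simp] theorem mem_evenCycles {C : List (Fin n)} : C ∈ evenCycles G ↔ IsEvenCycle G C := by
  simp [evenCycles]

/-- Removing the edge leaves a walk of 2j + 1 steps. No two cycles leave the same walk, since
canonical lists are unique up to rotation and reflection. -/
theorem card_evenCycles_through_le [DecidableRel G.Adj] {d Δ : ℕ} (hd : IsDegenerate G d)
    (hΔ : G.maxDegree ≤ Δ) {j : ℕ} (hj : 2 ≤ j) (e : Sym2 (Fin n)) :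
    3 * ((evenCycles G).filter fun C => e ∈ edgeList C ∧ C.length = 2 * j + 2).card ≤
      2 * (4 * (d * Δ)) ^ j := by
  induction e with
  | _ v u =>
  refine le_trans ?_ (G.three_mul_adjMatrix_pow_le hd hΔ hj v u)
  refine Nat.mul_le_mul_left _ (le_trans ?_ (G.card_walkLists_le _ _ _))
  refine card_le_card_of_forall_subsingleton (fun C l => C ~r l ∨ C ~r l.reverse) ?_ ?_
  · intro C hC
    simp only [mem_filter, mem_evenCycles] at hC
    have := hC.1.exists_walkList hC.2.1
    rwa [hC.2.2] at this
  · rintro l - C ⟨hC, h⟩ D ⟨hD, h'⟩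
    simp only [mem_filter, mem_evenCycles] at hC hD
    rcases h with h | h <;> rcases h' with h' | h'
    · exact hC.1.canonical.eq_of_isRotated hD.1.canonical hC.1.nodup (h.trans h'.symm)
    · refine absurd ?_ (hC.1.canonical.not_isRotated_reverse hD.1.canonical hD.1.nodup)
      rw [List.isRotated_reverse_comm_iff] at *
      exact h'.trans (by simpa using h.reverse.symm)
    · refine absurd ?_ (hC.1.canonical.not_isRotated_reverse hD.1.canonical hD.1.nodup)
      rw [List.isRotated_reverse_comm_iff]
      exact h'.trans (by simpa using h.reverse.symm)
    · exact hC.1.canonical.eq_of_isRotated hD.1.canonical hC.1.nodup (h.trans h'.symm)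

end RecursiveWalk

namespace RecursiveWalk

open Finset

variable {n q : ℕ} {G : SimpleGraph (Fin n)} {σ : Table n q}

/-! ## Recolouring -/

/-- The unordered pairs of a list of ordered pairs. -/
def unordered (l : List (Fin n × Fin n)) : List (Sym2 (Fin n)) := l.map fun e => s(e.1, e.2)

theorem uncolor_val (l : List (Fin n × Fin n)) (σ : Table n q) (z : Sym2 (Fin n)) :
    (uncolor l σ).val z = if z ∈ unordered l then none else σ z := by
  induction l generalizing σ with
  | nil => simp [uncolor, unordered]
  | cons e l ih =>
    simp only [uncolor, val_bind, val_op, ih, unordered, List.map_cons, List.mem_cons]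
    by_cases h1 : z ∈ List.map (fun e => s(e.1, e.2)) l
    · simp [h1]
    · by_cases h2 : z = s(e.1, e.2)
      · simp [h2]
      · simp [h1, h2]

theorem Valid.uncolor (h : Valid G σ) (l : List (Fin n × Fin n)) :
    Valid G (uncolor l σ).val := by
  induction l generalizing σ with
  | nil => exact h
  | cons e l ih => exact ih (h.update_none _)

theorem draw_none {α : Type} {A : List α} (h : A ≠ []) : draw A none = 0 := by
  rcases A with _ | ⟨a, l⟩
  · exact absurd rfl h
  · rw [draw, PMF.apply_eq_zero_iff, PMF.mem_support_map_iff]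
    simp

theorem mem_of_draw_ne_zero {α : Type} {A : List α} {a : α} (h : draw A (some a) ≠ 0) : a ∈ A := by
  rcases A with _ | ⟨b, l⟩
  · simp [draw] at h
  · rw [draw, ← PMF.mem_support_iff, PMF.mem_support_map_iff] at h
    obtain ⟨c, hc, h1⟩ := h
    rw [Option.some.injEq] at h1
    subst h1
    simpa using hc

theorem draw_some_le {α : Type} {A : List α} (hA : A.Nodup) (a : α) :
    draw A (some a) ≤ (A.length : ℝ≥0∞)⁻¹ := by
  classical
  rcases A with _ | ⟨b, l⟩
  · simp
  · rw [draw, PMF.map_apply, tsum_eq_single a]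
    · simp only [if_true, PMF.ofMultiset_apply]
      rw [Multiset.coe_count, ENNReal.div_eq_inv_mul, Multiset.coe_card]
      refine mul_le_of_le_one_right' ?_
      have := List.nodup_iff_count_le_one.1 hA a
      exact_mod_cast this
    · intro c hc
      simp [hc.symm]

theorem recolor_support (hq : ∀ τ : Table n q, Valid G τ → ∀ u v, G.Adj u v →
      (available τ u v).val ≠ [])
    {l : List (Fin n × Fin n)} (hl : ∀ e ∈ l, G.Adj e.1 e.2) {σ τ : Timed (Table n q)}
    (hσ : Valid G σ.val) (hτ : τ ∈ (recolor l σ).support) :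
    Valid G τ.val ∧ (∀ z ∉ unordered l, τ.val z = σ.val z) ∧
      ∀ z, (z ∈ unordered l ∨ σ.val z ≠ none) → τ.val z ≠ none := by
  induction l generalizing σ with
  | nil =>
    rw [recolor, PMF.mem_support_pure_iff] at hτ
    subst hτ
    simpa [unordered] using hσ
  | cons e l ih =>
    rw [recolor, PMF.mem_support_bind_iff] at hτ
    obtain ⟨o, ho, hτ⟩ := hτ
    have hne := hq _ hσ e.1 e.2 (hl e List.mem_cons_self)
    rcases o with _ | a
    · exact absurd (draw_none hne) ho
    have ha := mem_of_draw_ne_zero ho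
    obtain ⟨h1, h2, h3⟩ := ih (fun e he => hl e (List.mem_cons_of_mem _ he))
      (hσ.update_available (hl e List.mem_cons_self) ha) hτ
    refine ⟨h1, ?_, ?_⟩
    · intro z hz
      simp only [unordered, List.map_cons, List.mem_cons, not_or] at hz
      rw [h2 z hz.2]
      exact Function.update_of_ne hz.1 _ _
    · intro z hz
      by_cases hze : z = s(e.1, e.2)
      · apply h3
        right
        subst hze
        simp
      · apply h3
        rcases hz with hz | hz
        · simp only [unordered, List.map_cons, List.mem_cons, hze, false_or] at hz
          exact Or.inl hz
        · right
          exact (Function.update_of_ne hze _ _).trans_ne hz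

/-- Each edge is recoloured only once, so the outcome reveals every draw: a single sequence of draws
leads to τ, and each of its draws has probability at most r. -/
theorem recolor_apply_le (hq : ∀ τ : Table n q, Valid G τ → ∀ u v, G.Adj u v →
      (available τ u v).val ≠ [])
    {r : ℝ≥0∞} (hr : ∀ τ : Table n q, Valid G τ → ∀ u v, G.Adj u v →
      ((available τ u v).val.length : ℝ≥0∞)⁻¹ ≤ r)
    {l : List (Fin n × Fin n)} (hl : ∀ e ∈ l, G.Adj e.1 e.2) (hnd : (unordered l).Nodup)
    {σ : Timed (Table n q)} (hσ : Valid G σ.val) (τ : Table n q) :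
    ((recolor l σ).map Timed.val) τ ≤ r ^ l.length := by
  induction l generalizing σ with
  | nil => rw [List.length_nil, pow_zero]; exact PMF.coe_le_one _ _
  | cons e l ih =>
    have hadj := hl e List.mem_cons_self
    have hl' : ∀ e ∈ l, G.Adj e.1 e.2 := fun e he => hl e (List.mem_cons_of_mem _ he)
    rw [unordered, List.map_cons, List.nodup_cons] at hnd
    rw [recolor, PMF.map_bind, PMF.bind_apply, tsum_eq_single (τ s(e.1, e.2)), List.length_cons,
      pow_succ']
    · rcases ho : τ s(e.1, e.2) with _ | a
      · rw [draw_none (hq _ hσ _ _ hadj)]; simp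
      · by_cases hz : draw (available σ.val e.1 e.2).val (some a) = 0
        · rw [hz]; simp
        · refine mul_le_mul' ((draw_some_le (nodup_available _ _ _) a).trans (hr _ hσ _ _ hadj)) ?_
          exact ih hl' hnd.2 (hσ.update_available hadj (mem_of_draw_ne_zero hz))
    · intro o ho
      rcases o with _ | a
      · rw [draw_none (hq _ hσ _ _ hadj), zero_mul]
      by_cases hz : draw (available σ.val e.1 e.2).val (some a) = 0
      · rw [hz, zero_mul]
      · rw [mul_eq_zero]
        right
        rw [PMF.apply_eq_zero_iff, PMF.mem_support_map_iff]
        rintro ⟨τ', hτ', rfl⟩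
        have h2 := (recolor_support hq hl' (hσ.update_available hadj (mem_of_draw_ne_zero hz))
          hτ').2.1 _ hnd.1
        apply ho
        rw [h2]
        simp

/-! ### Addressing a cycle: probabilities and recovery of the previous colouring -/

theorem Valid.uncolor_cycle (h : Valid G σ) (C : List (Fin n)) :
    Valid G (do
      let E ← edgesT C
      RecursiveWalk.uncolor (E.drop 2) σ : Timed (Table n q)).val :=
  h.uncolor _

/-- The probability that addressing `C` turns the colouring `σ` into `τ`. -/
noncomputable def addressProb (C : List (Fin n)) (σ τ : Table n q) : ℝ≥0∞ :=
  ((address C σ).map Timed.val) τ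

theorem unordered_drop (C : List (Fin n)) :
    unordered ((edgesT C).val.drop 2) = (edgeList C).drop 2 := by
  simp [unordered, edgesT, edgeList]

theorem adj_of_mem_drop {C : List (Fin n)} (h : Bichromatic σ C) (hσ : Valid G σ) :
    ∀ e ∈ (edgesT C).val.drop 2, G.Adj e.1 e.2 := by
  intro e he
  have : s(e.1, e.2) ∈ edgeList C := List.mem_map_of_mem (List.mem_of_mem_drop he)
  exact hσ.edge_adj (h.colored _ this)

theorem addressProb_le (hq : ∀ τ : Table n q, Valid G τ → ∀ u v, G.Adj u v →
      (available τ u v).val ≠ [])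
    {r : ℝ≥0∞} (hr : ∀ τ : Table n q, Valid G τ → ∀ u v, G.Adj u v →
      ((available τ u v).val.length : ℝ≥0∞)⁻¹ ≤ r)
    {C : List (Fin n)} (h : Bichromatic σ C) (hσ : Valid G σ) (τ : Table n q) :
    addressProb C σ τ ≤ r ^ (C.length - 2) := by
  have h1 : ((edgesT C).val.drop 2).length = C.length - 2 := by simp [edgesT]
  rw [← h1]
  refine recolor_apply_le hq hr (adj_of_mem_drop h hσ) ?_ (hσ.uncolor_cycle C) τ
  rw [unordered_drop]
  exact (nodup_edgeList h.nodup h.three_le).sublist (List.drop_sublist _ _)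

theorem address_support (hq : ∀ τ : Table n q, Valid G τ → ∀ u v, G.Adj u v →
      (available τ u v).val ≠ [])
    {C : List (Fin n)} (h : Bichromatic σ C) (hσ : Valid G σ) (hf : Full G σ)
    {τ : Timed (Table n q)} (hτ : τ ∈ (address C σ).support) :
    Valid G τ.val ∧ Full G τ.val ∧ ∀ z ∉ (edgeList C).drop 2, τ.val z = σ z := by
  obtain ⟨h1, h2, h3⟩ := recolor_support hq (adj_of_mem_drop h hσ) (hσ.uncolor_cycle C) hτ
  rw [unordered_drop] at h2 h3
  refine ⟨h1, fun u v huv => ?_, fun z hz => ?_⟩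
  · apply h3
    by_cases hz : s(u, v) ∈ (edgeList C).drop 2
    · exact Or.inl hz
    · right
      simp only [val_bind, uncolor_val, unordered_drop, hz, if_false]
      exact hf u v huv
  · rw [h2 z hz]
    simp only [val_bind, uncolor_val, unordered_drop, hz, if_false]

theorem exists_of_addressProb_ne_zero {C : List (Fin n)} {τ : Table n q}
    (h : addressProb C σ τ ≠ 0) : ∃ τ' ∈ (address C σ).support, τ'.val = τ := by
  rw [addressProb, ← PMF.mem_support_iff, PMF.mem_support_map_iff] at h
  exact h

/-- The first two edges of C keep their colours, and these determine the alternating colours of the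
whole cycle. -/
theorem Bichromatic.eq_of_address {C : List (Fin n)} {σ' τ : Table n q} (h : Bichromatic σ C)
    (h' : Bichromatic σ' C) (hz : ∀ z ∉ (edgeList C).drop 2, τ z = σ z)
    (hz' : ∀ z ∉ (edgeList C).drop 2, τ z = σ' z) : σ = σ' := by
  funext z
  by_cases hm : z ∈ (edgeList C).drop 2
  · obtain ⟨i, hi, rfl⟩ := List.getElem_of_mem hm
    have h3 := h.three_le
    rw [List.length_drop, length_edgeList] at hi
    rw [List.getElem_drop, h.color_eq (2 + i) (by omega), h'.color_eq (2 + i) (by omega)]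
    have hnot : (edgeList C)[(2 + i) % 2]'(by simp; omega) ∉ (edgeList C).drop 2 := by
      intro hc
      obtain ⟨j, hj, hj'⟩ := List.getElem_of_mem hc
      rw [List.getElem_drop] at hj'
      have := (nodup_edgeList h.nodup h.three_le).getElem_inj_iff.1 hj'
      omega
    rw [← hz _ hnot, ← hz' _ hnot]
  · rw [← hz z hm, ← hz' z hm]

theorem Bichromatic.of_agree {B : List (Fin n)} {τ : Table n q} (h : Bichromatic τ B)
    (hz : ∀ e ∈ edgeList B, τ e = σ e) : Bichromatic σ B := by
  refine ⟨h.nodup, h.three_le, fun e he => ?_, fun i hi => ?_⟩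
  · rw [← hz e he]; exact h.colored e he
  · rw [← hz _ (List.getElem_mem _), ← hz _ (List.getElem_mem _)]; exact h.periodic i hi

/-- By `Bichromatic.eq_of_address` at most one term is nonzero, so summing over all predecessors
costs nothing. This replaces the usual encoding of the history of the walk. -/
theorem sum_addressProb_le (hq : ∀ τ : Table n q, Valid G τ → ∀ u v, G.Adj u v →
      (available τ u v).val ≠ [])
    {r : ℝ≥0∞} (hr : ∀ τ : Table n q, Valid G τ → ∀ u v, G.Adj u v →
      ((available τ u v).val.length : ℝ≥0∞)⁻¹ ≤ r)
    {C : List (Fin n)} {A : Finset (Table n q)}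
    (hA : ∀ σ ∈ A, Bichromatic σ C ∧ Valid G σ ∧ Full G σ) (τ : Table n q) :
    ∑ σ ∈ A, addressProb C σ τ ≤ r ^ (C.length - 2) := by
  by_cases h0 : ∃ σ ∈ A, addressProb C σ τ ≠ 0
  · obtain ⟨σ, hσ, h0⟩ := h0
    rw [sum_eq_single_of_mem σ hσ]
    · exact addressProb_le hq hr (hA σ hσ).1 (hA σ hσ).2.1 τ
    · intro σ' hσ' hne
      by_contra h1
      apply hne
      obtain ⟨τ₁, m₁, rfl⟩ := exists_of_addressProb_ne_zero h0
      obtain ⟨τ₂, m₂, e⟩ := exists_of_addressProb_ne_zero h1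
      have b₁ := (address_support hq (hA σ hσ).1 (hA σ hσ).2.1 (hA σ hσ).2.2 m₁).2.2
      have b₂ := (address_support hq (hA σ' hσ').1 (hA σ' hσ').2.1 (hA σ' hσ').2.2 m₂).2.2
      rw [e] at b₂
      exact (hA σ' hσ').1.eq_of_address (hA σ hσ).1 b₂ b₁
  · push Not at h0
    rw [sum_eq_zero h0]
    exact zero_le

/-! ## An inequality for increasing sequences -/

/-- The left side consists of the terms of the expanded product with at most one factor `y i`. -/
theorem prod_add_sum_le {ι : Type*} [DecidableEq ι] (s : Finset ι) (x y : ι → NNReal) :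
    ∏ i ∈ s, x i + ∑ i ∈ s, y i * ∏ j ∈ s.erase i, x j ≤ ∏ i ∈ s, (x i + y i) := by
  induction s using Finset.induction_on with
  | empty => simp
  | insert a s ha ih =>
    rw [prod_insert ha, prod_insert ha, sum_insert ha, erase_insert ha]
    have e : ∑ i ∈ s, y i * ∏ j ∈ (insert a s).erase i, x j =
        x a * ∑ i ∈ s, y i * ∏ j ∈ s.erase i, x j := by
      rw [mul_sum]
      refine sum_congr rfl fun i hi => ?_
      have hia : a ≠ i := fun h => ha (h ▸ hi)
      rw [erase_insert_of_ne hia, prod_insert (fun h => ha (mem_of_mem_erase h))]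
      ring
    rw [e]
    calc x a * ∏ i ∈ s, x i + (y a * ∏ j ∈ s, x j + x a * ∑ i ∈ s, y i * ∏ j ∈ s.erase i, x j)
        = x a * (∏ i ∈ s, x i + ∑ i ∈ s, y i * ∏ j ∈ s.erase i, x j) + y a * ∏ j ∈ s, x j := by
          ring
      _ ≤ x a * ∏ i ∈ s, (x i + y i) + y a * ∏ j ∈ s, (x j + y j) := by
          gcongr
          simp
      _ = _ := by ring

section Increasing

variable {α ι : Type*} [LinearOrder α] [DecidableEq ι]

open scoped Classical in
/-- The total weight of the elements of `A` that are incident with `e`. -/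
noncomputable def through (inc : ι → α → Prop) (t : α → NNReal) (A : Finset α) (e : ι) : NNReal :=
  ∑ C ∈ A.filter (inc e), t C

theorem through_insert (inc : ι → α → Prop) (t : α → NNReal) {A : Finset α} {a : α} (ha : a ∉ A)
    (e : ι) [Decidable (inc e a)] :
    through inc t (insert a A) e = through inc t A e + if inc e a then t a else 0 := by
  classical
  rw [through, through, filter_insert]
  split_ifs with h
  · rw [sum_insert (fun hc => ha (mem_filter.1 hc).1), add_comm]
  · rw [add_zero]

open scoped Classical in
/-- The sum over increasing sequences, organised by their first element, is bounded by a product. -/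
theorem one_add_sum_le_prod (inc : ι → α → Prop) (t : α → NNReal) (s : Finset ι)
    (A : Finset α) :
    1 + ∑ e ∈ s, ∑ C ∈ A.filter (inc e),
      t C * ∏ e' ∈ s.erase e, (1 + through inc t (A.filter (C < ·)) e') ≤
      ∏ e ∈ s, (1 + through inc t A e) := by
  induction A using Finset.induction_on_min with
  | empty => simp [through]
  | insert a A ha ih =>
    have haA : a ∉ A := fun h => lt_irrefl a (ha a h)
    have hfa : (insert a A).filter (a < ·) = A := by
      rw [filter_insert, if_neg (lt_irrefl a), filter_true_of_mem ha]
    have hfC : ∀ C ∈ A, (insert a A).filter (C < ·) = A.filter (C < ·) := fun C hC => by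
      rw [filter_insert, if_neg (ha C hC).not_gt]
    -- A new least element a can only come first in a sequence, and is charged to a single index;
    -- the sequences that start later are unchanged.
    have hsplit : ∑ e ∈ s, ∑ C ∈ (insert a A).filter (inc e), t C * ∏ e' ∈ s.erase e,
          (1 + through inc t ((insert a A).filter (C < ·)) e') =
        ∑ e ∈ s, (if inc e a then t a else 0) * ∏ e' ∈ s.erase e, (1 + through inc t A e') +
          ∑ e ∈ s, ∑ C ∈ A.filter (inc e),
            t C * ∏ e' ∈ s.erase e, (1 + through inc t (A.filter (C < ·)) e') := by
      rw [← sum_add_distrib]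
      refine sum_congr rfl fun e _ => ?_
      have hrest : ∑ C ∈ A.filter (inc e), t C * ∏ e' ∈ s.erase e,
            (1 + through inc t ((insert a A).filter (C < ·)) e') =
          ∑ C ∈ A.filter (inc e), t C * ∏ e' ∈ s.erase e,
            (1 + through inc t (A.filter (C < ·)) e') :=
        sum_congr rfl fun C hC => by rw [hfC C (mem_filter.1 hC).1]
      rw [← hrest, filter_insert]
      split_ifs with h
      · rw [sum_insert (fun hc => haA (mem_filter.1 hc).1), hfa]
      · rw [zero_mul, zero_add]
    rw [hsplit]
    calc _ = (1 + ∑ e ∈ s, ∑ C ∈ A.filter (inc e),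
            t C * ∏ e' ∈ s.erase e, (1 + through inc t (A.filter (C < ·)) e')) +
          ∑ e ∈ s, (if inc e a then t a else 0) * ∏ e' ∈ s.erase e, (1 + through inc t A e') := by
          ring
      _ ≤ _ := add_le_add_left ih _
      _ ≤ _ := prod_add_sum_le s _ _
      _ = _ := by
          refine prod_congr rfl fun e _ => ?_
          rw [through_insert inc t haA, add_assoc]

end Increasing

end RecursiveWalk

namespace RecursiveWalk

open Finset

variable {n q : ℕ} {G : SimpleGraph (Fin n)} {σ : Table n q}

/-! ## Frames -/

/-- The bookkeeping for one active call: its cycle (`none` for the main loop), the edges through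
which it may still make calls, and the last call that it has made. -/
structure Frame (n : ℕ) where
  top : Option (List (Fin n))
  avail : Finset (Sym2 (Fin n))
  bound : WithBot (List (Fin n))

/-- Bichromatic cycles that meet the cycle of the frame and do not meet the cycles of the inner
calls may still be called by this frame. -/
def Clear (σ : Table n q) (inner : List (List (Fin n))) (f : Frame n) : Prop :=
  ∀ B, Bichromatic σ B → Canonical B → MeetsTop f.top B → (∀ D ∈ inner, ¬ Meets D B) →
    (∀ e ∈ edgeList B, (∀ D ∈ f.top, e ∈ edgeList D) → e ∈ f.avail) ∧ f.bound < B

/-- The frames, from the innermost call to the main loop, describe the colouring correctly. -/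
def Tracks (σ : Table n q) : List (List (Fin n)) → List (Frame n) → Prop
  | _, [] => False
  | inner, f :: g => Clear σ inner f ∧
    match f.top with
    | none => g = []
    | some D => Tracks σ (D :: inner) g

/-- The stack of the cycles of the frames. -/
def stackOf (g : List (Frame n)) : List (List (Fin n)) := g.filterMap Frame.top

/-- The bookkeeping is a promise about the bichromatic cycles that avoid the inner calls, so it
survives whenever no new cycle of this kind appears. -/
theorem Tracks.mono {σ τ : Table n q} {inner inner' : List (List (Fin n))} {g : List (Frame n)}
    (h : ∀ B, Bichromatic τ B → Canonical B → (∀ D ∈ inner', ¬ Meets D B) →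
      Bichromatic σ B ∧ ∀ D ∈ inner, ¬ Meets D B)
    (hg : Tracks σ inner g) : Tracks τ inner' g := by
  induction g generalizing inner inner' with
  | nil => exact hg
  | cons f g ih =>
    obtain ⟨top, avail, bound⟩ := f
    refine ⟨fun B h1 h2 h3 h4 => ?_, ?_⟩
    · obtain ⟨h5, h6⟩ := h B h1 h2 h4
      exact hg.1 B h5 h2 h3 h6
    · rcases top with _ | D
      · exact hg.2
      · refine ih (fun B h1 h2 h3 => ?_) hg.2
        obtain ⟨h5, h6⟩ := h B h1 h2 fun D hD => h3 D (List.mem_cons_of_mem _ hD)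
        refine ⟨h5, fun D' hD' => ?_⟩
        rcases List.mem_cons.1 hD' with rfl | hD'
        · exact h3 _ List.mem_cons_self
        · exact h6 D' hD'

theorem Tracks.head?_stackOf {f : Frame n} {g : List (Frame n)} (h : Tracks σ [] (f :: g)) :
    (stackOf (f :: g)).head? = f.top := by
  obtain ⟨top, avail, bound⟩ := f
  rcases top with _ | D
  · obtain rfl : g = [] := h.2
    rfl
  · rfl

/-- A call for D returns when no bichromatic cycle meets D; the outer frames then no longer need to
exempt the cycles meeting D. -/
theorem Tracks.pop {f : Frame n} {g : List (Frame n)} {D : List (Fin n)}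
    (h : Tracks σ [] (f :: g)) (hD : f.top = some D)
    (hnone : ∀ B, Bichromatic σ B → Canonical B → ¬ MeetsTop f.top B) : Tracks σ [] g := by
  have h2 := h.2
  rw [hD] at h2
  refine h2.mono fun B h3 h4 _ => ⟨h3, fun D' hD' hm => ?_⟩
  rw [List.mem_singleton] at hD'
  subst hD'
  exact hnone B h3 h4 fun E hE => by
    rw [hD, Option.mem_some_iff] at hE
    exact hE ▸ hm

/-- The frames after a call for the cycle `C`, which is charged to the edge `e`. -/
def push (C : List (Fin n)) (e : Sym2 (Fin n)) (f : Frame n) (g : List (Frame n)) :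
    List (Frame n) :=
  ⟨some C, (edgeList C).toFinset, ⊥⟩ :: ⟨f.top, f.avail.erase e, C⟩ :: g

theorem stackOf_push (C : List (Fin n)) (e : Sym2 (Fin n)) (f : Frame n) (g : List (Frame n)) :
    stackOf (push C e f g) = C :: stackOf (f :: g) := by
  simp [push, stackOf, List.filterMap_cons]

/-- Recolouring affects only edges of C, so bichromatic cycles that do not meet C were there before.
They avoid e, and by minimality of C they come strictly after it; hence e can be retired and the
bound raised to C. -/
theorem Tracks.push {f : Frame n} {g : List (Frame n)} {C : List (Fin n)} {e : Sym2 (Fin n)}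
    {τ : Table n q} (h : Tracks σ [] (f :: g))
    (hmin : ∀ B, Bichromatic σ B → Canonical B → MeetsTop f.top B → C ≤ B)
    (he : e ∈ edgeList C) (hz : ∀ z ∉ edgeList C, τ z = σ z) :
    Tracks τ [] (push C e f g) := by
  have hstep : ∀ B, Bichromatic τ B → ¬ Meets C B → Bichromatic σ B := fun B hB hm =>
    hB.of_agree fun z hzB => hz z fun hzC => hm ⟨z, hzC, hzB⟩
  refine ⟨fun B _ _ _ _ => ⟨fun z _ hzC => ?_, WithBot.bot_lt_coe _⟩,
    fun B h1 h2 h3 h4 => ?_, ?_⟩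
  · simpa using hzC C rfl
  · have hm := h4 C List.mem_cons_self
    have hB := hstep B h1 hm
    obtain ⟨h5, h6⟩ := h.1 B hB h2 h3 (by simp)
    refine ⟨fun z hzB hztop => mem_erase.2 ⟨?_, h5 z hzB hztop⟩, WithBot.coe_lt_coe.2 ?_⟩
    · rintro rfl
      exact hm ⟨z, he, hzB⟩
    · refine lt_of_le_of_ne (hmin B hB h2 h3) ?_
      rintro rfl
      exact hm ⟨e, he, he⟩
  · obtain ⟨top, avail, bound⟩ := f
    rcases top with _ | D
    · exact h.2
    · refine Tracks.mono (fun B h1 _ h3 => ?_) h.2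
      refine ⟨hstep B h1 (h3 C (by simp)), fun D' hD' => h3 D' ?_⟩
      simp at hD' ⊢
      exact Or.inl hD'

/-! ## The probability that the walk goes on -/

/-- The probability that the walk has not ended `N` steps after it was in a state with the given
colouring and the given stack. -/
noncomputable def undone : ℕ → Table n q → List (List (Fin n)) → ℝ≥0∞
  | 0, _, _ => 1
  | N + 1, σ, st =>
    match (select σ st.head?).val, st with
    | some C, st => ∑ τ, addressProb C σ τ * undone N τ (C :: st)
    | none, _ :: st => undone N σ st
    | none, [] => 0

theorem undone_call {N : ℕ} {st : List (List (Fin n))} {C : List (Fin n)}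
    (h : (select σ st.head?).val = some C) :
    undone (N + 1) σ st = ∑ τ, addressProb C σ τ * undone N τ (C :: st) := by
  rw [undone.eq_def]
  simp only [h]

theorem undone_return {N : ℕ} {st : List (List (Fin n))} {D : List (Fin n)}
    (h : (select σ (some D)).val = none) : undone (N + 1) σ (D :: st) = undone N σ st := by
  rw [undone.eq_def]
  simp only [List.head?_cons, h]

theorem undone_end {N : ℕ} (h : (select σ none).val = none) : undone (N + 1) σ [] = 0 := by
  rw [undone.eq_def]
  simp only [List.head?_nil, h]

/-- Incidence of edges and cycles. -/
def Inc (e : Sym2 (Fin n)) (C : List (Fin n)) : Prop := e ∈ edgeList C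

open scoped Classical in
/-- The cycles after a given bound. -/
noncomputable def later (G : SimpleGraph (Fin n)) (b : WithBot (List (Fin n))) :
    Finset (List (Fin n)) :=
  (evenCycles G).filter fun C => b < C

/-- The potential of a frame. -/
noncomputable def frameVal (G : SimpleGraph (Fin n)) (y : NNReal) (t : List (Fin n) → NNReal)
    (f : Frame n) : NNReal :=
  y * ∏ e ∈ f.avail, (1 + through Inc t (later G f.bound) e)

/-- The potential of a list of frames. -/
noncomputable def framesVal (G : SimpleGraph (Fin n)) (y : NNReal) (t : List (Fin n) → NNReal)
    (g : List (Frame n)) : NNReal := (g.map (frameVal G y t)).prod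

theorem one_le_framesVal {y : NNReal} (hy : 1 ≤ y) (t : List (Fin n) → NNReal)
    (g : List (Frame n)) : 1 ≤ framesVal G y t g := by
  refine List.one_le_prod_of_one_le fun v hv => ?_
  obtain ⟨f, -, rfl⟩ := List.mem_map.1 hv
  exact one_le_mul hy (Finset.one_le_prod' fun e _ => by simp)

theorem through_later_le (t : List (Fin n) → NNReal) (b : WithBot (List (Fin n)))
    (e : Sym2 (Fin n)) : through Inc t (later G b) e ≤ through Inc t (evenCycles G) e := by
  classical
  exact sum_le_sum_of_subset (filter_subset_filter _ (filter_subset _ _))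

open scoped Classical in
-- One step of the potential argument: the current frame either returns or calls a later cycle C
-- charged to an available edge. The new frame has potential at most y · S^|C| and the old one keeps
-- its own y, which is why `t C` contains y²: one factor for the call and one for its return.
theorem framesVal_push_sum_le {y S r : NNReal} {t : List (Fin n) → NNReal}
    (ht : ∀ C, t C = y ^ 2 * r ^ (C.length - 2) * S ^ C.length)
    (hS : ∀ e, 1 + through Inc t (evenCycles G) e ≤ S) (f : Frame n) (g : List (Frame n)) :
    y * (framesVal G y t g + ∑ e ∈ f.avail, ∑ C ∈ (later G f.bound).filter (Inc e),
      r ^ (C.length - 2) * framesVal G y t (push C e f g)) ≤ framesVal G y t (f :: g) := by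
  have hS1 : 1 ≤ S ∨ IsEmpty (Sym2 (Fin n)) := by
    rcases isEmpty_or_nonempty (Sym2 (Fin n)) with h | ⟨⟨e⟩⟩
    · exact Or.inr h
    · exact Or.inl (le_trans (by simp) (hS e))
  have h1 : ∀ e, ∀ C ∈ (later G f.bound).filter (Inc e),
      r ^ (C.length - 2) * framesVal G y t (push C e f g) ≤ framesVal G y t g *
        (t C * ∏ e' ∈ f.avail.erase e,
          (1 + through Inc t ((later G f.bound).filter (C < ·)) e')) := by
    intro e C hC
    have hC' := (mem_filter.1 (mem_filter.1 hC).1)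
    have hb := hC'.2
    have hcyc : IsEvenCycle G C := mem_evenCycles.1 hC'.1
    have hl : (later G f.bound).filter (C < ·) = later G C := by
      ext D
      simp only [later, mem_filter, WithBot.coe_lt_coe]
      constructor
      · exact fun h => ⟨h.1.1, h.2⟩
      · exact fun h => ⟨⟨h.1, hb.trans (WithBot.coe_lt_coe.2 h.2)⟩, h.2⟩
    have hprod : ∏ e' ∈ (edgeList C).toFinset, (1 + through Inc t (later G ⊥) e') ≤
        S ^ C.length := by
      refine (prod_le_pow_card _ _ S fun e' _ =>
        (add_le_add_right (through_later_le t _ e') _).trans (hS e')).trans (le_of_eq ?_)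
      rw [List.toFinset_card_of_nodup (nodup_edgeList hcyc.nodup (by have := hcyc.six_le; omega)),
        length_edgeList]
    rw [hl]
    simp only [framesVal, push, List.map_cons, List.prod_cons, frameVal, ht]
    calc _ = r ^ (C.length - 2) * (y * (y * (∏ e' ∈ f.avail.erase e,
            (1 + through Inc t (later G C) e')))) * (List.map (frameVal G y t) g).prod *
          ∏ e' ∈ (edgeList C).toFinset, (1 + through Inc t (later G ⊥) e') := by
          ring
      _ ≤ r ^ (C.length - 2) * (y * (y * (∏ e' ∈ f.avail.erase e,
            (1 + through Inc t (later G C) e')))) * (List.map (frameVal G y t) g).prod *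
          S ^ C.length := by gcongr
      _ = _ := by ring
  calc _ ≤ y * (framesVal G y t g + ∑ e ∈ f.avail, ∑ C ∈ (later G f.bound).filter (Inc e),
          framesVal G y t g * (t C * ∏ e' ∈ f.avail.erase e,
          (1 + through Inc t ((later G f.bound).filter (C < ·)) e'))) := by
        exact mul_le_mul' le_rfl (add_le_add le_rfl (sum_le_sum fun e _ => sum_le_sum (h1 e)))
    _ = y * framesVal G y t g * (1 + ∑ e ∈ f.avail, ∑ C ∈ (later G f.bound).filter (Inc e),
          t C * ∏ e' ∈ f.avail.erase e,
            (1 + through Inc t ((later G f.bound).filter (C < ·)) e')) := by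
        simp only [← mul_sum]; ring
    _ ≤ y * framesVal G y t g * ∏ e ∈ f.avail, (1 + through Inc t (later G f.bound) e) := by
        refine mul_le_mul' le_rfl ?_
        convert one_add_sum_le_prod Inc t f.avail (later G f.bound)
    _ = _ := by simp only [framesVal, List.map_cons, List.prod_cons, frameVal]; ring

open scoped Classical in
/-- The complete colourings that are described by the frames. -/
noncomputable def tracked (G : SimpleGraph (Fin n)) (q : ℕ) (g : List (Frame n)) :
    Finset (Table n q) :=
  univ.filter fun σ => Valid G σ ∧ Full G σ ∧ Tracks σ [] g

theorem mem_tracked {g : List (Frame n)} :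
    σ ∈ tracked G q g ↔ Valid G σ ∧ Full G σ ∧ Tracks σ [] g := by
  simp [tracked]

/-- Exchange the two sums: for a fixed outcome τ, the probabilities from all colourings in which C
is selected add up to at most r^(|C|-2). -/
theorem sum_undone_push_le (hq : ∀ τ : Table n q, Valid G τ → ∀ u v, G.Adj u v →
      (available τ u v).val ≠ [])
    {r : ℝ≥0∞} (hr : ∀ τ : Table n q, Valid G τ → ∀ u v, G.Adj u v →
      ((available τ u v).val.length : ℝ≥0∞)⁻¹ ≤ r)
    (N : ℕ) (f : Frame n) (g : List (Frame n)) (C : List (Fin n)) {e : Sym2 (Fin n)}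
    (he : e ∈ edgeList C) :
    ∑ σ ∈ (tracked G q (f :: g)).filter (fun σ => (select σ f.top).val = some C),
        ∑ τ, addressProb C σ τ * undone N τ (C :: stackOf (f :: g)) ≤
      r ^ (C.length - 2) * ∑ τ ∈ tracked G q (push C e f g), undone N τ (stackOf (push C e f g)) := by
  set A := (tracked G q (f :: g)).filter (fun σ => (select σ f.top).val = some C) with hA
  have hAm : ∀ σ ∈ A, (Bichromatic σ C ∧ Valid G σ ∧ Full G σ) ∧ Tracks σ [] (f :: g) ∧
      ∀ B, Bichromatic σ B → Canonical B → MeetsTop f.top B → C ≤ B := by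
    intro σ hσ
    simp only [hA, mem_filter, mem_tracked] at hσ
    obtain ⟨h1, h2, h3, h4⟩ := select_some hσ.1.1 hσ.2
    exact ⟨⟨h1, hσ.1.1, hσ.1.2.1⟩, hσ.1.2.2, h4⟩
  have hto : ∀ σ ∈ A, ∀ τ, addressProb C σ τ ≠ 0 → τ ∈ tracked G q (push C e f g) := by
    intro σ hσ τ hτ
    obtain ⟨⟨h1, h2, h3⟩, h4, h5⟩ := hAm σ hσ
    obtain ⟨τ', hτ', rfl⟩ := exists_of_addressProb_ne_zero hτ
    obtain ⟨h6, h7, h8⟩ := address_support hq h1 h2 h3 hτ'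
    exact mem_tracked.2 ⟨h6, h7, h4.push h5 he fun z hz => h8 z fun hc => hz (List.mem_of_mem_drop hc)⟩
  have h1 : ∀ σ ∈ A, ∑ τ, addressProb C σ τ * undone N τ (C :: stackOf (f :: g)) =
      ∑ τ ∈ tracked G q (push C e f g),
        addressProb C σ τ * undone N τ (C :: stackOf (f :: g)) := by
    intro σ hσ
    refine (sum_subset (subset_univ _) fun τ _ hτ => ?_).symm
    rw [not_not.1 fun h => hτ (hto σ hσ τ h), zero_mul]
  rw [sum_congr rfl h1, sum_comm, mul_sum, stackOf_push]
  refine sum_le_sum fun τ _ => ?_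
  rw [← sum_mul]
  gcongr
  exact sum_addressProb_le hq hr (fun σ hσ => (hAm σ hσ).1) τ

/-- Summing over all tracked colourings, instead of fixing one, is what makes the induction on N
work: after a call, recoverability turns this sum into a sum over the colourings tracked by the new
frames. -/
theorem sum_undone_le (hq : ∀ τ : Table n q, Valid G τ → ∀ u v, G.Adj u v →
      (available τ u v).val ≠ [])
    {y S r : NNReal} (hy : 1 ≤ y) (hr : ∀ τ : Table n q, Valid G τ → ∀ u v, G.Adj u v →
      ((available τ u v).val.length : ℝ≥0∞)⁻¹ ≤ r)
    {t : List (Fin n) → NNReal} (ht : ∀ C, t C = y ^ 2 * r ^ (C.length - 2) * S ^ C.length)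
    (hS : ∀ e, 1 + through Inc t (evenCycles G) e ≤ S) (N : ℕ) (g : List (Frame n)) :
    (y : ℝ≥0∞) ^ N * ∑ σ ∈ tracked G q g, undone N σ (stackOf g) ≤
      Fintype.card (Table n q) * (framesVal G y t g : ℝ≥0∞) := by
  classical
  induction N generalizing g with
  | zero =>
    simp only [undone, sum_const, pow_zero, one_mul, nsmul_eq_mul, mul_one]
    calc ((tracked G q g).card : ℝ≥0∞) ≤ Fintype.card (Table n q) * 1 := by
          rw [mul_one]; exact_mod_cast card_le_univ _
      _ ≤ _ := by gcongr; exact_mod_cast one_le_framesVal hy t g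
  | succ N ih =>
    rcases g with _ | ⟨f, g⟩
    · have : tracked G q [] = ∅ := by
        rw [eq_empty_iff_forall_notMem]
        exact fun σ hσ => (mem_tracked.1 hσ).2.2
      simp [this]
    set T : ℝ≥0∞ := (Fintype.card (Table n q) : ℝ≥0∞)
    have hhead : ∀ σ ∈ tracked G q (f :: g), (stackOf (f :: g)).head? = f.top := fun σ hσ =>
      (mem_tracked.1 hσ).2.2.head?_stackOf
    have hpop : (y : ℝ≥0∞) ^ N * ∑ σ ∈ (tracked G q (f :: g)).filter
        (fun σ => (select σ f.top).val = none), undone (N + 1) σ (stackOf (f :: g)) ≤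
        T * framesVal G y t g := by
      refine le_trans ?_ (ih g)
      gcongr
      rcases hf : f.top with _ | D
      · rw [sum_eq_zero]
        · exact zero_le
        · intro σ hσ
          simp only [mem_filter] at hσ
          have hst : stackOf (f :: g) = [] := by
            have := hhead σ hσ.1
            rwa [hf, List.head?_eq_none_iff] at this
          rw [hst, undone_end (hf ▸ hσ.2)]
      · have hst : stackOf (f :: g) = D :: stackOf g := by simp [stackOf, hf]
        rw [hst]
        calc _ = ∑ σ ∈ (tracked G q (f :: g)).filter (fun σ => (select σ (some D)).val = none),
              undone N σ (stackOf g) := by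
              refine sum_congr rfl fun σ hσ => ?_
              simp only [mem_filter] at hσ
              exact undone_return hσ.2
          _ ≤ _ := by
              refine sum_le_sum_of_subset fun σ hσ => ?_
              simp only [mem_filter, mem_tracked] at hσ ⊢
              refine ⟨hσ.1.1, hσ.1.2.1, hσ.1.2.2.pop hf fun B h1 h2 => ?_⟩
              rw [hf]
              exact select_none hσ.1.1 hσ.2 B h1 h2
    have hpush : (y : ℝ≥0∞) ^ N * ∑ σ ∈ (tracked G q (f :: g)).filter
        (fun σ => ¬ (select σ f.top).val = none), undone (N + 1) σ (stackOf (f :: g)) ≤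
        T * ∑ e ∈ f.avail, ∑ C ∈ (later G f.bound).filter (Inc e),
          (r : ℝ≥0∞) ^ (C.length - 2) * framesVal G y t (push C e f g) := by
      set Q : List (Fin n) → Finset (Table n q) := fun C =>
        (tracked G q (f :: g)).filter (fun σ => (select σ f.top).val = some C) with hQ
      -- The selected cycle comes after the bound and can be charged: to an edge shared with the
      -- calling cycle or, in the main loop, to any of its edges.
      have hex : ∀ C, ∀ σ ∈ Q C, C ∈ later G f.bound ∧ ∃ e ∈ f.avail, e ∈ edgeList C := by
        intro C σ hσ
        simp only [hQ, mem_filter, mem_tracked] at hσ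
        obtain ⟨h1, h2, h3, -⟩ := select_some hσ.1.1 hσ.2
        obtain ⟨h5, h6⟩ := hσ.1.2.2.1 C h1 h2 h3 (by simp)
        refine ⟨?_, ?_⟩
        · simp only [later, mem_filter, mem_evenCycles]
          exact ⟨h1.isEvenCycle hσ.1.1 h2, h6⟩
        · rcases hf : f.top with _ | D
          · have hm := List.getElem_mem (l := edgeList C) (n := 0)
              (by have := h1.three_le; simp; omega)
            exact ⟨_, h5 _ hm (by simp [hf]), hm⟩
          · obtain ⟨e, he, he'⟩ := h3 D (by simp [hf])
            refine ⟨e, h5 e he' fun D' hD' => ?_, he'⟩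
            rw [hf, Option.mem_some_iff] at hD'
            exact hD' ▸ he
      have hle : ∑ σ ∈ (tracked G q (f :: g)).filter
          (fun σ => ¬ (select σ f.top).val = none), undone (N + 1) σ (stackOf (f :: g)) ≤
          ∑ C ∈ later G f.bound, ∑ σ ∈ Q C,
            ∑ τ, addressProb C σ τ * undone N τ (C :: stackOf (f :: g)) := by
        calc _ ≤ ∑ σ ∈ (later G f.bound).biUnion Q, undone (N + 1) σ (stackOf (f :: g)) := by
              refine sum_le_sum_of_subset fun σ hσ => ?_
              rw [mem_filter] at hσ
              obtain ⟨C, hC⟩ := Option.ne_none_iff_exists'.1 hσ.2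
              have hm : σ ∈ Q C := mem_filter.2 ⟨hσ.1, hC⟩
              exact mem_biUnion.2 ⟨C, (hex C σ hm).1, hm⟩
          _ ≤ ∑ C ∈ later G f.bound, ∑ σ ∈ Q C, undone (N + 1) σ (stackOf (f :: g)) := by
              rw [sum_biUnion]
              intro C _ C' _ hne
              rw [Function.onFun, disjoint_left]
              intro σ h1 h2
              have h1' := (mem_filter.1 h1).2
              have h2' := (mem_filter.1 h2).2
              rw [h1', Option.some.injEq] at h2'
              exact hne h2'
          _ = _ := by
              refine sum_congr rfl fun C _ => sum_congr rfl fun σ hσ => ?_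
              have h1 := mem_filter.1 hσ
              exact undone_call (by rw [hhead σ h1.1]; exact h1.2)
      calc _ ≤ (y : ℝ≥0∞) ^ N * ∑ C ∈ later G f.bound, ∑ σ ∈ Q C,
            ∑ τ, addressProb C σ τ * undone N τ (C :: stackOf (f :: g)) := by gcongr
        _ = ∑ C ∈ later G f.bound, (y : ℝ≥0∞) ^ N * ∑ σ ∈ Q C,
            ∑ τ, addressProb C σ τ * undone N τ (C :: stackOf (f :: g)) := by rw [mul_sum]
        _ ≤ ∑ C ∈ later G f.bound, ∑ e ∈ f.avail.filter (fun e => Inc e C),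
            T * ((r : ℝ≥0∞) ^ (C.length - 2) * framesVal G y t (push C e f g)) := by
            refine sum_le_sum fun C _ => ?_
            rcases (Q C).eq_empty_or_nonempty with h0 | ⟨σ, hσ⟩
            · rw [h0]; simp
            · obtain ⟨e, he, heC⟩ := (hex C σ hσ).2
              -- One admissible edge suffices for the charge; allowing all of them only enlarges the
              -- bound and makes it independent of σ.
              refine le_trans ?_ (single_le_sum (f := fun e => T * ((r : ℝ≥0∞) ^ (C.length - 2) *
                framesVal G y t (push C e f g))) (fun _ _ => zero_le)
                (mem_filter.2 ⟨he, heC⟩))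
              calc _ ≤ (y : ℝ≥0∞) ^ N * ((r : ℝ≥0∞) ^ (C.length - 2) *
                    ∑ τ ∈ tracked G q (push C e f g), undone N τ (stackOf (push C e f g))) := by
                    gcongr
                    exact sum_undone_push_le hq hr N f g C heC
                _ = (r : ℝ≥0∞) ^ (C.length - 2) * ((y : ℝ≥0∞) ^ N *
                    ∑ τ ∈ tracked G q (push C e f g), undone N τ (stackOf (push C e f g))) := by
                    ring
                _ ≤ (r : ℝ≥0∞) ^ (C.length - 2) * (T * framesVal G y t (push C e f g)) := by
                    exact mul_le_mul' le_rfl (ih _)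
                _ = _ := by ring
        _ = _ := by
            rw [mul_sum]
            simp only [mul_sum, sum_filter, mul_ite, mul_zero]
            rw [sum_comm]
    have hmain := framesVal_push_sum_le ht hS f g
    rw [← sum_filter_add_sum_filter_not (tracked G q (f :: g))
      (fun σ => (select σ f.top).val = none), pow_succ]
    calc _ = (y : ℝ≥0∞) * ((y : ℝ≥0∞) ^ N * ∑ σ ∈ (tracked G q (f :: g)).filter
          (fun σ => (select σ f.top).val = none), undone (N + 1) σ (stackOf (f :: g)) +
          (y : ℝ≥0∞) ^ N * ∑ σ ∈ (tracked G q (f :: g)).filter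
          (fun σ => ¬ (select σ f.top).val = none), undone (N + 1) σ (stackOf (f :: g))) := by
          ring
      _ ≤ (y : ℝ≥0∞) * (T * framesVal G y t g +
          T * ∑ e ∈ f.avail, ∑ C ∈ (later G f.bound).filter (Inc e),
          (r : ℝ≥0∞) ^ (C.length - 2) * framesVal G y t (push C e f g)) := by gcongr
      _ = T * ((y * (framesVal G y t g + ∑ e ∈ f.avail, ∑ C ∈ (later G f.bound).filter (Inc e),
          r ^ (C.length - 2) * framesVal G y t (push C e f g)) : NNReal) : ℝ≥0∞) := by
          push_cast
          ring
      _ ≤ _ := by gcongr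

end RecursiveWalk

namespace RecursiveWalk

open Finset

variable {n q : ℕ} {G : SimpleGraph (Fin n)} {σ : Table n q}

/-! ## The run of the walk -/

theorem tsum_bind_mul {α β : Type} (p : PMF α) (f : α → PMF β) (h : β → ℝ≥0∞) :
    ∑' b, (p.bind f) b * h b = ∑' a, p a * ∑' b, f a b * h b := by
  simp only [PMF.bind_apply, ← ENNReal.tsum_mul_right, ← ENNReal.tsum_mul_left, mul_assoc]
  exact ENNReal.tsum_comm

theorem tsum_pure_mul {α : Type} (a : α) (h : α → ℝ≥0∞) : ∑' b, PMF.pure a b * h b = h a := by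
  rw [tsum_eq_single a]
  · simp
  · intro b hb
    simp [PMF.pure_apply, hb]

theorem tsum_map_mul {α β : Type} (p : PMF α) (f : α → β) (h : β → ℝ≥0∞) :
    ∑' b, (p.map f) b * h b = ∑' a, p a * h (f a) := by
  rw [PMF.map, tsum_bind_mul]
  simp only [Function.comp_apply, tsum_pure_mul]

open scoped Classical in
/-- The probability that the walk has not ended `k` steps after a given state. -/
noncomputable def goOn (k : ℕ) (S : State n q) : ℝ≥0∞ :=
  if S.done = true then 0 else undone k S.coloring S.stack

theorem step_of_done {S : State n q} (h : S.done = true) : step S = PMF.pure S := by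
  simp [step, h]

theorem step_call {S : State n q} (h : S.done = false) {C : List (Fin n)}
    (hC : (select S.coloring S.stack.head?).val = some C) :
    step S = (address C S.coloring).map fun σ => ⟨σ.val, C :: S.stack, false,
      S.time + (select S.coloring S.stack.head?).time + σ.time + 1⟩ := by
  rw [step]
  simp only [h, Bool.false_eq_true, if_false, hC]

theorem step_return {S : State n q} (h : S.done = false)
    (hC : (select S.coloring S.stack.head?).val = none) {D : List (Fin n)}
    {st : List (List (Fin n))} (hst : S.stack = D :: st) :
    step S = PMF.pure ⟨S.coloring, st, false,
      S.time + (select S.coloring S.stack.head?).time + 1⟩ := by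
  obtain ⟨σ, st', dn, tm⟩ := S
  subst h hst
  rw [step]
  simp only [Bool.false_eq_true, if_false]
  simp only [hC]

theorem step_end {S : State n q} (h : S.done = false)
    (hC : (select S.coloring S.stack.head?).val = none) (hst : S.stack = []) :
    step S = PMF.pure ⟨S.coloring, [], true,
      S.time + (select S.coloring S.stack.head?).time + 1⟩ := by
  obtain ⟨σ, st', dn, tm⟩ := S
  subst h hst
  rw [step]
  simp only [Bool.false_eq_true, if_false]
  simp only [hC]

/-- The backward equation, which links the recursion for `undone` on colourings and stacks with the
actual process including its clock. -/
theorem tsum_step_mul_goOn (k : ℕ) (S : State n q) :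
    ∑' S', step S S' * goOn k S' = goOn (k + 1) S := by
  rcases hd : S.done with _ | _
  · have h1 : goOn (k + 1) S = undone (k + 1) S.coloring S.stack := by simp [goOn, hd]
    rw [h1]
    rcases ho : (select S.coloring S.stack.head?).val with _ | C
    · rcases hst : S.stack with _ | ⟨D, st⟩
      · rw [step_end hd ho hst, tsum_pure_mul]
        rw [hst] at ho
        rw [undone_end ho]
        simp [goOn]
      · rw [step_return hd ho hst, tsum_pure_mul]
        rw [hst] at ho
        rw [undone_return ho]
        simp [goOn]
    · rw [step_call hd ho, tsum_map_mul, undone_call ho]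
      simp only [goOn, Bool.false_eq_true, if_false]
      rw [← tsum_fintype (L := SummationFilter.unconditional _)]
      exact (tsum_map_mul (address C S.coloring) Timed.val
        (fun τ => undone k τ (C :: S.stack))).symm
  · rw [step_of_done hd, tsum_pure_mul]
    simp [goOn, hd]

theorem tsum_run_mul_goOn [DecidableRel G.Adj] (N k : ℕ) :
    ∑' S, run G q N S * goOn k S = goOn (N + k) (start G q) := by
  induction N generalizing k with
  | zero => rw [run, tsum_pure_mul, zero_add]
  | succ N ih =>
    rw [run, tsum_bind_mul]
    simp only [tsum_step_mul_goOn]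
    rw [ih, show N + 1 + k = N + (k + 1) by ring]

/-! ## Operation counts -/

section Time

variable {α : Type}

theorem findT_time_le {test : α → Timed Bool} {B : ℕ} {l : List α}
    (h : ∀ x ∈ l, (test x).time ≤ B) : (findT test l).time ≤ l.length * (B + 1) + 1 := by
  induction l with
  | nil => simp [findT]
  | cons x l ih =>
    have h1 := ih fun y hy => h y (List.mem_cons_of_mem _ hy)
    have h2 := h x List.mem_cons_self
    simp only [findT, time_bind, time_op, List.length_cons]
    have h3 : (l.length + 1) * (B + 1) = l.length * (B + 1) + (B + 1) := by ring
    split_ifs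
    · simp only [time_pure]; omega
    · omega

theorem anyT_time_le {test : α → Timed Bool} {B : ℕ} {l : List α}
    (h : ∀ x ∈ l, (test x).time ≤ B) : (anyT test l).time ≤ l.length * (B + 1) + 2 := by
  have := findT_time_le h
  simp only [anyT, time_bind, time_op]
  omega

theorem filterT_time_le {test : α → Timed Bool} {B : ℕ} {l : List α}
    (h : ∀ x ∈ l, (test x).time ≤ B) : (filterT test l).time ≤ l.length * (B + 1) + 1 := by
  induction l with
  | nil => simp [filterT]
  | cons x l ih =>
    have h1 := ih fun y hy => h y (List.mem_cons_of_mem _ hy)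
    have h2 := h x List.mem_cons_self
    simp only [filterT, time_bind, List.length_cons]
    have h3 : (l.length + 1) * (B + 1) = l.length * (B + 1) + (B + 1) := by ring
    split_ifs <;> simp only [time_op] <;> omega

end Time

section Bounds

variable {R : Type*} [CommSemiring R]

/-- A bound for the time that `available` takes. -/
def availableBound (n q : R) : R := q * (n * (4 * n + 6) + 2 + 1 + 1) + 1

/-- A bound for the time that `select` takes. -/
def selectBound (n q : R) : R :=
  n * (q * q) * ((n * (3 * n + 4) + 1) +
    ((3 * n + 6) + (4 * n + n * (2 * n + 3) + 5) + (2 * n + 2) + 1) + 2) + 1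

/-- A bound for the time that one step of the walk takes. -/
def stepBound (n q : R) : R :=
  selectBound n q + ((3 * n + 2) + n * (availableBound n q + q + 2)) + 1

/-- A bound for the time that `N` steps of the walk take. -/
def runBound (n q N : R) : R :=
  n * n * (availableBound n q + 2) + 1 + N * stepBound n q

end Bounds

theorem fourForbidden_time_le (σ : Table n q) (u v : Fin n) (a : Fin q) :
    (fourForbidden σ u v a).time ≤ n * (4 * n + 6) + 2 := by
  have h1 : ∀ x : Fin n, ∀ o : Option (Fin q), (anyT (fun y => do
      let xy ← op (σ s(x, y))
      let yv ← op (σ s(y, v))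
      op (decide (xy = some a ∧ yv = o))) (List.finRange n)).time ≤ n * (3 + 1) + 2 := by
    intro x o
    refine (anyT_time_le (B := 3) fun y _ => ?_).trans (by simp)
    simp
  refine (anyT_time_le (B := 4 * n + 5) fun x _ => ?_).trans (by simp)
  simp only [time_bind, time_op]
  split
  · simp only [time_pure]; omega
  · split
    · simp only [time_op]; omega
    · refine (Nat.add_le_add_left (Nat.add_le_add_left (Nat.add_le_add_left
        (h1 x (σ s(u, x))) _) _) _).trans ?_
      omega

theorem available_time_le (σ : Table n q) (u v : Fin n) :
    (available σ u v).time ≤ availableBound n q := by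
  refine (filterT_time_le (B := n * (4 * n + 6) + 2 + 1) fun a _ => ?_).trans
    (by simp [availableBound])
  simp only [time_bind, time_op]
  have := fourForbidden_time_le σ u v a
  omega

theorem greedy_time_le [DecidableRel G.Adj] (l : List (Fin n × Fin n)) (σ : Table n q) :
    (greedy G l σ).time ≤ l.length * (availableBound n q + 2) + 1 := by
  induction l generalizing σ with
  | nil => simp [greedy]
  | cons e l ih =>
    obtain ⟨u, v⟩ := e
    have h3 : (l.length + 1) * (availableBound n q + 2) =
      l.length * (availableBound n q + 2) + (availableBound n q + 2) := by ring
    simp only [greedy, time_bind, time_op, List.length_cons]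
    split
    · simp only [time_bind, time_op]
      have h1 := available_time_le σ u v
      have h2 := ih (op (Function.update σ s(u, v) (available σ u v).val.head?)).val
      omega
    · have := ih σ
      omega

theorem traceT_time_le (σ : Table n q) (v₀ : Fin n) (k : ℕ) (cur : Fin n) (a b : Fin q) :
    (traceT σ v₀ k cur a b).time ≤ k * (3 * n + 4) + 1 := by
  induction k generalizing cur a b with
  | zero => simp [traceT]
  | succ k ih =>
    have h1 : (findT (fun w => do
      let c ← op (σ s(cur, w))
      op (decide (c = some a))) (List.finRange n)).time ≤ n * (2 + 1) + 1 :=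
      (findT_time_le (B := 2) fun w _ => by simp).trans (by simp)
    have h3 : (k + 1) * (3 * n + 4) = k * (3 * n + 4) + (3 * n + 4) := by ring
    rw [traceT, time_bind]
    rcases (findT (fun w => do
      let c ← op (σ s(cur, w))
      op (decide (c = some a))) (List.finRange n)).val with _ | w
    · simp only [time_op]; omega
    · simp only [time_bind, time_op]
      split
      · simp only [time_op]; omega
      · simp only [time_bind, time_op]
        have := ih w b a
        omega

theorem canonicalT_time_le {C : List (Fin n)} (hC : C.length ≤ n) :
    (canonicalT C).time ≤ 3 * n + 6 := by
  rcases C with _ | ⟨v, _ | ⟨x, _ | ⟨y, l⟩⟩⟩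
  · simp [canonicalT]
  · simp [canonicalT]
  · simp [canonicalT]
  · have h1 := anyT_time_le (B := 1) (test := fun w => op (decide (w < v))) (l := x :: y :: l)
      fun w _ => by simp
    simp only [canonicalT, time_bind, time_op]
    simp only [List.length_cons] at *
    omega

theorem meetT_time_le {C D : List (Fin n)} (hC : C.length ≤ n) (hD : D.length ≤ n) :
    (meetT C D).time ≤ 4 * n + n * (2 * n + 3) + 4 := by
  have h1 : ∀ e : Fin n × Fin n, (anyT (fun e' => op (decide (s(e.1, e.2) = s(e'.1, e'.2))))
      (D.zip (D.rotate 1))).time ≤ 2 * n + 2 := fun e =>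
    (anyT_time_le (B := 1) fun _ _ => by simp).trans (by simp; omega)
  have h2 := anyT_time_le (B := 2 * n + 2) (l := C.zip (C.rotate 1)) fun e _ => h1 e
  have h3 : (C.zip (C.rotate 1)).length * (2 * n + 2 + 1) ≤ n * (2 * n + 3) :=
    Nat.mul_le_mul (by simpa using hC) le_rfl
  simp only [meetT, edgesT, time_bind]
  omega

theorem precedesT_time_le (C D : List (Fin n)) : (precedesT C D).time ≤ 2 * C.length + 1 := by
  induction C generalizing D with
  | nil => cases D <;> simp [precedesT]
  | cons x C ih =>
    rcases D with _ | ⟨y, D⟩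
    · simp [precedesT]
    · have := ih D
      simp only [precedesT, time_bind, time_op, List.length_cons]
      split
      · simp only [time_pure]; omega
      · simp only [time_bind, time_op]
        split
        · simp only [time_pure]; omega
        · omega

theorem betterT_time_le {top best : Option (List (Fin n))} {C : List (Fin n)}
    (hC : C.length ≤ n) (htop : ∀ D ∈ top, D.length ≤ n) :
    (betterT top best C).time ≤
      (3 * n + 6) + (4 * n + n * (2 * n + 3) + 5) + (2 * n + 2) + 1 := by
  have h1 := canonicalT_time_le hC
  rcases top with _ | D <;> rcases best with _ | D'
  · simp only [betterT, time_bind, time_op]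
    omega
  · have h3 := precedesT_time_le C D'
    simp only [betterT, time_bind, time_op]
    omega
  · have h2 := meetT_time_le (htop D rfl) hC
    simp only [betterT, time_bind, time_op]
    omega
  · have h2 := meetT_time_le (htop D rfl) hC
    have h3 := precedesT_time_le C D'
    simp only [betterT, time_bind, time_op]
    omega

theorem select_time_le (hσ : Valid G σ) {top : Option (List (Fin n))}
    (htop : ∀ D ∈ top, D.length ≤ n) : (select σ top).time ≤ selectBound n q := by
  set B := (n * (3 * n + 4) + 1) +
    ((3 * n + 6) + (4 * n + n * (2 * n + 3) + 5) + (2 * n + 2) + 1) + 2 with hB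
  have key : ∀ (l : List (Fin n × Fin q × Fin q)) (best : Option (List (Fin n))),
      (selectFrom σ top l best).time ≤ l.length * B + 1 := by
    intro l
    induction l with
    | nil => simp [selectFrom]
    | cons e l ih =>
      intro best
      obtain ⟨v, a, b⟩ := e
      have h1 := traceT_time_le σ v n v a b
      have h3 : (l.length + 1) * B = l.length * B + B := by ring
      rw [selectFrom, time_bind]
      rcases ho : (traceT σ v n v a b).val with _ | C
      · simp only [time_bind, time_op, List.length_cons]
        have := ih best
        omega
      · simp only [time_bind, time_op, val_op, List.length_cons]
        have h4 := ((traceT_eq_some_iff hσ).1 ho).2.1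
        have h5 := betterT_time_le (best := best) h4 htop
        have h6 := ih (if (betterT top best C).val = true then some C else best)
        omega
  refine (key _ _).trans (le_of_eq ?_)
  simp [selectBound, hB, List.length_product]

theorem uncolor_time (l : List (Fin n × Fin n)) (σ : Table n q) :
    (uncolor l σ).time = l.length + 1 := by
  induction l generalizing σ with
  | nil => simp [uncolor]
  | cons e l ih => simp only [uncolor, time_bind, time_op, val_op, ih, List.length_cons]; omega

theorem recolor_time_le {l : List (Fin n × Fin n)} {σ τ : Timed (Table n q)}
    (hτ : τ ∈ (recolor l σ).support) :
    τ.time ≤ σ.time + l.length * (availableBound n q + q + 2) := by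
  induction l generalizing σ with
  | nil =>
    rw [recolor, PMF.mem_support_pure_iff] at hτ
    subst hτ
    simp
  | cons e l ih =>
    rw [recolor, PMF.mem_support_bind_iff] at hτ
    obtain ⟨o, -, hτ⟩ := hτ
    have h1 := ih hτ
    have h2 := available_time_le σ.val e.1 e.2
    have h3 : (available σ.val e.1 e.2).val.length ≤ q := by
      simpa using (nodup_available σ.val e.1 e.2).length_le_card
    have h4 : (l.length + 1) * (availableBound n q + q + 2) =
      l.length * (availableBound n q + q + 2) + (availableBound n q + q + 2) := by ring
    simp only [List.length_cons] at *
    omega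

theorem address_time_le {C : List (Fin n)} (hC : C.length ≤ n) {τ : Timed (Table n q)}
    (hτ : τ ∈ (address C σ).support) :
    τ.time ≤ (3 * n + 2) + n * (availableBound n q + q + 2) := by
  have h1 := recolor_time_le hτ
  have h2 : ((edgesT C).val.drop 2).length ≤ n := by simp [edgesT]; omega
  have h3 := Nat.mul_le_mul_right (availableBound n q + q + 2) h2
  have h4 : (edgesT C).time = 2 * C.length + 1 := rfl
  rw [time_bind, uncolor_time, h4] at h1
  omega

/-! ## Reachable states -/

/-- What is known about a state after at most `N` steps. -/
structure Reachable (G : SimpleGraph (Fin n)) (N : ℕ) (S : State n q) : Prop where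
  valid : Valid G S.coloring
  full : Full G S.coloring
  length_le : ∀ D ∈ S.stack, D.length ≤ n
  of_done : S.done = true → HoldsAcyclicColoring G S.coloring
  time_le : S.time ≤ runBound n q N

theorem reachable_start [DecidableRel G.Adj]
    (hq : 2 * G.maxDegree < q ∨ ∀ u v, ¬ G.Adj u v) : Reachable G 0 (start G q) := by
  have h := greedy_spec (q := q) hq (List.finRange n ×ˢ List.finRange n)
    ((List.nodup_finRange n).product (List.nodup_finRange n)) _ (valid_empty G)
    (fun u v _ _ => Or.inl (by simp [List.mem_product]))
  refine ⟨h.1, h.2, by simp [start], by simp [start], ?_⟩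
  refine (greedy_time_le (G := G) (List.finRange n ×ˢ List.finRange n) _).trans ?_
  simp [runBound, List.length_product]

theorem Reachable.step {N : ℕ} {S S' : State n q}
    (hq : ∀ τ : Table n q, Valid G τ → ∀ u v, G.Adj u v → (available τ u v).val ≠ [])
    (h : Reachable G N S) (hS : S' ∈ (step S).support) : Reachable G (N + 1) S' := by
  have htop : ∀ D ∈ S.stack.head?, D.length ≤ n := fun D hD =>
    h.length_le D (List.mem_of_mem_head? hD)
  have h1 := select_time_le h.valid htop
  have h2 : runBound n q (N + 1) = runBound n q N + stepBound n q := by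
    simp only [runBound]; ring
  have h3 := h.time_le
  have h4 : stepBound n q = selectBound n q +
    ((3 * n + 2) + n * (availableBound n q + q + 2)) + 1 := rfl
  rcases hd : S.done with _ | _
  · rcases ho : (select S.coloring S.stack.head?).val with _ | C
    · rcases hst : S.stack with _ | ⟨D, st⟩
      · rw [step_end hd ho hst, PMF.mem_support_pure_iff] at hS
        subst hS
        refine ⟨h.valid, h.full, by simp, fun _ => ?_, ?_⟩
        -- With an empty stack the selection is unrestricted, so its failure means that no
        -- bichromatic cycle exists at all.
        · refine holdsAcyclicColoring h.valid h.full fun C hC hcan => ?_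
          refine select_none h.valid ho C hC hcan ?_
          simp [hst, MeetsTop]
        · simp only; omega
      · rw [step_return hd ho hst, PMF.mem_support_pure_iff] at hS
        subst hS
        refine ⟨h.valid, h.full, fun E hE => h.length_le E ?_, by simp, ?_⟩
        · rw [hst]; exact List.mem_cons_of_mem _ hE
        · simp only; omega
    · rw [step_call hd ho, PMF.mem_support_map_iff] at hS
      obtain ⟨τ, hτ, rfl⟩ := hS
      obtain ⟨hb, -⟩ := select_some h.valid ho
      have hlen : C.length ≤ n := by simpa using hb.nodup.length_le_card
      obtain ⟨h5, h6, -⟩ := address_support hq hb h.valid h.full hτ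
      refine ⟨h5, h6, ?_, by simp, ?_⟩
      · intro D hD
        rcases List.mem_cons.1 hD with rfl | hD
        · exact hlen
        · exact h.length_le D hD
      · have := address_time_le hlen hτ
        simp only; omega
  · rw [step_of_done hd, PMF.mem_support_pure_iff] at hS
    subst hS
    exact ⟨h.valid, h.full, h.length_le, h.of_done, by omega⟩

theorem reachable_of_mem_support [DecidableRel G.Adj]
    (hq0 : 2 * G.maxDegree < q ∨ ∀ u v, ¬ G.Adj u v)
    (hq : ∀ τ : Table n q, Valid G τ → ∀ u v, G.Adj u v → (available τ u v).val ≠ [])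
    {N : ℕ} {S : State n q} (hS : S ∈ (run G q N).support) : Reachable G N S := by
  induction N generalizing S with
  | zero =>
    rw [run, PMF.mem_support_pure_iff] at hS
    subst hS
    exact reachable_start hq0
  | succ N ih =>
    rw [run, PMF.mem_support_bind_iff] at hS
    obtain ⟨S₀, h0, h1⟩ := hS
    exact (ih h0).step hq h1

end RecursiveWalk

namespace RecursiveWalk

open Finset

variable {n q : ℕ} {G : SimpleGraph (Fin n)}

/-! ## The weights of the cycles through an edge -/

/-- Cycles of length 2j + 2 contribute at most (2/3)(4dΔ)^j · y² r^(2j) S^(2j+2), and r² ≤ 1/(16dΔ)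
(for dΔ > 0) turns this into a geometric series of ratio S²/4 = 9/25. From j = 2 on it sums to (2/3)
· 1.0201 · 1.44 · 81/400 ≈ 0.1983, just below S − 1 = 1/5. -/
theorem one_add_through_le [DecidableRel G.Adj] {d Δ : ℕ} (hd : IsDegenerate G d)
    (hΔ : G.maxDegree ≤ Δ) {r : NNReal} (hr : r ^ 2 * (16 * (d * Δ)) ≤ 1)
    {t : List (Fin n) → NNReal}
    (ht : ∀ C, t C = (101 / 100) ^ 2 * r ^ (C.length - 2) * (6 / 5) ^ C.length)
    (e : Sym2 (Fin n)) : 1 + through Inc t (evenCycles G) e ≤ 6 / 5 := by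
  classical
  set F := (evenCycles G).filter (Inc e) with hF
  set c : ℝ := 2 / 3 * (101 / 100) ^ 2 * (6 / 5) ^ 2
  have hmem : ∀ C ∈ F, IsEvenCycle G C ∧ e ∈ edgeList C := fun C hC => by
    simpa [hF, Inc] using hC
  have hmaps : ∀ C ∈ F, (C.length - 2) / 2 ∈ Ico 2 (n + 1) := by
    intro C hC
    have h1 := (hmem C hC).1.six_le
    have h2 : C.length ≤ n := by simpa using (hmem C hC).1.nodup.length_le_card
    simp only [mem_Ico]
    omega
  have hfiber : ∀ j ∈ Ico 2 (n + 1), ∑ C ∈ F with (C.length - 2) / 2 = j, (t C : ℝ) ≤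
      c * (9 / 25) ^ j := by
    intro j hj
    have hlen : ∀ C ∈ F, (C.length - 2) / 2 = j → C.length = 2 * j + 2 := by
      intro C hC h
      have h1 := (hmem C hC).1.six_le
      obtain ⟨k, hk⟩ := (hmem C hC).1.even
      omega
    have hcard := card_evenCycles_through_le hd hΔ (mem_Ico.1 hj).1 e
    have hsub : (F.filter fun C => (C.length - 2) / 2 = j).card ≤
        ((evenCycles G).filter fun C => e ∈ edgeList C ∧ C.length = 2 * j + 2).card := by
      refine card_le_card fun C hC => ?_
      rw [mem_filter] at hC
      have := hmem C hC.1
      simp only [mem_filter, mem_evenCycles]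
      exact ⟨this.1, this.2, hlen C hC.1 hC.2⟩
    have hval : ∀ C ∈ F.filter fun C => (C.length - 2) / 2 = j,
        (t C : ℝ) = (101 / 100) ^ 2 * (6 / 5) ^ 2 * ((r : ℝ) ^ 2 * (36 / 25)) ^ j := by
      intro C hC
      rw [mem_filter] at hC
      rw [ht, hlen C hC.1 hC.2, Nat.add_sub_cancel]
      push_cast
      rw [mul_pow, pow_add, pow_mul, pow_mul]
      norm_num
      ring
    rw [sum_congr rfl hval, sum_const, nsmul_eq_mul]
    have h1 : (3 : ℝ) * (F.filter fun C => (C.length - 2) / 2 = j).card ≤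
        2 * (4 * (d * Δ)) ^ j := by
      exact_mod_cast (Nat.mul_le_mul_left 3 hsub).trans hcard
    have h2 : (4 * ((d : ℝ) * Δ)) ^ j * ((r : ℝ) ^ 2 * (36 / 25)) ^ j ≤ (9 / 25) ^ j := by
      rw [← mul_pow]
      refine pow_le_pow_left₀ (by positivity) ?_ j
      have : (r : ℝ) ^ 2 * (16 * (d * Δ)) ≤ 1 := by exact_mod_cast hr
      linarith
    have h3 : (0 : ℝ) ≤ ((r : ℝ) ^ 2 * (36 / 25)) ^ j := by positivity
    have h4 := mul_le_mul_of_nonneg_right h1 h3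
    simp only [c]
    nlinarith
  have hsum : ((through Inc t (evenCycles G) e : NNReal) : ℝ) ≤ 1 / 5 := by
    rw [through]
    push_cast
    rw [show (evenCycles G).filter (Inc e) = F from rfl,
      ← sum_fiberwise_of_maps_to hmaps]
    refine (sum_le_sum hfiber).trans ?_
    rw [← mul_sum]
    have h1 := geom_sum_Ico_le_of_lt_one (m := 2) (n := n + 1)
      (show (0 : ℝ) ≤ 9 / 25 by norm_num) (by norm_num)
    have h2 : (0 : ℝ) ≤ c := by positivity
    refine (mul_le_mul_of_nonneg_left h1 h2).trans ?_
    simp only [c]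
    norm_num
  rw [← NNReal.coe_le_coe]
  push_cast
  linarith

/-! ## The palette -/

theorem paletteSize_ge (d Δ : ℕ) :
    2 * (Δ : ℝ) + 4 * Real.sqrt (d * Δ) ≤ paletteSize d Δ := by
  refine le_trans (le_of_eq ?_) (Nat.le_ceil _)
  rcases Nat.eq_zero_or_pos Δ with rfl | h
  · simp
  · have h0 : (0 : ℝ) < Δ := by exact_mod_cast h
    have h1 : Real.sqrt (d / Δ) * Δ = Real.sqrt (d * Δ) := by
      rw [show (d : ℝ) * Δ = d / Δ * Δ ^ 2 by field_simp, Real.sqrt_mul (by positivity),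
        Real.sqrt_sq h0.le]
    rw [← h1]
    ring

theorem not_adj_of_isDegenerate_zero (hd : IsDegenerate G 0) (u v : Fin n) : ¬ G.Adj u v := by
  intro huv
  obtain ⟨o, ho⟩ := hd
  have key : ∀ v w, G.Adj v w → ¬ o.lt v w := by
    intro v w h1 h2
    have h := ho v
    rw [Nat.cast_zero, nonpos_iff_eq_zero, Set.encard_eq_zero] at h
    exact (Set.ext_iff.1 h w).1 ⟨h1, h2⟩
  rcases o.le_total u v with h | h
  · exact key u v huv (@lt_of_le_of_ne _ o.toPartialOrder _ _ h huv.ne)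
  · exact key v u huv.symm (@lt_of_le_of_ne _ o.toPartialOrder _ _ h huv.ne')

/-- The palette is large enough for the walk. -/
theorem exists_rate [DecidableRel G.Adj] {d Δ : ℕ} (hd : IsDegenerate G d)
    (hΔ : G.maxDegree = Δ) (hq : q = paletteSize d Δ) :
    (2 * G.maxDegree < q ∨ ∀ u v, ¬ G.Adj u v) ∧
    (∀ τ : Table n q, Valid G τ → ∀ u v, G.Adj u v → (available τ u v).val ≠ []) ∧
    ∃ r : NNReal, r ^ 2 * (16 * (d * Δ)) ≤ 1 ∧
      ∀ τ : Table n q, Valid G τ → ∀ u v, G.Adj u v →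
        ((available τ u v).val.length : ℝ≥0∞)⁻¹ ≤ r := by
  by_cases hG : ∀ u v, ¬ G.Adj u v
  -- Without edges the palette may be empty, but nothing is ever drawn and the rate 0 will do.
  · exact ⟨Or.inr hG, fun _ _ u v h => absurd h (hG u v), 0, by simp,
      fun _ _ u v h => absurd h (hG u v)⟩
  push Not at hG
  obtain ⟨a, b, hab⟩ := hG
  have hd0 : 0 < d := Nat.pos_of_ne_zero fun h => by
    subst h
    exact not_adj_of_isDegenerate_zero hd a b hab
  have hΔ0 : 0 < Δ := by
    rw [← hΔ]
    exact lt_of_lt_of_le ((G.degree_pos_iff_exists_adj a).2 ⟨b, hab⟩) (G.degree_le_maxDegree a)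
  have hpos : (0 : ℝ) < d * Δ := by positivity
  have hs : 0 < Real.sqrt (d * Δ) := Real.sqrt_pos.2 hpos
  have hge := paletteSize_ge d Δ
  rw [← hq] at hge
  have hlen : ∀ τ : Table n q, Valid G τ → ∀ u v,
      4 * Real.sqrt (d * Δ) ≤ (available τ u v).val.length := by
    intro τ hτ u v
    have h := hτ.le_length_available u v
    rw [hΔ] at h
    have : (q : ℝ) ≤ (available τ u v).val.length + 2 * Δ := by exact_mod_cast h
    linarith
  -- The rate is the reciprocal of the guaranteed number of choices; its square times 16dΔ is
  -- exactly 1.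
  refine ⟨Or.inl ?_, fun τ hτ u v _ h => ?_, Real.toNNReal (4 * Real.sqrt (d * Δ))⁻¹, ?_,
    fun τ hτ u v _ => ?_⟩
  · rw [hΔ]
    have : (2 * Δ : ℝ) < q := by linarith
    exact_mod_cast this
  · have := hlen τ hτ u v
    rw [h, List.length_nil, Nat.cast_zero] at this
    linarith
  · rw [← NNReal.coe_le_coe]
    push_cast
    rw [Real.coe_toNNReal _ (by positivity), inv_pow, mul_pow, Real.sq_sqrt hpos.le]
    refine le_of_eq ?_
    field_simp
    norm_num
  · have h1 := hlen τ hτ u v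
    rw [ENNReal.inv_le_iff_inv_le, ← ENNReal.ofReal, ENNReal.ofReal_inv_of_pos (by positivity),
      inv_inv]
    exact ENNReal.ofReal_le_of_le_toReal (by simpa using h1)

end RecursiveWalk

namespace RecursiveWalk

open Finset

variable {n q : ℕ} {G : SimpleGraph (Fin n)}

/-! ## Termination -/

theorem tracks_root (σ : Table n q) : Tracks σ [] [⟨none, Finset.univ, ⊥⟩] :=
  ⟨fun _ _ _ _ _ => ⟨fun _ _ _ => mem_univ _, WithBot.bot_lt_coe _⟩, rfl⟩

theorem card_sym2_le (n : ℕ) : Fintype.card (Sym2 (Fin n)) ≤ n ^ 2 := by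
  have := Fintype.card_le_of_surjective (fun p : Fin n × Fin n => s(p.1, p.2)) fun e => by
    induction e with
    | _ u v => exact ⟨(u, v), rfl⟩
  simpa [sq] using this

theorem card_table_le (n q : ℕ) : Fintype.card (Table n q) ≤ 2 ^ (q * n ^ 2) := by
  rw [Fintype.card_fun, Fintype.card_option, Fintype.card_fin, pow_mul]
  exact (Nat.pow_le_pow_right q.succ_pos (card_sym2_le n)).trans
    (Nat.pow_le_pow_left (Nat.lt_two_pow_self) _)

/-- The main loop may charge its calls to any unordered pair of vertices, so its potential has at
most n² edge factors, each at most 2. -/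
theorem framesVal_root_le {y S : NNReal} (hy : y ≤ 2) (hS2 : S ≤ 2)
    {t : List (Fin n) → NNReal} (hS : ∀ e, 1 + through Inc t (evenCycles G) e ≤ S) :
    framesVal G y t [⟨none, Finset.univ, ⊥⟩] ≤ 2 ^ (n ^ 2 + 1) := by
  rw [framesVal, List.map_singleton, List.prod_singleton, frameVal, pow_succ']
  refine mul_le_mul' hy ?_
  calc ∏ e : Sym2 (Fin n), (1 + through Inc t (later G ⊥) e)
      ≤ ∏ _e : Sym2 (Fin n), (2 : NNReal) := prod_le_prod' fun e _ =>
        ((add_le_add_right (through_later_le t ⊥ e) 1).trans (hS e)).trans hS2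
    _ = 2 ^ Fintype.card (Sym2 (Fin n)) := by simp
    _ ≤ 2 ^ n ^ 2 := pow_le_pow_right₀ one_le_two (card_sym2_le n)

/-- A number of steps after which the walk has probably ended. -/
def duration {R : Type*} [CommSemiring R] (n q s : R) : R := 70 * (q * n ^ 2 + (n ^ 2 + 1) + s)

theorem goOn_start_le [DecidableRel G.Adj] {d Δ : ℕ} (hd : IsDegenerate G d)
    (hΔ : G.maxDegree = Δ) (hq : q = paletteSize d Δ) (s : ℕ) :
    goOn (duration n q s) (start G q) ≤ 2⁻¹ ^ s := by
  obtain ⟨hq0, hq1, r, hr1, hr2⟩ := exists_rate hd hΔ hq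
  set N := duration n q s with hN
  have hS := one_add_through_le hd hΔ.le hr1 fun _ => rfl
  have h1 := sum_undone_le (y := 101 / 100) hq1
    ((one_le_div (by norm_num)).2 (by norm_num)) hr2 (fun _ => rfl) hS N
    [⟨none, Finset.univ, ⊥⟩]
  have h0 := reachable_start hq0
  -- The greedy colouring is one of the colourings tracked by the root frame, so its survival
  -- probability is a single term of the sum.
  have h2 : goOn N (start G q) ≤
      ∑ σ ∈ tracked G q [⟨none, Finset.univ, ⊥⟩], undone N σ [] :=
    single_le_sum (f := fun σ => undone N σ []) (fun _ _ => zero_le)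
      (mem_tracked.2 ⟨h0.valid, h0.full, tracks_root _⟩)
  set K := q * n ^ 2 + (n ^ 2 + 1) with hK
  have h3 : (Fintype.card (Table n q) : ℝ≥0∞) * (framesVal G (101 / 100)
      (fun C => (101 / 100) ^ 2 * r ^ (C.length - 2) * (6 / 5) ^ C.length)
      [⟨none, Finset.univ, ⊥⟩] : NNReal) ≤ 2 ^ K := by
    rw [hK, pow_add]
    refine mul_le_mul' ?_ ?_
    · exact_mod_cast card_table_le n q
    · have := framesVal_root_le (y := 101 / 100) (by rw [← NNReal.coe_le_coe]; norm_num)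
        (by rw [← NNReal.coe_le_coe]; norm_num) hS
      exact_mod_cast this
  have h4 : (2 : ℝ≥0∞) ^ (K + s) ≤ ((101 / 100 : NNReal) : ℝ≥0∞) ^ N := by
    -- This is where the factor 70 in `duration` comes from: 1.01^70 ≈ 2.007, so each block of 70
    -- steps halves the bound.
    have h : (2 : NNReal) ≤ (101 / 100) ^ 70 := by
      rw [← NNReal.coe_le_coe]
      norm_num
    have : (2 : NNReal) ^ (K + s) ≤ (101 / 100) ^ N := by
      rw [hN, duration, ← hK, pow_mul]
      exact pow_le_pow_left₀ zero_le h _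
    exact_mod_cast this
  have h5 : (2 : ℝ≥0∞) ^ K * (2 ^ s * goOn N (start G q)) ≤ 2 ^ K * 1 := by
    rw [← mul_assoc, ← pow_add, mul_one]
    exact (mul_le_mul' h4 h2).trans (h1.trans h3)
  have h6 : (2 : ℝ≥0∞) ^ s * goOn N (start G q) ≤ 1 :=
    (ENNReal.mul_le_mul_iff_right (by positivity) (by finiteness)).1 h5
  rw [← ENNReal.inv_pow, ENNReal.le_inv_iff_mul_le, mul_comm]
  exact h6

theorem runBound_mono {n n' q q' N N' : ℕ} (h1 : n ≤ n') (h2 : q ≤ q') (h3 : N ≤ N') :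
    runBound n q N ≤ runBound n' q' N' := by
  unfold runBound stepBound selectBound availableBound
  gcongr

theorem duration_mono {n n' q q' s s' : ℕ} (h1 : n ≤ n') (h2 : q ≤ q') (h3 : s ≤ s') :
    duration n q s ≤ duration n' q' s' := by
  unfold duration
  gcongr

open Polynomial in
/-- The polynomial that bounds the time of the walk. -/
noncomputable def timeBound : Polynomial ℕ := runBound X X (duration X X X)

/-- The bounds are defined over any commutative semiring, so the same formulas serve as numbers and
as polynomials. By monotonicity, n, q and s may all be replaced by their sum. -/
theorem eval_timeBound (m : ℕ) : timeBound.eval m = runBound m m (duration m m m) := by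
  simp [timeBound, runBound, stepBound, selectBound, availableBound, duration]

theorem le_toOuterMeasure_run [DecidableRel G.Adj] {d Δ : ℕ} (hd : IsDegenerate G d)
    (hΔ : G.maxDegree = Δ) (hq : q = paletteSize d Δ) (s : ℕ) :
    1 - (2⁻¹ : ℝ≥0∞) ^ s ≤ (run G q (duration n q s)).toOuterMeasure
      {S | S.done = true ∧ S.time ≤ timeBound.eval (n + q + s) ∧
        HoldsAcyclicColoring G S.coloring} := by
  obtain ⟨hq0, hq1, -⟩ := exists_rate hd hΔ hq
  set N := duration n q s
  set p := run G q N
  set A : Set (State n q) := {S | S.done = true ∧ S.time ≤ timeBound.eval (n + q + s) ∧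
    HoldsAcyclicColoring G S.coloring}
  have hN : ∑' S, p S * goOn 0 S ≤ 2⁻¹ ^ s := by
    rw [tsum_run_mul_goOn]
    exact goOn_start_le hd hΔ hq s
  -- Every reachable state that has ended is good, as correctness and the time bound hold with
  -- certainty; only a walk still in progress can fail.
  have hle : ∀ S, p S ≤ A.indicator p S + p S * goOn 0 S := by
    intro S
    by_cases hS : S ∈ A
    · simp [hS]
    · by_cases hp : p S = 0
      · simp [hp]
      have hR := reachable_of_mem_support hq0 hq1 ((PMF.mem_support_iff _ _).2 hp)
      have hd' : S.done = false := by
        by_contra hc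
        rw [Bool.not_eq_false] at hc
        refine hS ⟨hc, hR.time_le.trans ?_, hR.of_done hc⟩
        rw [eval_timeBound]
        exact runBound_mono (by omega) (by omega)
          (duration_mono (by omega) (by omega) (by omega))
      simp [goOn, hd', undone]
  rw [PMF.toOuterMeasure_apply, tsub_le_iff_right]
  calc 1 = ∑' S, p S := p.tsum_coe.symm
    _ ≤ ∑' S, (A.indicator p S + p S * goOn 0 S) := ENNReal.tsum_le_tsum hle
    _ = ∑' S, A.indicator p S + ∑' S, p S * goOn 0 S := ENNReal.tsum_add
    _ ≤ _ := by gcongr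

end RecursiveWalk

/-! ## Existence of the colouring -/

theorem IsDegenerate.of_iso {V W : Type*} {G : SimpleGraph V} {H : SimpleGraph W} (f : H ≃g G)
    {d : ℕ} (h : IsDegenerate G d) : IsDegenerate H d := by
  obtain ⟨o, ho⟩ := h
  refine ⟨@LinearOrder.lift' _ _ o f f.injective, fun v => ?_⟩
  refine le_trans ?_ (ho (f v))
  rw [← f.injective.encard_image]
  refine Set.encard_le_encard ?_
  rintro _ ⟨w, ⟨h1, h2⟩, rfl⟩
  exact ⟨f.map_adj_iff.2 h1, h2⟩

theorem IsAcyclicEdgeColoring.comap {V W K : Type*} {G : SimpleGraph V} {H : SimpleGraph W}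
    (f : G ≃g H) {c : H.EdgeLabeling K} (hc : IsAcyclicEdgeColoring H c) :
    IsAcyclicEdgeColoring G fun e => c (f.toHom.mapEdgeSet e) := by
  refine ⟨fun e e' hne h => ?_, fun v p hp => ?_⟩
  · obtain ⟨v, h1, h2⟩ := h
    exact hc.1 _ _ (fun h => hne (SimpleGraph.Hom.mapEdgeSet.injective _ f.injective h))
      ⟨f v, Sym2.mem_map.2 ⟨v, h1, rfl⟩, Sym2.mem_map.2 ⟨v, h2, rfl⟩⟩
  · have h := hc.2 _ _ (hp.map f.injective (f := f.toHom))
    convert h using 2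
    ext a
    simp only [colorsOn, Set.mem_ofPred_eq, SimpleGraph.Walk.edges_map, List.mem_map]
    constructor
    · rintro ⟨e, h1, h2⟩
      exact ⟨f.toHom.mapEdgeSet e, ⟨e, h1, rfl⟩, h2⟩
    · rintro ⟨e, ⟨e', h1, h2⟩, h3⟩
      refine ⟨⟨e', p.edges_subset_edgeSet h1⟩, h1, ?_⟩
      rw [← h3]
      congr 1
      exact Subtype.ext h2

theorem exists_isAcyclicEdgeColoring_fin {n : ℕ} (G : SimpleGraph (Fin n)) [DecidableRel G.Adj]
    {d Δ : ℕ} (hd : IsDegenerate G d) (hΔ : G.maxDegree = Δ) :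
    ∃ c : G.EdgeLabeling (Fin (paletteSize d Δ)), IsAcyclicEdgeColoring G c := by
  by_contra hne
  -- With s = 1 the walk succeeds with probability at least 1/2, so the success event cannot be
  -- empty.
  have h := RecursiveWalk.le_toOuterMeasure_run hd hΔ rfl 1
  rw [pow_one, Set.eq_empty_of_forall_notMem (s := {S | _}), MeasureTheory.measure_empty,
    nonpos_iff_eq_zero, tsub_eq_zero_iff_le] at h
  · exact absurd h (by simp)
  · rintro S ⟨-, -, c, hc, -⟩
    exact hne ⟨c, hc⟩

theorem theorem6 :
    (∀ (V : Type*) [Fintype V] (G : SimpleGraph V) [DecidableRel G.Adj] (d Δ : ℕ),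
      IsDegenerate G d → G.maxDegree = Δ →
      ∃ c : G.EdgeLabeling (Fin (paletteSize d Δ)), IsAcyclicEdgeColoring G c) ∧
    (∃ P : Polynomial ℕ,
      ∀ (n : ℕ) (G : SimpleGraph (Fin n)) [DecidableRel G.Adj] (d Δ q : ℕ),
      IsDegenerate G d → G.maxDegree = Δ → q = paletteSize d Δ →
      ∀ s : ℕ, ∃ N : ℕ,
        1 - (2⁻¹ : ℝ≥0∞) ^ s ≤
          (RecursiveWalk.run G q N).toOuterMeasure
            {S | S.done = true ∧ S.time ≤ P.eval (n + q + s) ∧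
              RecursiveWalk.HoldsAcyclicColoring G S.coloring}) := by
  refine ⟨fun V _ G _ d Δ hd hΔ => ?_, RecursiveWalk.timeBound,
    fun n G _ d Δ q hd hΔ hq s => ⟨_, RecursiveWalk.le_toOuterMeasure_run hd hΔ hq s⟩⟩
  classical
  have f : G.map (Fintype.equivFin V).toEmbedding ≃g G :=
    (SimpleGraph.Iso.map (Fintype.equivFin V) G).symm
  obtain ⟨c, hc⟩ := exists_isAcyclicEdgeColoring_fin _ (hd.of_iso f)
    (f.maxDegree_eq.trans hΔ)
  exact ⟨_, hc.comap f.symm⟩
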